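/- Let $\tau$ be the square root of the golden ratio and $s=1/\tau$, so $s^2+s^4=1$. Let $G$ (the golden bee) be the closed hexagon with vertices, in counterclockwise order, $v_0=(0,0)$, $v_1=(s,0)$, $v_2=(s,s^2)$, $v_3=(s^3,s^2)$, $v_4=(s^3,1)$, $v_5=(0,1)$. Isometric copies (reflections allowed) of $sG$ and $s^2G$ are called large and small tiles. A tiling of the plane is a set of tiles (sets homeomorphic to a closed disk) whose union is $\mathbb R^2$, such that the intersection of any two distinct tiles has empty interior and is connected (possibly empty). The sides of the tiles are decorated with arrows (directed segments) of four colours $a,b,c,d$. An arrow of colour $x$ from $p$ to $q$ is written $x\colon p\to q$. In coordinates on $G$, to be scaled by $s$, the large tile carries $c\colon(0,0)\to(s^3,0)$; $d\colon(s^3,0)\to(s,0)$; $a\colon(s,0)\to(s,s^4)$; $b\colon(s,s^4)\to(s,s^2)$; $d\colon v_2\to v_3$; $a\colon v_3\to v_4$; $c\colon v_4\to v_5$; $b\colon(0,2s^4)\to(0,1)$; $a\colon(0,s^4)\to(0,2s^4)$; $a\colon(0,s^4)\to(0,0)$. In coordinates on $G$, to be scaled by $s^2$, the small tile carries $a\colon(0,0)\to(s^3,0)$;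 $b\colon(s^3,0)\to(s,0)$; $c\colon v_2\to v_1$; $b\colon v_2\to v_3$; $d\colon v_3\to v_4$; $a\colon v_4\to v_5$; $c\colon(0,1)\to(0,s^4)$; $d\colon(0,s^4)\to(0,0)$. Isometric copies of a tile carry the transported arrows (this is unambiguous, since $G$ has no nontrivial symmetry). An Ammann(-A2) tiling is a tiling of the plane by large and small tiles obeying the matching rule: whenever two arrows belonging to distinct tiles have more than one point in common, they are the same directed segment and have the same colour. Given an Ammann tiling $T$, a partner of a small tile $t\in T$ is a large tile $b\in T$ such that $t\cup b$ is congruent to $G$. Let $A(T)$ be obtained from $T$ by replacing each small tile and its partner by their union (all other tiles being kept), and let $a(T)=sA(T)=\{su : u\in A(T)\}$. Proposition 4.1. If $T$ is an Ammann tiling, then every small tile of $T$ has exactly one partner, distinct small tiles have distinct partners, and the amalgamation $a(T)$ is again an Ammann tiling. -/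

import Mathlib

open scoped Pointwise

noncomputable section

namespace AmmannA2

/-- The Euclidean plane. -/
abbrev Plane : Type := EuclideanSpace ℝ (Fin 2)

/-- The square root of the golden ratio. -/
def τ : ℝ := Real.sqrt Real.goldenRatio

/-- The scaling factor `s = 1 / τ`, so that `s ^ 4 + s ^ 2 = 1`. -/
def s : ℝ := 1 / τ

/-- The golden bee: the `L`-shaped closed hexagon with vertices
`(0,0), (s,0), (s,s²), (s³,s²), (s³,1), (0,1)`. -/
def G : Set Plane :=
  {p | (0 ≤ p 0 ∧ p 0 ≤ s ∧ 0 ≤ p 1 ∧ p 1 ≤ s ^ 2) ∨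
       (0 ≤ p 0 ∧ p 0 ≤ s ^ 3 ∧ 0 ≤ p 1 ∧ p 1 ≤ 1)}

/-- Two plane sets are congruent if an isometry of the plane (reflections allowed) carries one
onto the other. -/
def Congruent (t u : Set Plane) : Prop := ∃ U : Plane ≃ᵢ Plane, t = U '' u

/-- A large tile is an isometric copy of `sG`. -/
def IsLarge (t : Set Plane) : Prop := Congruent t (s • G)

/-- A small tile is an isometric copy of `s²G`. -/
def IsSmall (t : Set Plane) : Prop := Congruent t (s ^ 2 • G)

/-- A tiling of the plane: a set of tiles (topological closed disks), any two distinct ones of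
which have an intersection with empty interior, whose union is the plane. As a standing
convention the intersection of two distinct tiles is connected, possibly empty. -/
structure IsTiling (T : Set (Set Plane)) : Prop where
  disk : ∀ t ∈ T, Nonempty (t ≃ₜ Metric.closedBall (0 : Plane) 1)
  nonoverlapping : ∀ t ∈ T, ∀ t' ∈ T, t ≠ t' → interior (t ∩ t') = ∅
  covers : ⋃₀ T = Set.univ
  connected : ∀ t ∈ T, ∀ t' ∈ T, t ≠ t' → IsPreconnected (t ∩ t')

/-- The four colours of the side decorations. -/
inductive Color
  | a
  | b
  | c
  | d

/-- A coloured arrow, i.e. a coloured directed segment. -/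
structure Arrow where
  color : Color
  tail : Plane
  head : Plane

/-- The segment underlying an arrow. -/
def Arrow.support (e : Arrow) : Set Plane := segment ℝ e.tail e.head

/-- The image of an arrow under a map of the plane. -/
def Arrow.map (f : Plane → Plane) (e : Arrow) : Arrow := ⟨e.color, f e.tail, f e.head⟩

/-- The decoration of the large tile, drawn on `G` (to be scaled by `s`). The sides of `G` are
listed counterclockwise, starting with the bottom side. -/
def largeDecoration : Set Arrow :=
  { -- bottom side, from (0,0) to (s,0)
    ⟨.c, !₂[0, 0], !₂[s ^ 3, 0]⟩, ⟨.d, !₂[s ^ 3, 0], !₂[s, 0]⟩,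
    -- right side, from (s,0) to (s,s²)
    ⟨.a, !₂[s, 0], !₂[s, s ^ 4]⟩, ⟨.b, !₂[s, s ^ 4], !₂[s, s ^ 2]⟩,
    -- the two sides at the reflex vertex (s³,s²)
    ⟨.d, !₂[s, s ^ 2], !₂[s ^ 3, s ^ 2]⟩,
    ⟨.a, !₂[s ^ 3, s ^ 2], !₂[s ^ 3, 1]⟩,
    -- top side, from (s³,1) to (0,1)
    ⟨.c, !₂[s ^ 3, 1], !₂[0, 1]⟩,
    -- left side; the length of the uppermost arrow is s⁶
    ⟨.b, !₂[0, 2 * s ^ 4], !₂[0, 1]⟩, ⟨.a, !₂[0, s ^ 4], !₂[0, 2 * s ^ 4]⟩,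
    ⟨.a, !₂[0, s ^ 4], !₂[0, 0]⟩ }

/-- The decoration of the small tile, drawn on `G` (to be scaled by `s²`). -/
def smallDecoration : Set Arrow :=
  { -- bottom side, from (0,0) to (s,0)
    ⟨.a, !₂[0, 0], !₂[s ^ 3, 0]⟩, ⟨.b, !₂[s ^ 3, 0], !₂[s, 0]⟩,
    -- right side, from (s,0) to (s,s²)
    ⟨.c, !₂[s, s ^ 2], !₂[s, 0]⟩,
    -- the two sides at the reflex vertex (s³,s²)
    ⟨.b, !₂[s, s ^ 2], !₂[s ^ 3, s ^ 2]⟩,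
    ⟨.d, !₂[s ^ 3, s ^ 2], !₂[s ^ 3, 1]⟩,
    -- top side, from (s³,1) to (0,1)
    ⟨.a, !₂[s ^ 3, 1], !₂[0, 1]⟩,
    -- left side, from (0,1) to (0,0)
    ⟨.c, !₂[0, 1], !₂[0, s ^ 4]⟩, ⟨.d, !₂[0, s ^ 4], !₂[0, 0]⟩ }

/-- The arrows carried by the sides of a large or small tile `t`: the images of the prototile's
arrows under the isometry that carries the prototile onto `t`. (The hexagon `G` has no
nontrivial symmetry, so this isometry is determined by `t`.) -/
def decoration (t : Set Plane) : Set Arrow :=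
  {e | (∃ U : Plane ≃ᵢ Plane, t = U '' (s • G) ∧
          ∃ e₀ ∈ largeDecoration, e = e₀.map (fun p => U (s • p))) ∨
       (∃ U : Plane ≃ᵢ Plane, t = U '' (s ^ 2 • G) ∧
          ∃ e₀ ∈ smallDecoration, e = e₀.map (fun p => U (s ^ 2 • p)))}

/-- The matching rule: whenever arrows of two distinct tiles overlap (in more than one point),
they coincide, together with their colour and direction. -/
def ObeysMatchingRule (T : Set (Set Plane)) : Prop :=
  ∀ t ∈ T, ∀ t' ∈ T, t ≠ t' → ∀ e ∈ decoration t, ∀ e' ∈ decoration t',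
    (e.support ∩ e'.support).Nontrivial → e = e'

/-- An Ammann tiling: a tiling of the plane by large and small tiles that obeys the matching
rule. -/
structure IsAmmannTiling (T : Set (Set Plane)) : Prop where
  tiling : IsTiling T
  tiles : ∀ t ∈ T, IsLarge t ∨ IsSmall t
  matching : ObeysMatchingRule T

/-- The large tile `b` of `T` is a partner of the small tile `t` of `T` if `t ∪ b` is a hexagon
congruent to `G`. -/
structure IsPartner (T : Set (Set Plane)) (t b : Set Plane) : Prop where
  small_mem : t ∈ T
  small : IsSmall t
  large_mem : b ∈ T
  large : IsLarge b
  union : Congruent (t ∪ b) G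

/-- `A(T)`: every small tile of `T` is merged with its partner, and the tiles of `T` that take
part in no such merging are kept. -/
def amalgamated (T : Set (Set Plane)) : Set (Set Plane) :=
  {u | ∃ t b, IsPartner T t b ∧ u = t ∪ b} ∪
  {u | u ∈ T ∧ ∀ t b, IsPartner T t b → u ≠ t ∧ u ≠ b}

/-- The amalgamation `a(T) = sA(T)`. -/
def amalgamation (T : Set (Set Plane)) : Set (Set Plane) :=
  (fun u : Set Plane => s • u) '' amalgamated T

end AmmannA2

end

namespace AmmannA2

/-! ### The number `s` -/

/-! Partners. In an Ammann tiling every arrow of a tile is also an arrow of exactly one other tile,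
which lies on the opposite side of it (`IsAmmannTiling.exists_shared`, `IsAmmannTiling.not_three`).
For the tiling is locally finite, so each point inside an arrow belongs to a second tile; if the
arrow met every foreign arrow in at most one point, countably many tiles could not cover it. Apply
this to the arrow d that starts at the reflex vertex of a small tile. Among the four arrows of
colour d only the one that starts at the convex corner v₂ of a large tile fits into the notch, and
it puts the large tile where the union becomes a bee (`IsAmmannTiling.largePart_mem`). Uniqueness in
both directions holds because a bee can be cut into a small and a large tile in only one way
(`dissect_unique`).

Matching rule. Along the boundaries of the amalgamated tiles the old arrows c and d turn into a and
b, an old a turns into d, and an old a followed by an old b turns into one c of the reverse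
direction. The only possible conflict is an old a that turns into d for the tile on one side and
into a part of c for the tile on the other. `not_becomesD_of_becomesC` excludes it by examining the
arrow b that follows.

Topology. Disks, covering and nonoverlapping are inherited from the given tiling; connected
intersections are not. All tiles have parallel axes (`IsAmmannTiling.parallel`). Two parallel
L-shapes have a connected intersection unless their notches face each other and enclose a
rectangular hole; such a hole would have to contain a whole amalgamated tile, for which it is too
small (`isPreconnected_inter`). -/

theorem s_pos : 0 < s := by
  unfold s τ; have := Real.goldenRatio_pos; positivity

theorem s_sq : s ^ 2 = Real.goldenRatio⁻¹ := by
  unfold s τ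
  rw [div_pow, Real.sq_sqrt Real.goldenRatio_pos.le]; simp

theorem s_pow_four : s ^ 4 = 1 - s ^ 2 := by
  have h : s ^ 4 = (s ^ 2) ^ 2 := by ring
  rw [h, s_sq]
  have h1 := Real.goldenRatio_sq
  have h2 := Real.goldenRatio_pos
  generalize Real.goldenRatio = φ at h1 h2
  field_simp
  linarith

/-- Since s⁴ = 1 − s², every power of s is an integral combination of 1, s, s² and s·s². These
normal forms make comparisons of vertex coordinates linear. -/
theorem s_pow_three : s ^ 3 = s * s ^ 2 := by ring
theorem s_pow_five : s ^ 5 = s - s * s ^ 2 := by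
  have : s ^ 5 = s * s ^ 4 := by ring
  rw [this, s_pow_four]; ring
theorem s_pow_six : s ^ 6 = 2 * s ^ 2 - 1 := by
  have : s ^ 6 = s ^ 2 * s ^ 4 := by ring
  rw [this, s_pow_four]; linarith [s_pow_four, (by ring : s ^ 2 * (1 - s ^ 2) = s ^ 2 - s ^ 4)]
theorem s_pow_eight : s ^ 8 = 2 - 3 * s ^ 2 := by
  have : s ^ 8 = s ^ 4 * s ^ 4 := by ring
  rw [this, s_pow_four]; linarith [s_pow_four, (by ring : (1 - s ^ 2) * (1 - s ^ 2) = 1 - 2 * s ^ 2 + s ^ 4)]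

/-- Numerical bounds for `s ^ 2`, `s` and `s * s ^ 2`, in terms of which all coordinates of
vertices are linear. -/
theorem s_bounds : (0.618 < s ^ 2 ∧ s ^ 2 < 0.6181) ∧ (0.786 < s ∧ s < 0.7863) ∧
    (0.4857 < s * s ^ 2 ∧ s * s ^ 2 < 0.4861) := by
  have h4 := s_pow_four
  have h0 := s_pos
  have hq : 0.618 < s ^ 2 := by
    by_contra h; push Not at h
    nlinarith [sq_nonneg s]
  have hq' : s ^ 2 < 0.6181 := by
    by_contra h; push Not at h
    nlinarith [sq_nonneg s]
  have hs : 0.786 < s := by nlinarith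
  have hs' : s < 0.7863 := by nlinarith
  exact ⟨⟨hq, hq'⟩, ⟨hs, hs'⟩, by nlinarith, by nlinarith⟩

/-! ### Orthonormal frames -/

/-- An orthonormal frame of the plane, based at `c`. -/
@[ext]
structure Frame where
  /-- the origin -/
  c : Plane
  /-- the first axis -/
  u : Plane
  /-- the second axis -/
  v : Plane
  hu : u 0 ^ 2 + u 1 ^ 2 = 1
  hv : v 0 ^ 2 + v 1 ^ 2 = 1
  huv : u 0 * v 0 + u 1 * v 1 = 0

theorem plane_ext {p q : Plane} (h0 : p 0 = q 0) (h1 : p 1 = q 1) : p = q := by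
  ext i; fin_cases i <;> assumption

theorem dist_sq_eq (p q : Plane) : dist p q ^ 2 = (p 0 - q 0) ^ 2 + (p 1 - q 1) ^ 2 := by
  rw [EuclideanSpace.dist_eq, Real.sq_sqrt (by positivity)]
  simp [Fin.sum_univ_two, Real.dist_eq, sq_abs]

namespace Frame

/-- The point with coordinates `x`, `y` in the frame. -/
def pt (F : Frame) (x y : ℝ) : Plane := F.c + x • F.u + y • F.v

/-- The first coordinate in the frame. -/
def X (F : Frame) (p : Plane) : ℝ := (p 0 - F.c 0) * F.u 0 + (p 1 - F.c 1) * F.u 1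

/-- The second coordinate in the frame. -/
def Y (F : Frame) (p : Plane) : ℝ := (p 0 - F.c 0) * F.v 0 + (p 1 - F.c 1) * F.v 1

@[simp] theorem pt_zero (F : Frame) (x y : ℝ) : F.pt x y 0 = F.c 0 + x * F.u 0 + y * F.v 0 := by
  simp [pt]

@[simp] theorem pt_one (F : Frame) (x y : ℝ) : F.pt x y 1 = F.c 1 + x * F.u 1 + y * F.v 1 := by
  simp [pt]

@[simp] theorem X_pt (F : Frame) (x y : ℝ) : F.X (F.pt x y) = x := by
  simp only [X, pt_zero, pt_one]
  linear_combination x * F.hu + y * F.huv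

@[simp] theorem Y_pt (F : Frame) (x y : ℝ) : F.Y (F.pt x y) = y := by
  simp only [Y, pt_zero, pt_one]
  linear_combination x * F.huv + y * F.hv

/-- The second axis is the first one turned by a right angle, up to the sign ε, which is the
determinant of the frame. -/
theorem v_eq (F : Frame) : ∃ ε : ℝ, ε ^ 2 = 1 ∧ F.v 0 = -ε * F.u 1 ∧ F.v 1 = ε * F.u 0 := by
  have hu := F.hu
  have hv := F.hv
  have huv := F.huv
  refine ⟨F.u 0 * F.v 1 - F.u 1 * F.v 0, ?_, ?_, ?_⟩
  · linear_combination (F.v 0 ^ 2 + F.v 1 ^ 2) * hu + hv - (F.u 0 * F.v 0 + F.u 1 * F.v 1) * huv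
  · linear_combination (-F.v 0) * hu + F.u 0 * huv
  · linear_combination (-F.v 1) * hu + F.u 1 * huv

@[simp] theorem pt_X_Y (F : Frame) (p : Plane) : F.pt (F.X p) (F.Y p) = p := by
  obtain ⟨ε, h, h0, h1⟩ := F.v_eq
  have hu := F.hu
  apply plane_ext
  · simp only [X, Y, pt_zero, h0, h1]
    linear_combination (p 0 - F.c 0) * hu + (-F.u 0 * F.u 1 * (p 1 - F.c 1) + F.u 1 ^ 2 * (p 0 - F.c 0)) * h
  · simp only [X, Y, pt_one, h0, h1]
    linear_combination (p 1 - F.c 1) * hu + (F.u 0 ^ 2 * (p 1 - F.c 1) - F.u 0 * F.u 1 * (p 0 - F.c 0)) * h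

theorem pt_inj (F : Frame) {x y x' y' : ℝ} (h : F.pt x y = F.pt x' y') : x = x' ∧ y = y' := by
  constructor
  · simpa using congrArg F.X h
  · simpa using congrArg F.Y h

theorem dist_pt_sq (F : Frame) (x y x' y' : ℝ) :
    dist (F.pt x y) (F.pt x' y') ^ 2 = (x - x') ^ 2 + (y - y') ^ 2 := by
  rw [dist_sq_eq]
  simp only [pt_zero, pt_one]
  linear_combination (x - x') ^ 2 * F.hu + (y - y') ^ 2 * F.hv + 2 * (x - x') * (y - y') * F.huv

theorem dist_sq_coord (F : Frame) (p q : Plane) :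
    dist p q ^ 2 = (F.X p - F.X q) ^ 2 + (F.Y p - F.Y q) ^ 2 := by
  rw [← F.dist_pt_sq, pt_X_Y, pt_X_Y]

@[fun_prop] theorem continuous_X (F : Frame) : Continuous F.X := by unfold X; fun_prop
@[fun_prop] theorem continuous_Y (F : Frame) : Continuous F.Y := by unfold Y; fun_prop
@[fun_prop] theorem continuous_pt (F : Frame) : Continuous (fun q : ℝ × ℝ => F.pt q.1 q.2) := by
  unfold pt; fun_prop

/-- The isometry carrying the standard frame to `F`. -/
noncomputable def iso (F : Frame) : Plane ≃ᵢ Plane :=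
  IsometryEquiv.mk' (fun p => F.pt (p 0) (p 1)) (fun p => !₂[F.X p, F.Y p])
    (fun p => by simp) (Isometry.of_dist_eq fun p q => by
      rw [← sq_eq_sq₀ dist_nonneg dist_nonneg, F.dist_pt_sq, dist_sq_eq])

@[simp] theorem iso_apply (F : Frame) (p : Plane) : F.iso p = F.pt (p 0) (p 1) := rfl

/-- Every isometry of the plane comes from a frame. -/
theorem exists_iso_eq (U : Plane ≃ᵢ Plane) : ∃ F : Frame, F.iso = U := by
  -- By Mazur–Ulam the isometry is affine; its linear part supplies the axes.
  set A := U.toRealAffineIsometryEquiv with hA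
  set L := A.linearIsometryEquiv with hL
  have hUL (p : Plane) : U p = L p + U 0 := by
    have := A.map_vadd 0 p
    simpa [hA] using this
  have hin (p q : Plane) : (L p) 0 * (L q) 0 + (L p) 1 * (L q) 1 = p 0 * q 0 + p 1 * q 1 := by
    have := L.inner_map_map p q
    simp only [PiLp.inner_apply, Fin.sum_univ_two, RCLike.inner_apply, conj_trivial] at this
    linarith
  refine ⟨⟨U 0, L !₂[1, 0], L !₂[0, 1], ?_, ?_, ?_⟩, ?_⟩
  · have := hin !₂[1, 0] !₂[1, 0]; simp at this; linarith
  · have := hin !₂[0, 1] !₂[0, 1]; simp at this; linarith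
  · have := hin !₂[1, 0] !₂[0, 1]; simp at this; linarith
  · ext1 p
    have hp : p = p 0 • !₂[1, 0] + p 1 • !₂[0, 1] := by apply plane_ext <;> simp
    rw [iso_apply, hUL p]
    conv_rhs => rw [hp]
    simp only [pt, map_add, map_smul]
    abel

end Frame

/-! ### Tiles -/

/-- Membership in the golden bee, in coordinates. -/
def InG (x y : ℝ) : Prop := 0 ≤ x ∧ 0 ≤ y ∧ x ≤ s ∧ y ≤ 1 ∧ (x ≤ s ^ 3 ∨ y ≤ s ^ 2)

/-- Membership in the interior of the golden bee, in coordinates. -/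
def InGo (x y : ℝ) : Prop := 0 < x ∧ 0 < y ∧ x < s ∧ y < 1 ∧ (x < s ^ 3 ∨ y < s ^ 2)

theorem InGo.inG {x y : ℝ} (h : InGo x y) : InG x y := by
  obtain ⟨h1, h2, h3, h4, h5⟩ := h
  exact ⟨h1.le, h2.le, h3.le, h4.le, h5.imp le_of_lt le_of_lt⟩

theorem mem_G_iff (p : Plane) : p ∈ G ↔ InG (p 0) (p 1) := by
  have hb := s_bounds
  simp only [G, Set.mem_ofPred_eq, InG, s_pow_three]
  constructor
  · rintro (⟨h1, h2, h3, h4⟩ | ⟨h1, h2, h3, h4⟩)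
    · exact ⟨h1, h3, h2, by linarith, Or.inr h4⟩
    · exact ⟨h1, h3, by linarith, h4, Or.inl h2⟩
  · rintro ⟨h1, h2, h3, h4, h | h⟩
    · exact Or.inr ⟨h1, h, h2, h4⟩
    · exact Or.inl ⟨h1, h3, h2, h⟩

/-- The copy of `r • G` in the frame `F`. -/
def tile (F : Frame) (r : ℝ) : Set Plane := {p | InG (F.X p / r) (F.Y p / r)}

/-- The interior of `tile F r`. -/
def otile (F : Frame) (r : ℝ) : Set Plane := {p | InGo (F.X p / r) (F.Y p / r)}

theorem pt_mem_tile {F : Frame} {r : ℝ} (hr : 0 < r) {x y : ℝ} :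
    F.pt (r * x) (r * y) ∈ tile F r ↔ InG x y := by
  simp [tile, hr.ne']

theorem pt_mem_otile {F : Frame} {r : ℝ} (hr : 0 < r) {x y : ℝ} :
    F.pt (r * x) (r * y) ∈ otile F r ↔ InGo x y := by
  simp [otile, hr.ne']

theorem exists_pt {F : Frame} {r : ℝ} (hr : 0 < r) (p : Plane) :
    ∃ x y, p = F.pt (r * x) (r * y) :=
  ⟨F.X p / r, F.Y p / r, by rw [mul_div_cancel₀ _ hr.ne', mul_div_cancel₀ _ hr.ne', F.pt_X_Y]⟩

theorem iso_image_smul (F : Frame) {r : ℝ} (hr : 0 < r) : F.iso '' (r • G) = tile F r := by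
  ext p
  constructor
  · rintro ⟨_, ⟨q, hq, rfl⟩, rfl⟩
    simpa [tile, hr.ne'] using (mem_G_iff q).1 hq
  · intro hp
    obtain ⟨x, y, rfl⟩ := exists_pt (F := F) hr p
    rw [pt_mem_tile hr] at hp
    exact ⟨r • !₂[x, y], Set.smul_mem_smul_set ((mem_G_iff _).2 (by simpa using hp)), by simp⟩

theorem congruent_smul_iff {t : Set Plane} {r : ℝ} (hr : 0 < r) :
    Congruent t (r • G) ↔ ∃ F, t = tile F r := by
  constructor
  · rintro ⟨U, rfl⟩
    obtain ⟨F, rfl⟩ := Frame.exists_iso_eq U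
    exact ⟨F, iso_image_smul F hr⟩
  · rintro ⟨F, rfl⟩
    exact ⟨F.iso, (iso_image_smul F hr).symm⟩

theorem congruent_G_iff {t : Set Plane} : Congruent t G ↔ ∃ F, t = tile F 1 := by
  rw [← congruent_smul_iff one_pos, one_smul]

theorem otile_subset (F : Frame) (r : ℝ) : otile F r ⊆ tile F r := fun _ h => InGo.inG h

theorem isOpen_otile (F : Frame) (r : ℝ) : IsOpen (otile F r) := by
  have h0 : Continuous fun p => F.X p / r := by fun_prop
  have h1 : Continuous fun p => F.Y p / r := by fun_prop
  refine (isOpen_lt continuous_const h0).inter <| (isOpen_lt continuous_const h1).inter <|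
    (isOpen_lt h0 continuous_const).inter <| (isOpen_lt h1 continuous_const).inter <|
    (isOpen_lt h0 continuous_const).union (isOpen_lt h1 continuous_const)

theorem isClosed_tile (F : Frame) (r : ℝ) : IsClosed (tile F r) := by
  have h0 : Continuous fun p => F.X p / r := by fun_prop
  have h1 : Continuous fun p => F.Y p / r := by fun_prop
  refine (isClosed_le continuous_const h0).inter <| (isClosed_le continuous_const h1).inter <|
    (isClosed_le h0 continuous_const).inter <| (isClosed_le h1 continuous_const).inter <|
    (isClosed_le h0 continuous_const).union (isClosed_le h1 continuous_const)

/-- The star-shapedness of the bee with respect to an interior point. -/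
theorem InG.lineMap_inGo {x y : ℝ} (h : InG x y) {a : ℝ} (ha : 0 < a) (ha1 : a ≤ 1) :
    InGo (x + a * (1 / 4 - x)) (y + a * (1 / 4 - y)) := by
  obtain ⟨hb1, hb2, hb3⟩ := s_bounds
  rw [InG, s_pow_three] at h
  rw [InGo, s_pow_three]
  obtain ⟨h1, h2, h3, h4, h5⟩ := h
  refine ⟨by nlinarith, by nlinarith, by nlinarith, by nlinarith, ?_⟩
  rcases h5 with h5 | h5
  · left; nlinarith
  · right; nlinarith

/-- The bee is star-shaped about (1/4, 1/4), and moving any of its points slightly towards this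
centre brings it into the open part. -/
theorem tile_subset_closure (F : Frame) {r : ℝ} (hr : 0 < r) :
    tile F r ⊆ closure (otile F r) := by
  intro p hp
  obtain ⟨x, y, rfl⟩ := exists_pt (F := F) hr p
  rw [pt_mem_tile hr] at hp
  have hc : Continuous fun a : ℝ => F.pt (r * (x + a * (1 / 4 - x))) (r * (y + a * (1 / 4 - y))) :=
    F.continuous_pt.comp (by fun_prop : Continuous fun a : ℝ =>
      (r * (x + a * (1 / 4 - x)), r * (y + a * (1 / 4 - y))))
  have ht : Filter.Tendsto (fun a : ℝ => F.pt (r * (x + a * (1 / 4 - x)))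
      (r * (y + a * (1 / 4 - y)))) (nhdsWithin 0 (Set.Ioi 0)) (nhds (F.pt (r * x) (r * y))) := by
    have := hc.tendsto 0
    simp only [zero_mul, add_zero] at this
    exact this.mono_left nhdsWithin_le_nhds
  refine mem_closure_of_tendsto ht ?_
  have : Set.Ioc (0 : ℝ) 1 ∈ nhdsWithin (0 : ℝ) (Set.Ioi 0) := Ioc_mem_nhdsGT one_pos
  filter_upwards [this] with a ha
  exact (pt_mem_otile hr).2 (hp.lineMap_inGo ha.1 ha.2)

theorem isPreconnected_otile (F : Frame) {r : ℝ} (hr : 0 < r) : IsPreconnected (otile F r) := by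
  refine isPreconnected_of_forall (F.pt (r * (1 / 4)) (r * (1 / 4))) fun p hp => ?_
  obtain ⟨x, y, rfl⟩ := exists_pt (F := F) hr p
  rw [pt_mem_otile hr] at hp
  have hc : Continuous fun a : ℝ => F.pt (r * (x + a * (1 / 4 - x))) (r * (y + a * (1 / 4 - y))) :=
    F.continuous_pt.comp (by fun_prop : Continuous fun a : ℝ =>
      (r * (x + a * (1 / 4 - x)), r * (y + a * (1 / 4 - y))))
  refine ⟨_ '' Set.Icc (0 : ℝ) 1, ?_, ⟨1, by simp, ?_⟩, ⟨0, by simp, ?_⟩,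
    isPreconnected_Icc.image _ hc.continuousOn⟩
  · rintro _ ⟨a, ⟨h0, h1⟩, rfl⟩
    rw [pt_mem_otile hr]
    rcases h0.eq_or_lt with rfl | h0
    · simpa using hp
    · exact hp.inG.lineMap_inGo h0 h1
  · simp
  · simp

theorem ball_subset_otile (F : Frame) {r : ℝ} (hr : 0 < r) :
    Metric.ball (F.pt (r * (1 / 4)) (r * (1 / 4))) (r / 8) ⊆ otile F r := by
  intro p hp
  obtain ⟨x, y, rfl⟩ := exists_pt (F := F) hr p
  rw [pt_mem_otile hr]
  rw [Metric.mem_ball, ← sq_lt_sq₀ dist_nonneg (by positivity), F.dist_pt_sq] at hp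
  have h : (x - 1 / 4) ^ 2 + (y - 1 / 4) ^ 2 < (1 / 8) ^ 2 := by
    have : r ^ 2 * ((x - 1 / 4) ^ 2 + (y - 1 / 4) ^ 2) < r ^ 2 * (1 / 8) ^ 2 := by linarith
    exact lt_of_mul_lt_mul_left this (by positivity)
  have hx := abs_lt_of_sq_lt_sq' (by linarith [sq_nonneg (y - 1 / 4)] : (x - 1 / 4) ^ 2 < (1 / 8) ^ 2) (by norm_num)
  have hy := abs_lt_of_sq_lt_sq' (by linarith [sq_nonneg (x - 1 / 4)] : (y - 1 / 4) ^ 2 < (1 / 8) ^ 2) (by norm_num)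
  obtain ⟨hb1, hb2, hb3⟩ := s_bounds
  refine ⟨by linarith, by linarith, by linarith, by linarith, Or.inr (by linarith)⟩

/-- Nonoverlapping tiles: the open part of one misses the other. -/
theorem disjoint_otile_tile {F F' : Frame} {r r' : ℝ} (hr' : 0 < r')
    (h : interior (tile F r ∩ tile F' r') = ∅) : Disjoint (otile F r) (tile F' r') := by
  rw [Set.disjoint_left]
  intro p hp hp'
  obtain ⟨q, hq, hq'⟩ := mem_closure_iff.1 (tile_subset_closure F' hr' hp') _ (isOpen_otile F r) hp
  have : q ∈ interior (tile F r ∩ tile F' r') := by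
    refine mem_interior.2 ⟨otile F r ∩ otile F' r', ?_, (isOpen_otile F r).inter (isOpen_otile F' r'), hq, hq'⟩
    exact Set.inter_subset_inter (otile_subset _ _) (otile_subset _ _)
  simp [h] at this

/-! ### Metric rigidity of the golden bee -/

theorem InG.dist_le {x y x' y' : ℝ} (h : InG x y) (h' : InG x' y') :
    (x - x') ^ 2 + (y - y') ^ 2 ≤ 1 + s ^ 2 := by
  obtain ⟨h1, h2, h3, h4, -⟩ := h
  obtain ⟨h1', h2', h3', h4', -⟩ := h'
  have hx : (x - x') ^ 2 ≤ s ^ 2 := sq_le_sq' (by linarith) (by linarith)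
  have hy : (y - y') ^ 2 ≤ 1 ^ 2 := sq_le_sq' (by linarith) (by linarith)
  linarith

/-- The distance is the diagonal of the bounding box s × 1. One of the two diagonals ends at the
corner (s, 1), which the notch cuts off; the other joins v₁ and v₅. -/
theorem InG.eq_of_dist_eq {x y x' y' : ℝ} (h : InG x y) (h' : InG x' y')
    (hd : (x - x') ^ 2 + (y - y') ^ 2 = 1 + s ^ 2) :
    (x = s ∧ y = 0 ∧ x' = 0 ∧ y' = 1) ∨ (x = 0 ∧ y = 1 ∧ x' = s ∧ y' = 0) := by
  obtain ⟨hb1, hb2, hb3⟩ := s_bounds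
  obtain ⟨h1, h2, h3, h4, h5⟩ := h
  obtain ⟨h1', h2', h3', h4', h5'⟩ := h'
  rw [s_pow_three] at h5 h5'
  have hx : (x - x') ^ 2 ≤ s ^ 2 := sq_le_sq' (by linarith) (by linarith)
  have hy : (y - y') ^ 2 ≤ 1 ^ 2 := sq_le_sq' (by linarith) (by linarith)
  have hx' : (x - x') ^ 2 = s ^ 2 := by linarith
  have hy' : (y - y') ^ 2 = 1 ^ 2 := by linarith
  rw [sq_eq_sq_iff_eq_or_eq_neg] at hx' hy'
  rcases hx' with hx' | hx' <;> rcases hy' with hy' | hy'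
  · exfalso; rcases h5 with h5 | h5 <;> linarith
  · left; refine ⟨?_, ?_, ?_, ?_⟩ <;> linarith
  · right; refine ⟨?_, ?_, ?_, ?_⟩ <;> linarith
  · exfalso; rcases h5' with h5 | h5 <;> linarith

/-- The first two points are v₁ and v₅ in some order, and two circles about them leave two
candidates for the third. In the order v₁, v₅ these are v₀ and its mirror image in the line v₁v₅,
which has x > s. In the other order they are the missing corner (s, 1) and a point with x < 0. -/
theorem InG.rigid {xa ya xb yb xc yc : ℝ} (ha : InG xa ya) (hb : InG xb yb) (hc : InG xc yc)
    (hab : (xa - xb) ^ 2 + (ya - yb) ^ 2 = 1 + s ^ 2)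
    (hca : (xc - xa) ^ 2 + (yc - ya) ^ 2 = s ^ 2) (hcb : (xc - xb) ^ 2 + (yc - yb) ^ 2 = 1) :
    xa = s ∧ ya = 0 ∧ xb = 0 ∧ yb = 1 ∧ xc = 0 ∧ yc = 0 := by
  obtain ⟨hb1, hb2, hb3⟩ := s_bounds
  obtain ⟨h1, h2, h3, h4, h5⟩ := hc
  rw [s_pow_three] at h5
  rcases ha.eq_of_dist_eq hb hab with ⟨rfl, rfl, rfl, rfl⟩ | ⟨rfl, rfl, rfl, rfl⟩
  · have hy : yc = s * xc := by linarith
    have : xc * ((1 + s ^ 2) * xc - 2 * s) = 0 := by rw [hy] at hcb; linarith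
    rcases mul_eq_zero.1 this with h | h
    · simp [h, hy]
    · nlinarith
  · have hy : yc = s * xc + 1 - s ^ 2 := by linarith
    have : (xc - s) * ((1 + s ^ 2) * xc + s * (1 - s ^ 2)) = 0 := by rw [hy] at hcb; linarith
    rcases mul_eq_zero.1 this with h | h
    · have : xc = s := by linarith
      subst this
      rcases h5 with h | h <;> nlinarith
    · nlinarith

theorem scaled_dist {r x y x' y' m : ℝ} (hr : 0 < r) :
    (r * x - r * x') ^ 2 + (r * y - r * y') ^ 2 = r ^ 2 * m ↔ (x - x') ^ 2 + (y - y') ^ 2 = m := by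
  rw [show (r * x - r * x') ^ 2 + (r * y - r * y') ^ 2 = r ^ 2 * ((x - x') ^ 2 + (y - y') ^ 2) by ring]
  exact mul_right_inj' (by positivity)

theorem tile_dist_le {F : Frame} {r : ℝ} (hr : 0 < r) {p q : Plane} (hp : p ∈ tile F r)
    (hq : q ∈ tile F r) : dist p q ^ 2 ≤ r ^ 2 * (1 + s ^ 2) := by
  obtain ⟨x, y, rfl⟩ := exists_pt (F := F) hr p
  obtain ⟨x', y', rfl⟩ := exists_pt (F := F) hr q
  rw [pt_mem_tile hr] at hp hq
  rw [F.dist_pt_sq]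
  have := mul_le_mul_of_nonneg_left (hp.dist_le hq) (sq_nonneg r)
  linarith

/-- Three points of a tile with the mutual distances of `v₁`, `v₅`, `v₀` are these vertices. -/
theorem tile_rigid {F : Frame} {r : ℝ} (hr : 0 < r) {a b c : Plane} (ha : a ∈ tile F r)
    (hb : b ∈ tile F r) (hc : c ∈ tile F r) (hab : dist a b ^ 2 = r ^ 2 * (1 + s ^ 2))
    (hca : dist c a ^ 2 = r ^ 2 * s ^ 2) (hcb : dist c b ^ 2 = r ^ 2 * 1) :
    c = F.pt 0 0 ∧ a = F.pt (r * s) 0 ∧ b = F.pt 0 r := by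
  obtain ⟨xa, ya, rfl⟩ := exists_pt (F := F) hr a
  obtain ⟨xb, yb, rfl⟩ := exists_pt (F := F) hr b
  obtain ⟨xc, yc, rfl⟩ := exists_pt (F := F) hr c
  rw [pt_mem_tile hr] at ha hb hc
  rw [F.dist_pt_sq, scaled_dist hr] at hab hca hcb
  obtain ⟨rfl, rfl, rfl, rfl, rfl, rfl⟩ := ha.rigid hb hc hab hca hcb
  simp

theorem Frame.eq_of_pt_eq {F F' : Frame} {r : ℝ} (hr : 0 < r) (h0 : F.pt 0 0 = F'.pt 0 0)
    (h1 : F.pt (r * s) 0 = F'.pt (r * s) 0) (h2 : F.pt 0 r = F'.pt 0 r) : F = F' := by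
  have hs := s_pos
  simp only [Frame.pt, zero_smul, add_zero] at h0 h1 h2
  rw [h0] at h1 h2
  have h1' := smul_right_injective Plane (mul_pos hr hs).ne' (add_left_cancel h1)
  have h2' := smul_right_injective Plane hr.ne' (add_left_cancel h2)
  exact Frame.ext h0 h1' h2'

theorem inG_zero_zero : InG 0 0 := by
  have hb := s_bounds
  exact ⟨le_rfl, le_rfl, by linarith, by norm_num, Or.inr (by linarith)⟩

theorem inG_s_zero : InG s 0 := by
  have hb := s_bounds
  exact ⟨by linarith, le_rfl, le_rfl, by norm_num, Or.inr (by linarith)⟩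

theorem inG_zero_one : InG 0 1 := by
  have hb := s_bounds
  exact ⟨le_rfl, by norm_num, by linarith, le_rfl, Or.inl (by rw [s_pow_three]; linarith)⟩

theorem corner_mem_tile (F : Frame) {r : ℝ} (hr : 0 < r) :
    F.pt 0 0 ∈ tile F r ∧ F.pt (r * s) 0 ∈ tile F r ∧ F.pt 0 r ∈ tile F r := by
  refine ⟨?_, ?_, ?_⟩
  · simpa using (pt_mem_tile (F := F) hr).2 inG_zero_zero
  · simpa using (pt_mem_tile (F := F) hr).2 inG_s_zero
  · simpa using (pt_mem_tile (F := F) hr).2 inG_zero_one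

theorem scale_le_of_tile_subset {F F' : Frame} {r r' : ℝ} (hr : 0 < r) (hr' : 0 < r')
    (h : tile F r ⊆ tile F' r') : r ≤ r' := by
  obtain ⟨-, h1, h2⟩ := corner_mem_tile F hr
  have hd := tile_dist_le hr' (h h1) (h h2)
  rw [F.dist_pt_sq] at hd
  have : r ^ 2 * (1 + s ^ 2) ≤ r' ^ 2 * (1 + s ^ 2) := by linarith
  exact (pow_le_pow_iff_left₀ hr.le hr'.le two_ne_zero).1 (le_of_mul_le_mul_right this (by positivity))

/-- The golden bee has no nontrivial symmetry: a tile determines its size and its frame. -/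
theorem tile_inj {F F' : Frame} {r r' : ℝ} (hr : 0 < r) (hr' : 0 < r')
    (h : tile F r = tile F' r') : F = F' ∧ r = r' := by
  have hrr : r = r' :=
    le_antisymm (scale_le_of_tile_subset hr hr' h.le) (scale_le_of_tile_subset hr' hr h.ge)
  subst hrr
  refine ⟨?_, rfl⟩
  obtain ⟨h0, h1, h2⟩ := corner_mem_tile F hr
  rw [h] at h0 h1 h2
  obtain ⟨e0, e1, e2⟩ := tile_rigid hr h1 h2 h0 (by rw [F.dist_pt_sq]; ring)
    (by rw [F.dist_pt_sq]; ring) (by rw [F.dist_pt_sq]; ring)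
  exact Frame.eq_of_pt_eq hr e0 e1 e2

/-! ### Kinds of tiles and their decorations -/

/-- The two kinds of tiles. -/
inductive Kind
  | large
  | small

namespace Kind

/-- The scaling factor of a kind of tiles. -/
noncomputable def scale : Kind → ℝ
  | large => s
  | small => s ^ 2

/-- The decoration of a kind of tiles. -/
def deco : Kind → Set Arrow
  | large => largeDecoration
  | small => smallDecoration

theorem scale_pos (k : Kind) : 0 < k.scale := by
  have := s_pos
  cases k <;> simp only [scale] <;> positivity

theorem scale_injective : Function.Injective scale := by
  have hb := s_bounds
  intro k k' h
  cases k <;> cases k' <;> simp only [scale] at h <;> first | rfl | linarith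

theorem scale_mem (k : Kind) : s ^ 2 ≤ k.scale ∧ k.scale ≤ s := by
  have hb := s_bounds
  cases k <;> simp only [scale] <;> constructor <;> linarith

end Kind

theorem kind_tile_inj {F F' : Frame} {k k' : Kind} (h : tile F k.scale = tile F' k'.scale) :
    F = F' ∧ k = k' :=
  (tile_inj k.scale_pos k'.scale_pos h).imp_right (@Kind.scale_injective _ _)

theorem isLarge_iff {t : Set Plane} : IsLarge t ↔ ∃ F, t = tile F Kind.large.scale :=
  congruent_smul_iff s_pos

theorem isSmall_iff {t : Set Plane} : IsSmall t ↔ ∃ F, t = tile F Kind.small.scale :=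
  congruent_smul_iff (pow_pos s_pos 2)

/-- The similarity with factor `r` followed by the isometry given by a frame. -/
def Frame.app (F : Frame) (r : ℝ) (p : Plane) : Plane := F.pt (r * p 0) (r * p 1)

/-- A tile determines its kind and its frame (`kind_tile_inj`), so the isometry quantified over in
`decoration` is unique. -/
theorem decoration_tile (F : Frame) (k : Kind) :
    decoration (tile F k.scale) = {e | ∃ e₀ ∈ k.deco, e = e₀.map (F.app k.scale)} := by
  have key (k' : Kind) (U : Plane ≃ᵢ Plane) (h : tile F k.scale = U '' (k'.scale • G)) :
      k' = k ∧ (fun p => U (k'.scale • p)) = F.app k.scale := by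
    obtain ⟨F', rfl⟩ := Frame.exists_iso_eq U
    rw [iso_image_smul F' k'.scale_pos] at h
    obtain ⟨rfl, rfl⟩ := kind_tile_inj h
    refine ⟨rfl, ?_⟩
    funext p
    simp [Frame.app]
  have hF (p : Plane) : F.iso (k.scale • p) = F.app k.scale p := by simp [Frame.app]
  ext e
  constructor
  · rintro (⟨U, h, e₀, he₀, rfl⟩ | ⟨U, h, e₀, he₀, rfl⟩)
    · obtain ⟨rfl, h2⟩ := key .large U h
      exact ⟨e₀, he₀, congrArg (fun f => e₀.map f) h2⟩
    · obtain ⟨rfl, h2⟩ := key .small U h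
      exact ⟨e₀, he₀, congrArg (fun f => e₀.map f) h2⟩
  · rintro ⟨e₀, he₀, rfl⟩
    have h := (iso_image_smul F k.scale_pos).symm
    have h2 : e₀.map (F.app k.scale) = e₀.map (fun p => F.iso (k.scale • p)) :=
      congrArg (fun f => e₀.map f) (funext fun p => (hF p).symm)
    cases k
    · exact Or.inl ⟨F.iso, h, e₀, he₀, h2⟩
    · exact Or.inr ⟨F.iso, h, e₀, he₀, h2⟩

/-! ### Dissection of the bee into a large and a small tile -/

namespace Frame

/-- The frame of the small tile in the dissection of `tile W 1`. -/
noncomputable def smallPart (W : Frame) : Frame where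
  c := W.c + W.v
  u := W.u
  v := -W.v
  hu := W.hu
  hv := by simpa using W.hv
  huv := by have := W.huv; simp only [PiLp.neg_apply]; linarith

/-- The frame of the large tile in the dissection of `tile W 1`. -/
noncomputable def largePart (W : Frame) : Frame where
  c := W.c + s • W.u
  u := W.v
  v := -W.u
  hu := W.hv
  hv := by simpa using W.hu
  huv := by have := W.huv; simp only [PiLp.neg_apply]; linarith

theorem smallPart_pt (W : Frame) (x y : ℝ) : W.smallPart.pt x y = W.pt x (1 - y) := by
  simp only [pt, smallPart]; module

theorem largePart_pt (W : Frame) (x y : ℝ) : W.largePart.pt x y = W.pt (s - y) x := by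
  simp only [pt, largePart]; module

theorem pt_mem_smallPart (W : Frame) {x y : ℝ} :
    W.pt x y ∈ tile W.smallPart (s ^ 2) ↔ InG (x / s ^ 2) ((1 - y) / s ^ 2) := by
  have : W.pt x y = W.smallPart.pt x (1 - y) := by rw [smallPart_pt]; congr 1; ring
  rw [this]
  simp [tile]

theorem pt_mem_largePart (W : Frame) {x y : ℝ} :
    W.pt x y ∈ tile W.largePart s ↔ InG (y / s) ((s - x) / s) := by
  have : W.pt x y = W.largePart.pt y (s - x) := by rw [largePart_pt]; congr 1; ring
  rw [this]
  simp [tile]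

end Frame

/-- The cut is the polygonal line (0, s⁴), (s⁵, s⁴), (s⁵, s²), (s³, s²). -/
theorem inG_dissect (x y : ℝ) :
    InG x y ↔ InG (x / s ^ 2) ((1 - y) / s ^ 2) ∨ InG (y / s) ((s - x) / s) := by
  obtain ⟨hb1, hb2, hb3⟩ := s_bounds
  have hs := s_pos
  have hs2 : 0 < s ^ 2 := pow_pos hs 2
  simp only [InG, le_div_iff₀ hs2, div_le_iff₀ hs2, le_div_iff₀ hs, div_le_iff₀ hs]
  have e1 : s ^ 3 * s ^ 2 = s - s * s ^ 2 := by rw [← s_pow_five]; ring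
  have e2 : s ^ 2 * s ^ 2 = 1 - s ^ 2 := by rw [← s_pow_four]; ring
  have e3 : s ^ 3 * s = 1 - s ^ 2 := by rw [← s_pow_four]; ring
  have e4 : s * s = s ^ 2 := by ring
  have e5 : s ^ 2 * s = s * s ^ 2 := by ring
  simp only [e2, e4, e5, s_pow_three, zero_mul, one_mul]
  constructor
  · rintro ⟨h1, h2, h3, h4, h5⟩
    by_cases hy : y ≤ s ^ 2
    · by_cases hy4 : y ≤ 1 - s ^ 2
      · right; refine ⟨?_, ?_, ?_, ?_, Or.inl ?_⟩ <;> linarith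
      · by_cases hx : x ≤ s - s * s ^ 2
        · left; refine ⟨?_, ?_, ?_, ?_, Or.inl ?_⟩ <;> linarith
        · right; refine ⟨?_, ?_, ?_, ?_, Or.inr ?_⟩ <;> linarith
    · left
      have hx : x ≤ s * s ^ 2 := by rcases h5 with h | h <;> linarith
      refine ⟨?_, ?_, ?_, ?_, Or.inr ?_⟩ <;> linarith
  · rintro (⟨h1, h2, h3, h4, h5⟩ | ⟨h1, h2, h3, h4, h5⟩)
    · exact ⟨by linarith, by linarith, by linarith, by linarith, Or.inl (by linarith)⟩
    · exact ⟨by linarith, by linarith, by linarith, by linarith, Or.inr (by linarith)⟩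

/-- A copy of the bee is the union of a small and a large tile. -/
theorem tile_dissect (W : Frame) :
    tile W.smallPart (s ^ 2) ∪ tile W.largePart s = tile W 1 := by
  ext p
  rw [← W.pt_X_Y p, Set.mem_union, W.pt_mem_smallPart, W.pt_mem_largePart, ← inG_dissect]
  simp [tile]

/-- The dissection of the bee into a small and a large tile is unique. -/
theorem dissect_unique {F F' W : Frame} (h : tile F (s ^ 2) ∪ tile F' s = tile W 1) :
    F = W.smallPart ∧ F' = W.largePart := by
  obtain ⟨hb1, hb2, hb3⟩ := s_bounds
  have hs := s_pos
  have hs2 : 0 < s ^ 2 := pow_pos hs 2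
  have h4 := s_pow_four
  have h6 := s_pow_six
  have h8 := s_pow_eight
  have mem {x y : ℝ} (hxy : InG x y) : W.pt x y ∈ tile F (s ^ 2) ∪ tile F' s := by
    rw [h]; simpa [tile] using hxy
  have far_small {x y x' y' : ℝ} (hp : W.pt x y ∈ tile F (s ^ 2)) (hq : W.pt x' y' ∈ tile F (s ^ 2)) :
      (x - x') ^ 2 + (y - y') ^ 2 ≤ s ^ 2 := by
    have := tile_dist_le hs2 hp hq
    rw [W.dist_pt_sq] at this
    linarith [(by ring : (s ^ 2) ^ 2 * (1 + s ^ 2) = s ^ 4 + s ^ 6)]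
  have far_large {x y x' y' : ℝ} (hp : W.pt x y ∈ tile F' s) (hq : W.pt x' y' ∈ tile F' s) :
      (x - x') ^ 2 + (y - y') ^ 2 ≤ 1 := by
    have := tile_dist_le hs hp hq
    rw [W.dist_pt_sq] at this
    linarith [(by ring : s ^ 2 * (1 + s ^ 2) = s ^ 2 + s ^ 4)]
  have m0 := mem inG_zero_zero
  have m1 := mem inG_s_zero
  have m5 := mem inG_zero_one
  have m2 : W.pt s (s ^ 2) ∈ _ := mem ⟨by linarith, by linarith, le_rfl, by linarith, Or.inr le_rfl⟩
  have m4 : W.pt (s ^ 3) 1 ∈ _ :=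
    mem ⟨by positivity, by linarith, by rw [s_pow_three]; linarith, by linarith, Or.inl le_rfl⟩
  have d40 : 1 < (s ^ 3 - 0) ^ 2 + (1 - 0 : ℝ) ^ 2 := by
    have : 0 < (s ^ 3) ^ 2 := by positivity
    linarith
  have d41 : 1 < (s ^ 3 - s) ^ 2 + (1 - 0 : ℝ) ^ 2 := by
    have : 0 < (s ^ 3 - s) ^ 2 := by
      have : s ^ 3 - s ≠ 0 := by rw [s_pow_three]; linarith
      positivity
    linarith
  have hm : ∀ a : ℝ, Filter.Tendsto (fun ε => W.pt 0 (a + ε)) (nhdsWithin 0 (Set.Ioi 0))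
      (nhds (W.pt 0 a)) := by
    intro a
    have hc : Continuous fun ε : ℝ => W.pt 0 (a + ε) :=
      W.continuous_pt.comp (by fun_prop : Continuous fun ε : ℝ => ((0 : ℝ), a + ε))
    simpa using (hc.tendsto 0).mono_left nhdsWithin_le_nhds
  -- The squared diameters of the two parts are s⁴ + s⁶ = s² and s² + s⁴ = 1. If v₄ is in the small
  -- part, then v₀ and v₁ are too far from it and lie in the large part; v₅ is too far from v₁ and
  -- lies in the small part; v₂ is too far from v₅ and lies in the large part. Now v₂, v₀, v₁ pin
  -- down the large tile.
  rcases m4 with m4 | m4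
  · have m0 : W.pt 0 0 ∈ tile F' s := m0.resolve_left fun h => by linarith [far_small m4 h]
    have m1 : W.pt s 0 ∈ tile F' s := m1.resolve_left fun h => by linarith [far_small m4 h]
    have m5 : W.pt 0 1 ∈ tile F (s ^ 2) := m5.resolve_right fun h => by
      have := far_large m1 h
      linarith
    have m2 : W.pt s (s ^ 2) ∈ tile F' s := m2.resolve_left fun h => by
      have := far_small h m5
      nlinarith
    obtain ⟨e0, e1, e2⟩ := tile_rigid hs m2 m0 m1
      (by rw [W.dist_pt_sq]; ring) (by rw [W.dist_pt_sq]; ring) (by rw [W.dist_pt_sq]; ring)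
    have hF' : F' = W.largePart := by
      refine Frame.eq_of_pt_eq hs ?_ ?_ ?_
      · rw [← e0, W.largePart_pt]; simp
      · rw [← e1, W.largePart_pt]; simp [sq]
      · rw [← e2, W.largePart_pt]; simp
    -- This end of the cut is a limit of points of the left side just above it, which the large tile
    -- misses.
    have m6 : W.pt 0 (s ^ 4) ∈ tile F (s ^ 2) := by
      refine (isClosed_tile F _).mem_of_tendsto (hm (s ^ 4)) ?_
      have : Set.Ioc (0 : ℝ) (s ^ 2) ∈ nhdsWithin (0 : ℝ) (Set.Ioi 0) := Ioc_mem_nhdsGT hs2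
      filter_upwards [this] with ε hε
      refine (mem ?_).resolve_right fun hl => ?_
      · exact ⟨le_rfl, by linarith [hε.1], hs.le, by linarith [hε.2],
          Or.inl (pow_pos hs 3).le⟩
      · rw [hF', W.pt_mem_largePart] at hl
        obtain ⟨-, -, -, -, hl⟩ := hl
        rw [div_le_iff₀ hs, div_le_iff₀ hs] at hl
        rcases hl with hl | hl
        · linarith [hε.1, (by ring : s ^ 3 * s = s ^ 4)]
        · nlinarith
    refine ⟨?_, hF'⟩
    obtain ⟨e0, e1, e2⟩ := tile_rigid hs2 m4 m6 m5
      (by rw [W.dist_pt_sq]; linear_combination (s ^ 4 - s ^ 2 - 1) * h4)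
      (by rw [W.dist_pt_sq]; ring) (by rw [W.dist_pt_sq, h4]; ring)
    refine Frame.eq_of_pt_eq hs2 ?_ ?_ ?_
    · rw [← e0, W.smallPart_pt]; simp
    · rw [← e1, W.smallPart_pt]; congr 1; ring
    · rw [← e2, W.smallPart_pt, h4]
  -- With v₄ in the large part, v₁ and the left side near v₀ are left to the small part. Its
  -- diameter s is exactly the distance from v₁ to v₀, so a point slightly above v₀ is already too
  -- far from v₁.
  · exfalso
    have n0 : W.pt 0 0 ∉ tile F' s := fun h => by linarith [far_large m4 h]
    have m1 : W.pt s 0 ∈ tile F (s ^ 2) := m1.resolve_right fun h => by linarith [far_large m4 h]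
    have hev := (hm 0).eventually ((isClosed_tile F' s).isOpen_compl.eventually_mem
      (show W.pt 0 0 ∈ (tile F' s)ᶜ from n0))
    have : Set.Ioc (0 : ℝ) 1 ∈ nhdsWithin (0 : ℝ) (Set.Ioi 0) := Ioc_mem_nhdsGT one_pos
    obtain ⟨ε, hε, hε'⟩ := (hev.and this).exists
    have hmem : W.pt 0 (0 + ε) ∈ tile F (s ^ 2) := by
      refine (mem ?_).resolve_right hε
      exact ⟨le_rfl, by linarith [hε'.1], hs.le, by linarith [hε'.2], Or.inl (pow_pos hs 3).le⟩
    have := far_small m1 hmem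
    nlinarith [hε'.1]

/-! ### Edges -/

/-- An arrow of a prototile in coordinates on `G`: it runs from `(x, y)` to `(x', y')`, has
length `l`, the unit direction `(a, b)` and the unit normal `(m, n)` pointing into `G`. -/
structure Edge where
  color : Color
  x : ℝ
  y : ℝ
  x' : ℝ
  y' : ℝ
  a : ℝ
  b : ℝ
  m : ℝ
  n : ℝ
  l : ℝ
  unit_dir : a ^ 2 + b ^ 2 = 1
  unit_normal : m ^ 2 + n ^ 2 = 1
  ortho : a * m + b * n = 0
  head_x : x' = x + l * a
  head_y : y' = y + l * b

namespace Edge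

/-- The arrow underlying an edge. -/
def arrow (E : Edge) : Arrow := ⟨E.color, !₂[E.x, E.y], !₂[E.x', E.y']⟩

/-! ### The eighteen edges of the two prototiles -/

noncomputable def largeBottomC : Edge where
  color := .c; x := 0; y := 0; x' := s ^ 3; y' := 0
  a := 1; b := 0; m := 0; n := 1; l := s ^ 3
  unit_dir := by norm_num
  unit_normal := by norm_num
  ortho := by norm_num
  head_x := by ring
  head_y := by ring

noncomputable def largeBottomD : Edge where
  color := .d; x := s ^ 3; y := 0; x' := s; y' := 0
  a := 1; b := 0; m := 0; n := 1; l := s - s ^ 3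
  unit_dir := by norm_num
  unit_normal := by norm_num
  ortho := by norm_num
  head_x := by ring
  head_y := by ring

noncomputable def largeRightA : Edge where
  color := .a; x := s; y := 0; x' := s; y' := s ^ 4
  a := 0; b := 1; m := -1; n := 0; l := s ^ 4
  unit_dir := by norm_num
  unit_normal := by norm_num
  ortho := by norm_num
  head_x := by ring
  head_y := by ring

noncomputable def largeRightB : Edge where
  color := .b; x := s; y := s ^ 4; x' := s; y' := s ^ 2
  a := 0; b := 1; m := -1; n := 0; l := s ^ 2 - s ^ 4
  unit_dir := by norm_num
  unit_normal := by norm_num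
  ortho := by norm_num
  head_x := by ring
  head_y := by ring

noncomputable def largeNotchD : Edge where
  color := .d; x := s; y := s ^ 2; x' := s ^ 3; y' := s ^ 2
  a := -1; b := 0; m := 0; n := -1; l := s - s ^ 3
  unit_dir := by norm_num
  unit_normal := by norm_num
  ortho := by norm_num
  head_x := by ring
  head_y := by ring

noncomputable def largeNotchA : Edge where
  color := .a; x := s ^ 3; y := s ^ 2; x' := s ^ 3; y' := 1
  a := 0; b := 1; m := -1; n := 0; l := 1 - s ^ 2
  unit_dir := by norm_num
  unit_normal := by norm_num
  ortho := by norm_num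
  head_x := by ring
  head_y := by ring

noncomputable def largeTopC : Edge where
  color := .c; x := s ^ 3; y := 1; x' := 0; y' := 1
  a := -1; b := 0; m := 0; n := -1; l := s ^ 3
  unit_dir := by norm_num
  unit_normal := by norm_num
  ortho := by norm_num
  head_x := by ring
  head_y := by ring

noncomputable def largeLeftB : Edge where
  color := .b; x := 0; y := 2 * s ^ 4; x' := 0; y' := 1
  a := 0; b := 1; m := 1; n := 0; l := 1 - 2 * s ^ 4
  unit_dir := by norm_num
  unit_normal := by norm_num
  ortho := by norm_num
  head_x := by ring
  head_y := by ring

noncomputable def largeLeftUpperA : Edge where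
  color := .a; x := 0; y := s ^ 4; x' := 0; y' := 2 * s ^ 4
  a := 0; b := 1; m := 1; n := 0; l := s ^ 4
  unit_dir := by norm_num
  unit_normal := by norm_num
  ortho := by norm_num
  head_x := by ring
  head_y := by ring

noncomputable def largeLeftLowerA : Edge where
  color := .a; x := 0; y := s ^ 4; x' := 0; y' := 0
  a := 0; b := -1; m := 1; n := 0; l := s ^ 4
  unit_dir := by norm_num
  unit_normal := by norm_num
  ortho := by norm_num
  head_x := by ring
  head_y := by ring

noncomputable def smallBottomA : Edge where
  color := .a; x := 0; y := 0; x' := s ^ 3; y' := 0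
  a := 1; b := 0; m := 0; n := 1; l := s ^ 3
  unit_dir := by norm_num
  unit_normal := by norm_num
  ortho := by norm_num
  head_x := by ring
  head_y := by ring

noncomputable def smallBottomB : Edge where
  color := .b; x := s ^ 3; y := 0; x' := s; y' := 0
  a := 1; b := 0; m := 0; n := 1; l := s - s ^ 3
  unit_dir := by norm_num
  unit_normal := by norm_num
  ortho := by norm_num
  head_x := by ring
  head_y := by ring

noncomputable def smallRightC : Edge where
  color := .c; x := s; y := s ^ 2; x' := s; y' := 0
  a := 0; b := -1; m := -1; n := 0; l := s ^ 2
  unit_dir := by norm_num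
  unit_normal := by norm_num
  ortho := by norm_num
  head_x := by ring
  head_y := by ring

noncomputable def smallNotchB : Edge where
  color := .b; x := s; y := s ^ 2; x' := s ^ 3; y' := s ^ 2
  a := -1; b := 0; m := 0; n := -1; l := s - s ^ 3
  unit_dir := by norm_num
  unit_normal := by norm_num
  ortho := by norm_num
  head_x := by ring
  head_y := by ring

noncomputable def smallNotchD : Edge where
  color := .d; x := s ^ 3; y := s ^ 2; x' := s ^ 3; y' := 1
  a := 0; b := 1; m := -1; n := 0; l := 1 - s ^ 2
  unit_dir := by norm_num
  unit_normal := by norm_num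
  ortho := by norm_num
  head_x := by ring
  head_y := by ring

noncomputable def smallTopA : Edge where
  color := .a; x := s ^ 3; y := 1; x' := 0; y' := 1
  a := -1; b := 0; m := 0; n := -1; l := s ^ 3
  unit_dir := by norm_num
  unit_normal := by norm_num
  ortho := by norm_num
  head_x := by ring
  head_y := by ring

noncomputable def smallLeftC : Edge where
  color := .c; x := 0; y := 1; x' := 0; y' := s ^ 4
  a := 0; b := -1; m := 1; n := 0; l := 1 - s ^ 4
  unit_dir := by norm_num
  unit_normal := by norm_num
  ortho := by norm_num
  head_x := by ring
  head_y := by ring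

noncomputable def smallLeftD : Edge where
  color := .d; x := 0; y := s ^ 4; x' := 0; y' := 0
  a := 0; b := -1; m := 1; n := 0; l := s ^ 4
  unit_dir := by norm_num
  unit_normal := by norm_num
  ortho := by norm_num
  head_x := by ring
  head_y := by ring
/-- What is used of the position of an edge: its direction is parallel to an axis, the side of
the normal belongs to `G` and the other side does not. -/
structure Sound (E : Edge) : Prop where
  axis : E.a * E.b = 0
  l_pos : 0 < E.l
  mem : ∀ z, 0 ≤ z → z ≤ E.l → InG (E.x + z * E.a) (E.y + z * E.b)
  inside : ∀ η, 0 < η → η ≤ 1 / 10 →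
    InGo (E.x + E.l / 2 * E.a + η * E.m) (E.y + E.l / 2 * E.b + η * E.n)
  outside : ∀ z, 0 < z → z < E.l → ∀ η, 0 < η → η ≤ 1 / 10 →
    ¬ InG (E.x + z * E.a - η * E.m) (E.y + z * E.b - η * E.n)

end Edge

open Edge

/-- The edges of a kind of tiles. -/
noncomputable def Kind.edges : Kind → List Edge
  | .large => [largeBottomC, largeBottomD, largeRightA, largeRightB, largeNotchD, largeNotchA,
      largeTopC, largeLeftB, largeLeftUpperA, largeLeftLowerA]
  | .small => [smallBottomA, smallBottomB, smallRightC, smallNotchB, smallNotchD, smallTopA,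
      smallLeftC, smallLeftD]

theorem mem_deco_iff {k : Kind} {e : Arrow} : e ∈ k.deco ↔ ∃ E ∈ k.edges, e = E.arrow := by
  cases k
  · simp [Kind.deco, Kind.edges, largeDecoration, Edge.arrow, largeBottomC, largeBottomD,
      largeRightA, largeRightB, largeNotchD, largeNotchA,
      largeTopC, largeLeftB, largeLeftUpperA, largeLeftLowerA]
  · simp [Kind.deco, Kind.edges, smallDecoration, Edge.arrow, smallBottomA, smallBottomB,
      smallRightC, smallNotchB, smallNotchD, smallTopA, smallLeftC, smallLeftD]

set_option maxHeartbeats 1000000 in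
-- eighteen edges, each with a dozen linear inequalities
theorem sound_of_mem {k : Kind} {E : Edge} (hE : E ∈ k.edges) : E.Sound := by
  obtain ⟨hb1, hb2, hb3⟩ := s_bounds
  cases k <;> simp only [Kind.edges, List.mem_cons, List.not_mem_nil, or_false] at hE
  · rcases hE with rfl | rfl | rfl | rfl | rfl | rfl | rfl | rfl | rfl | rfl <;>
    · simp only [largeBottomC, largeBottomD, largeRightA, largeRightB, largeNotchD, largeNotchA,
        largeTopC, largeLeftB, largeLeftUpperA, largeLeftLowerA]
      constructor
      · norm_num
      · simp only [s_pow_three, s_pow_four]; linarith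
      · intro η h h'
        simp only [InG, s_pow_three, s_pow_four] at h' ⊢
        refine ⟨?_, ?_, ?_, ?_, ?_⟩
        all_goals first | linarith | exact Or.inl (by linarith) | exact Or.inr (by linarith)
      · intro η h h'
        simp only [InGo, s_pow_three, s_pow_four]
        refine ⟨?_, ?_, ?_, ?_, ?_⟩
        all_goals first | linarith | exact Or.inl (by linarith) | exact Or.inr (by linarith)
      · simp only [InG, s_pow_three, s_pow_four]
        rintro z hz hz' η h h' ⟨h1, h2, h3, h4, h5⟩
        first | linarith | (rcases h5 with h5 | h5 <;> linarith)
  · rcases hE with rfl | rfl | rfl | rfl | rfl | rfl | rfl | rfl <;>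
    · simp only [smallBottomA, smallBottomB,
        smallRightC, smallNotchB, smallNotchD, smallTopA, smallLeftC, smallLeftD]
      constructor
      · norm_num
      · simp only [s_pow_three, s_pow_four]; linarith
      · intro η h h'
        simp only [InG, s_pow_three, s_pow_four] at h' ⊢
        refine ⟨?_, ?_, ?_, ?_, ?_⟩
        all_goals first | linarith | exact Or.inl (by linarith) | exact Or.inr (by linarith)
      · intro η h h'
        simp only [InGo, s_pow_three, s_pow_four]
        refine ⟨?_, ?_, ?_, ?_, ?_⟩
        all_goals first | linarith | exact Or.inl (by linarith) | exact Or.inr (by linarith)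
      · simp only [InG, s_pow_three, s_pow_four]
        rintro z hz hz' η h h' ⟨h1, h2, h3, h4, h5⟩
        first | linarith | (rcases h5 with h5 | h5 <;> linarith)

/-! ### Boundary points, and the frames along the edges -/

theorem InG.side_of_not_inGo {x y : ℝ} (h : InG x y) (h' : ¬ InGo x y) :
    x = 0 ∨ y = 0 ∨ (x = s ∧ y ≤ s ^ 2) ∨ (y = 1 ∧ x ≤ s ^ 3) ∨ (x = s ^ 3 ∧ s ^ 2 ≤ y) ∨
      (y = s ^ 2 ∧ s ^ 3 ≤ x) := by
  obtain ⟨hb1, hb2, hb3⟩ := s_bounds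
  have h3 := s_pow_three
  obtain ⟨h1, h2, h3, h4, h5⟩ := h
  by_contra hc
  push Not at hc
  obtain ⟨c1, c2, c3, c4, c5, c6⟩ := hc
  apply h'
  refine ⟨h1.lt_of_ne' c1, h2.lt_of_ne' c2, h3.lt_of_ne fun e => ?_, h4.lt_of_ne fun e => ?_, ?_⟩
  · have := c3 e
    rcases h5 with h5 | h5 <;> linarith
  · have := c4 e
    rcases h5 with h5 | h5 <;> linarith
  · rcases h5 with h5 | h5
    · rcases h5.eq_or_lt with h5 | h5
      · exact Or.inr (c5 h5)
      · exact Or.inl h5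
    · rcases h5.eq_or_lt with h5 | h5
      · exact Or.inl (c6 h5)
      · exact Or.inr h5

/-- The edges cover the boundary of the bee. -/
theorem exists_edge_of_boundary (k : Kind) {x y : ℝ} (h : InG x y) (h' : ¬ InGo x y) :
    ∃ E ∈ k.edges, ∃ z, 0 ≤ z ∧ z ≤ E.l ∧ x = E.x + z * E.a ∧ y = E.y + z * E.b := by
  obtain ⟨hb1, hb2, hb3⟩ := s_bounds
  have hside := h.side_of_not_inGo h'
  obtain ⟨h1, h2, h3, h4, -⟩ := h
  have q3 := s_pow_three
  have q4 := s_pow_four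
  cases k
  · rcases hside with e | e | ⟨e, g⟩ | ⟨e, g⟩ | ⟨e, g⟩ | ⟨e, g⟩
    · rcases le_total y (s ^ 4) with g | g
      · exact ⟨largeLeftLowerA, by simp [Kind.edges], s ^ 4 - y, by
          simp only [largeLeftLowerA]; refine ⟨?_, ?_, ?_, ?_⟩ <;> linarith⟩
      · rcases le_total y (2 * s ^ 4) with g | g
        · exact ⟨largeLeftUpperA, by simp [Kind.edges], y - s ^ 4, by
            simp only [largeLeftUpperA]; refine ⟨?_, ?_, ?_, ?_⟩ <;> linarith⟩
        · exact ⟨largeLeftB, by simp [Kind.edges], y - 2 * s ^ 4, by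
            simp only [largeLeftB]; refine ⟨?_, ?_, ?_, ?_⟩ <;> linarith⟩
    · rcases le_total x (s ^ 3) with g | g
      · exact ⟨largeBottomC, by simp [Kind.edges], x, by
          simp only [largeBottomC]; refine ⟨?_, ?_, ?_, ?_⟩ <;> linarith⟩
      · exact ⟨largeBottomD, by simp [Kind.edges], x - s ^ 3, by
          simp only [largeBottomD]; refine ⟨?_, ?_, ?_, ?_⟩ <;> linarith⟩
    · rcases le_total y (s ^ 4) with g' | g'
      · exact ⟨largeRightA, by simp [Kind.edges], y, by
          simp only [largeRightA]; refine ⟨?_, ?_, ?_, ?_⟩ <;> linarith⟩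
      · exact ⟨largeRightB, by simp [Kind.edges], y - s ^ 4, by
          simp only [largeRightB]; refine ⟨?_, ?_, ?_, ?_⟩ <;> linarith⟩
    · exact ⟨largeTopC, by simp [Kind.edges], s ^ 3 - x, by
        simp only [largeTopC]; refine ⟨?_, ?_, ?_, ?_⟩ <;> linarith⟩
    · exact ⟨largeNotchA, by simp [Kind.edges], y - s ^ 2, by
        simp only [largeNotchA]; refine ⟨?_, ?_, ?_, ?_⟩ <;> linarith⟩
    · exact ⟨largeNotchD, by simp [Kind.edges], s - x, by
        simp only [largeNotchD]; refine ⟨?_, ?_, ?_, ?_⟩ <;> linarith⟩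
  · rcases hside with e | e | ⟨e, g⟩ | ⟨e, g⟩ | ⟨e, g⟩ | ⟨e, g⟩
    · rcases le_total y (s ^ 4) with g | g
      · exact ⟨smallLeftD, by simp [Kind.edges], s ^ 4 - y, by
          simp only [smallLeftD]; refine ⟨?_, ?_, ?_, ?_⟩ <;> linarith⟩
      · exact ⟨smallLeftC, by simp [Kind.edges], 1 - y, by
          simp only [smallLeftC]; refine ⟨?_, ?_, ?_, ?_⟩ <;> linarith⟩
    · rcases le_total x (s ^ 3) with g | g
      · exact ⟨smallBottomA, by simp [Kind.edges], x, by
          simp only [smallBottomA]; refine ⟨?_, ?_, ?_, ?_⟩ <;> linarith⟩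
      · exact ⟨smallBottomB, by simp [Kind.edges], x - s ^ 3, by
          simp only [smallBottomB]; refine ⟨?_, ?_, ?_, ?_⟩ <;> linarith⟩
    · exact ⟨smallRightC, by simp [Kind.edges], s ^ 2 - y, by
        simp only [smallRightC]; refine ⟨?_, ?_, ?_, ?_⟩ <;> linarith⟩
    · exact ⟨smallTopA, by simp [Kind.edges], s ^ 3 - x, by
        simp only [smallTopA]; refine ⟨?_, ?_, ?_, ?_⟩ <;> linarith⟩
    · exact ⟨smallNotchD, by simp [Kind.edges], y - s ^ 2, by
        simp only [smallNotchD]; refine ⟨?_, ?_, ?_, ?_⟩ <;> linarith⟩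
    · exact ⟨smallNotchB, by simp [Kind.edges], s - x, by
        simp only [smallNotchB]; refine ⟨?_, ?_, ?_, ?_⟩ <;> linarith⟩

/-- The frame at the tail of an edge of `tile F r`: the first axis is the direction of the edge,
the second one points into the tile. -/
noncomputable def Frame.edge (F : Frame) (r : ℝ) (E : Edge) : Frame where
  c := F.pt (r * E.x) (r * E.y)
  u := E.a • F.u + E.b • F.v
  v := E.m • F.u + E.n • F.v
  hu := by
    simp only [PiLp.add_apply, PiLp.smul_apply, smul_eq_mul]
    linear_combination E.a ^ 2 * F.hu + E.b ^ 2 * F.hv + 2 * E.a * E.b * F.huv + E.unit_dir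
  hv := by
    simp only [PiLp.add_apply, PiLp.smul_apply, smul_eq_mul]
    linear_combination E.m ^ 2 * F.hu + E.n ^ 2 * F.hv + 2 * E.m * E.n * F.huv + E.unit_normal
  huv := by
    simp only [PiLp.add_apply, PiLp.smul_apply, smul_eq_mul]
    linear_combination E.a * E.m * F.hu + E.b * E.n * F.hv + (E.a * E.n + E.b * E.m) * F.huv
      + E.ortho

theorem Frame.edge_pt (F : Frame) (r : ℝ) (E : Edge) (x y : ℝ) :
    (F.edge r E).pt (r * x) (r * y) =
      F.pt (r * (E.x + x * E.a + y * E.m)) (r * (E.y + x * E.b + y * E.n)) := by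
  simp only [Frame.pt, Frame.edge]; module

/-- The arrow of `tile F r` given by an edge. -/
noncomputable def Frame.arrow (F : Frame) (r : ℝ) (E : Edge) : Arrow := E.arrow.map (F.app r)

theorem Frame.arrow_tail' (F : Frame) (r : ℝ) (E : Edge) :
    (F.arrow r E).tail = F.pt (r * E.x) (r * E.y) := by
  simp [Frame.arrow, Arrow.map, Edge.arrow, Frame.app]

theorem Frame.arrow_head' (F : Frame) (r : ℝ) (E : Edge) :
    (F.arrow r E).head = F.pt (r * E.x') (r * E.y') := by
  simp [Frame.arrow, Arrow.map, Edge.arrow, Frame.app]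

theorem Frame.arrow_tail (F : Frame) (r : ℝ) (E : Edge) :
    (F.arrow r E).tail = (F.edge r E).c := F.arrow_tail' r E

theorem Frame.arrow_head (F : Frame) (r : ℝ) (E : Edge) :
    (F.arrow r E).head = (F.edge r E).pt (r * E.l) 0 := by
  have := F.edge_pt r E E.l 0
  rw [mul_zero] at this
  rw [F.arrow_head', this, E.head_x, E.head_y]
  simp

theorem mem_decoration_iff {F : Frame} {k : Kind} {e : Arrow} :
    e ∈ decoration (tile F k.scale) ↔ ∃ E ∈ k.edges, e = F.arrow k.scale E := by
  rw [decoration_tile]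
  constructor
  · rintro ⟨e₀, h, rfl⟩
    obtain ⟨E, hE, rfl⟩ := mem_deco_iff.1 h
    exact ⟨E, hE, rfl⟩
  · rintro ⟨E, hE, rfl⟩
    exact ⟨_, mem_deco_iff.2 ⟨E, hE, rfl⟩, rfl⟩

theorem mem_segment_pt (F : Frame) {l : ℝ} (hl : 0 < l) {p : Plane} :
    p ∈ segment ℝ F.c (F.pt l 0) ↔ ∃ z, 0 ≤ z ∧ z ≤ l ∧ p = F.pt z 0 := by
  rw [segment_eq_image']
  constructor
  · rintro ⟨θ, ⟨h0, h1⟩, rfl⟩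
    refine ⟨θ * l, by positivity, by nlinarith, ?_⟩
    simp only [Frame.pt]; module
  · rintro ⟨z, h0, h1, rfl⟩
    refine ⟨z / l, ⟨by positivity, (div_le_one hl).2 h1⟩, ?_⟩
    have : z • F.u = (z / l) • l • F.u := by rw [smul_smul, div_mul_cancel₀ _ hl.ne']
    simp only [Frame.pt, zero_smul, add_zero, add_sub_cancel_left, this]

theorem Frame.mem_support_arrow {F : Frame} {r : ℝ} (hr : 0 < r) {E : Edge} (hl : 0 < E.l)
    {p : Plane} : p ∈ (F.arrow r E).support ↔
      ∃ z, 0 ≤ z ∧ z ≤ r * E.l ∧ p = (F.edge r E).pt z 0 := by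
  rw [Arrow.support, F.arrow_tail, F.arrow_head, mem_segment_pt _ (mul_pos hr hl)]

/-- Points of a tile outside its open part lie on arrows. -/
theorem exists_arrow_of_not_mem_otile {F : Frame} {k : Kind} {p : Plane}
    (hp : p ∈ tile F k.scale) (hp' : p ∉ otile F k.scale) :
    ∃ E ∈ k.edges, p ∈ (F.arrow k.scale E).support := by
  have hk := k.scale_pos
  obtain ⟨x, y, rfl⟩ := exists_pt (F := F) hk p
  rw [pt_mem_tile hk] at hp
  rw [pt_mem_otile hk] at hp'
  obtain ⟨E, hE, z, h0, h1, rfl, rfl⟩ := exists_edge_of_boundary k hp hp'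
  refine ⟨E, hE, (F.mem_support_arrow hk (sound_of_mem hE).l_pos).2
    ⟨k.scale * z, by positivity, by gcongr, ?_⟩⟩
  have := F.edge_pt k.scale E z 0
  rw [mul_zero] at this
  rw [this]
  simp

/-- The interior points of an arrow of a tile are limits of points outside the tile. -/
theorem arrow_mem_closure_compl {F : Frame} {k : Kind} {E : Edge} (hE : E ∈ k.edges) {z : ℝ}
    (h0 : 0 < z) (h1 : z < k.scale * E.l) :
    (F.edge k.scale E).pt z 0 ∈ closure (tile F k.scale)ᶜ := by
  have hk := k.scale_pos
  obtain ⟨w, rfl⟩ : ∃ w, z = k.scale * w := ⟨z / k.scale, by field_simp⟩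
  have hw0 : 0 < w := pos_of_mul_pos_right h0 hk.le
  have hw1 : w < E.l := lt_of_mul_lt_mul_left h1 hk.le
  have hc : Continuous fun η : ℝ => (F.edge k.scale E).pt (k.scale * w) (k.scale * -η) :=
    (F.edge k.scale E).continuous_pt.comp
      (by fun_prop : Continuous fun η : ℝ => (k.scale * w, k.scale * -η))
  have ht := (hc.tendsto 0).mono_left (nhdsWithin_le_nhds (s := Set.Ioi 0))
  simp only [neg_zero, mul_zero] at ht
  refine mem_closure_of_tendsto ht ?_
  have : Set.Ioc (0 : ℝ) (1 / 10) ∈ nhdsWithin (0 : ℝ) (Set.Ioi 0) := Ioc_mem_nhdsGT (by norm_num)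
  filter_upwards [this] with η hη
  rw [Frame.edge_pt, Set.mem_compl_iff, pt_mem_tile hk]
  have := (sound_of_mem hE).outside w hw0 hw1 η hη.1 hη.2
  simpa [sub_eq_add_neg] using this

theorem Frame.v_eq_or_neg {Φ Ψ : Frame} (h : Φ.u = Ψ.u) : Φ.v = Ψ.v ∨ Φ.v = -Ψ.v := by
  obtain ⟨ε, h1, h2, h3⟩ := Φ.v_eq
  obtain ⟨δ, g1, g2, g3⟩ := Ψ.v_eq
  rw [← h] at g2 g3
  rcases sq_eq_sq_iff_eq_or_eq_neg.1 (h1.trans g1.symm) with rfl | rfl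
  · left; apply plane_ext <;> linarith
  · right; apply plane_ext <;> simp only [PiLp.neg_apply] <;> linarith

theorem Frame.edge_mid_mem_otile (F : Frame) {k : Kind} {E : Edge} (hE : E ∈ k.edges) {η : ℝ}
    (h0 : 0 < η) (h1 : η ≤ s ^ 2 / 10) :
    (F.edge k.scale E).pt (k.scale * E.l / 2) η ∈ otile F k.scale := by
  have hk := k.scale_pos
  obtain ⟨w, rfl⟩ : ∃ w, η = k.scale * w := ⟨η / k.scale, by field_simp⟩
  have hw0 : 0 < w := pos_of_mul_pos_right h0 hk.le
  have hw1 : w ≤ 1 / 10 := by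
    have := k.scale_mem.1
    refine le_of_mul_le_mul_left ?_ hk
    linarith
  rw [mul_div_assoc, F.edge_pt, pt_mem_otile hk]
  exact (sound_of_mem hE).inside w hw0 hw1

theorem Frame.support_arrow_subset (F : Frame) {k : Kind} {E : Edge} (hE : E ∈ k.edges) :
    (F.arrow k.scale E).support ⊆ tile F k.scale := by
  have hk := k.scale_pos
  intro p hp
  obtain ⟨z, h0, h1, rfl⟩ := (F.mem_support_arrow hk (sound_of_mem hE).l_pos).1 hp
  obtain ⟨w, rfl⟩ : ∃ w, z = k.scale * w := ⟨z / k.scale, by field_simp⟩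
  have := F.edge_pt k.scale E w 0
  rw [mul_zero] at this
  rw [this, pt_mem_tile hk]
  simpa using (sound_of_mem hE).mem w (nonneg_of_mul_nonneg_right h0 hk)
    (le_of_mul_le_mul_left h1 hk)

/-! ### Arrows shared by two tiles -/

/-- An arrow determines its tail, length and unit direction, but not the side on which its tile
lies. -/
theorem Frame.edge_eq_of_arrow_eq {F F' : Frame} {k k' : Kind} {E E' : Edge} (hE : E ∈ k.edges)
    (hE' : E' ∈ k'.edges) (h : F'.arrow k'.scale E' = F.arrow k.scale E) :
    k'.scale * E'.l = k.scale * E.l ∧ (F'.edge k'.scale E').c = (F.edge k.scale E).c ∧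
      (F'.edge k'.scale E').u = (F.edge k.scale E).u := by
  have hl : 0 < k.scale * E.l := mul_pos k.scale_pos (sound_of_mem hE).l_pos
  have hl' : 0 < k'.scale * E'.l := mul_pos k'.scale_pos (sound_of_mem hE').l_pos
  have h1 := congrArg Arrow.tail h
  have h2 := congrArg Arrow.head h
  rw [F.arrow_tail, F'.arrow_tail] at h1
  rw [F.arrow_head, F'.arrow_head] at h2
  generalize F.edge k.scale E = Φ at *
  generalize F'.edge k'.scale E' = Φ' at *
  simp only [Frame.pt, zero_smul, add_zero, h1] at h2
  have h3 := add_left_cancel h2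
  have h30 := congrArg (fun p : Plane => p 0) h3
  have h31 := congrArg (fun p : Plane => p 1) h3
  simp only [PiLp.smul_apply, smul_eq_mul] at h30 h31
  have h4 : (k'.scale * E'.l) ^ 2 = (k.scale * E.l) ^ 2 := by
    linear_combination (k'.scale * E'.l * Φ'.u 0 + k.scale * E.l * Φ.u 0) * h30 +
      (k'.scale * E'.l * Φ'.u 1 + k.scale * E.l * Φ.u 1) * h31 -
      (k'.scale * E'.l) ^ 2 * Φ'.hu + (k.scale * E.l) ^ 2 * Φ.hu
  have h5 := (pow_left_inj₀ hl'.le hl.le two_ne_zero).1 h4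
  rw [h5] at h3
  exact ⟨h5, h1, smul_right_injective Plane hl.ne' h3⟩

section Tiling

variable {T : Set (Set Plane)} (hT : IsAmmannTiling T)
include hT

theorem IsAmmannTiling.exists_frame {t : Set Plane} (ht : t ∈ T) :
    ∃ (k : Kind) (F : Frame), t = tile F k.scale := by
  rcases hT.tiles t ht with h | h
  · exact ⟨.large, isLarge_iff.1 h⟩
  · exact ⟨.small, isSmall_iff.1 h⟩

theorem IsAmmannTiling.disjoint {F F' : Frame} {k k' : Kind} (h : tile F k.scale ∈ T)
    (h' : tile F' k'.scale ∈ T) (hne : tile F k.scale ≠ tile F' k'.scale) :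
    Disjoint (otile F k.scale) (tile F' k'.scale) :=
  disjoint_otile_tile k'.scale_pos (hT.tiling.nonoverlapping _ h _ h' hne)

theorem IsAmmannTiling.eq_of_mem {F F' : Frame} {k k' : Kind} (h : tile F k.scale ∈ T)
    (h' : tile F' k'.scale ∈ T) {p : Plane} (hp : p ∈ otile F k.scale)
    (hp' : p ∈ otile F' k'.scale) : tile F k.scale = tile F' k'.scale := by
  by_contra hne
  exact Set.disjoint_left.1 (hT.disjoint h h' hne) hp (otile_subset _ _ hp')

theorem IsAmmannTiling.exists_ball {t : Set Plane} (ht : t ∈ T) :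
    ∃ c, Metric.ball c (s ^ 2 / 8) ⊆ interior t := by
  obtain ⟨k, F, rfl⟩ := hT.exists_frame ht
  refine ⟨_, (Metric.ball_subset_ball ?_).trans ((ball_subset_otile F k.scale_pos).trans
    (interior_maximal (otile_subset _ _) (isOpen_otile _ _)))⟩
  linarith [k.scale_mem.1]

theorem IsAmmannTiling.disjoint_interior {t t' : Set Plane} (ht : t ∈ T) (ht' : t' ∈ T)
    (h : t ≠ t') : Disjoint (interior t) (interior t') := by
  rw [Set.disjoint_iff_inter_eq_empty, ← interior_inter]
  exact hT.tiling.nonoverlapping t ht t' ht' h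

theorem IsAmmannTiling.countable : T.Countable := by
  refine Set.PairwiseDisjoint.countable_of_isOpen (s := interior)
    (fun t ht t' ht' h => hT.disjoint_interior ht ht' h) (fun _ _ => isOpen_interior)
    fun t ht => ?_
  obtain ⟨c, hc⟩ := hT.exists_ball ht
  exact ⟨c, hc (Metric.mem_ball_self (by have := s_pos; positivity))⟩

theorem IsAmmannTiling.dist_le {t : Set Plane} (ht : t ∈ T) {p q : Plane} (hp : p ∈ t)
    (hq : q ∈ t) : dist p q ≤ 2 := by
  obtain ⟨k, F, rfl⟩ := hT.exists_frame ht
  have h := tile_dist_le k.scale_pos hp hq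
  have hb := s_bounds
  have hk := k.scale_mem
  have hk' := k.scale_pos
  by_contra hc
  push Not at hc
  nlinarith

/-- Volume count: the tiles that meet the unit ball about x lie in the ball of radius 4, and they
contain disjoint balls of one fixed radius. -/
theorem IsAmmannTiling.locallyFinite : LocallyFinite (fun t : T => (t : Set Plane)) := by
  intro x
  refine ⟨Metric.ball x 1, Metric.ball_mem_nhds x one_pos, ?_⟩
  have hs := s_pos
  set I := {t : T | ((t : Set Plane) ∩ Metric.ball x 1).Nonempty} with hI
  choose c hc using fun t : T => hT.exists_ball t.2
  have hsub (t : I) : Metric.ball (c t) (s ^ 2 / 8) ⊆ Metric.ball x 4 := by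
    intro p hp
    obtain ⟨q, hq, hq'⟩ := t.2
    have h1 := hT.dist_le t.1.2 (interior_subset (hc t hp)) hq
    have h2 := dist_triangle p q x
    rw [Metric.mem_ball] at hq' ⊢
    linarith
  have hfin := MeasureTheory.Measure.finite_const_le_meas_of_disjoint_iUnion
    (MeasureTheory.volume : MeasureTheory.Measure Plane)
    (ε := MeasureTheory.volume (Metric.ball (0 : Plane) (s ^ 2 / 8)))
    (As := fun t : I => Metric.ball (c t) (s ^ 2 / 8))
    (Metric.measure_ball_pos _ _ (by positivity))
    (fun _ => measurableSet_ball)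
    (fun t t' h => ((hT.disjoint_interior t.1.2 t'.1.2 fun e => h (Subtype.ext (Subtype.ext e))).mono
      (hc t) (hc t')))
    (ne_top_of_le_ne_top (MeasureTheory.measure_ball_lt_top (x := x) (r := 4)).ne
      (MeasureTheory.measure_mono (Set.iUnion_subset hsub)))
  have huniv : {i : I | MeasureTheory.volume (Metric.ball (0 : Plane) (s ^ 2 / 8)) ≤
      MeasureTheory.volume (Metric.ball (c i) (s ^ 2 / 8))} = Set.univ := by
    ext i
    simp
  rw [huniv, Set.finite_univ_iff] at hfin
  exact Set.toFinite I

theorem IsAmmannTiling.isClosed {t : Set Plane} (ht : t ∈ T) : IsClosed t := by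
  obtain ⟨k, F, rfl⟩ := hT.exists_frame ht
  exact isClosed_tile F _

theorem IsAmmannTiling.isClosed_sUnion {S : Set (Set Plane)} (hS : S ⊆ T) : IsClosed (⋃₀ S) := by
  have h : LocallyFinite (fun t : S => (t : Set Plane)) :=
    hT.locallyFinite.comp_injective (g := fun t : S => (⟨t, hS t.2⟩ : T))
      fun t t' e => Subtype.ext (congrArg (fun t : T => (t : Set Plane)) e)
  rw [Set.sUnion_eq_iUnion]
  exact h.isClosed_iUnion fun t => hT.isClosed (hS t.2)

/-- Two distinct tiles without a common arrow meet in a countable set. -/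
theorem IsAmmannTiling.countable_inter {F F' : Frame} {k k' : Kind} (h : tile F k.scale ∈ T)
    (h' : tile F' k'.scale ∈ T) (hne : tile F k.scale ≠ tile F' k'.scale)
    (hs : ∀ E ∈ k.edges, ∀ E' ∈ k'.edges, F'.arrow k'.scale E' ≠ F.arrow k.scale E) :
    (tile F k.scale ∩ tile F' k'.scale).Countable := by
  have hsub : tile F k.scale ∩ tile F' k'.scale ⊆ ⋃ E ∈ {E | E ∈ k.edges},
      ⋃ E' ∈ {E | E ∈ k'.edges}, (F.arrow k.scale E).support ∩ (F'.arrow k'.scale E').support := by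
    rintro p ⟨hp, hp'⟩
    obtain ⟨E, hE, h1⟩ := exists_arrow_of_not_mem_otile hp
      fun ho => Set.disjoint_left.1 (hT.disjoint h h' hne) ho hp'
    obtain ⟨E', hE', h2⟩ := exists_arrow_of_not_mem_otile hp'
      fun ho => Set.disjoint_left.1 (hT.disjoint h' h hne.symm) ho hp
    exact Set.mem_biUnion hE (Set.mem_biUnion hE' ⟨h1, h2⟩)
  refine Set.Countable.mono hsub ?_
  refine (List.finite_toSet _).countable.biUnion fun E hE =>
    (List.finite_toSet _).countable.biUnion fun E' hE' => ?_
  by_contra hc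
  have hnt : ((F.arrow k.scale E).support ∩ (F'.arrow k'.scale E').support).Nontrivial := by
    rw [← Set.not_subsingleton_iff]
    exact fun hsub => hc hsub.finite.countable
  exact hs E hE E' hE' (hT.matching _ h _ h' hne _ (mem_decoration_iff.2 ⟨E, hE, rfl⟩) _
    (mem_decoration_iff.2 ⟨E', hE', rfl⟩) hnt).symm

/-- Every arrow of a tile is also an arrow of another tile. -/
theorem IsAmmannTiling.exists_shared {F : Frame} {k : Kind} {E : Edge} (h : tile F k.scale ∈ T)
    (hE : E ∈ k.edges) : ∃ (F' : Frame) (k' : Kind) (E' : Edge), tile F' k'.scale ∈ T ∧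
      tile F' k'.scale ≠ tile F k.scale ∧ E' ∈ k'.edges ∧
      F'.arrow k'.scale E' = F.arrow k.scale E := by
  by_contra hcon
  push Not at hcon
  have hl : 0 < k.scale * E.l := mul_pos k.scale_pos (sound_of_mem hE).l_pos
  set Φ := F.edge k.scale E with hΦ
  set J : Set Plane := (fun z => Φ.pt z 0) '' Set.Ioo 0 (k.scale * E.l) with hJ
  have hJs : J ⊆ (F.arrow k.scale E).support := by
    rintro _ ⟨z, hz, rfl⟩
    exact (F.mem_support_arrow k.scale_pos (sound_of_mem hE).l_pos).2 ⟨z, hz.1.le, hz.2.le, rfl⟩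
  have hcover : J ⊆ ⋃ t' ∈ T \ {tile F k.scale}, J ∩ t' := by
    -- By local finiteness the union of the other tiles is closed, so it contains all limits of
    -- points outside the given tile.
    have hcl : closure (tile F k.scale)ᶜ ⊆ ⋃₀ (T \ {tile F k.scale}) := by
      refine closure_minimal (fun p hp => ?_) (hT.isClosed_sUnion Set.sdiff_subset)
      obtain ⟨t', ht', hp'⟩ : p ∈ ⋃₀ T := by rw [hT.tiling.covers]; trivial
      refine ⟨t', ⟨ht', fun e => hp ?_⟩, hp'⟩
      rw [← Set.mem_singleton_iff.1 e]
      exact hp'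
    intro p hp
    obtain ⟨z, hz, rfl⟩ := id hp
    obtain ⟨t', ht', hp'⟩ := hcl (arrow_mem_closure_compl (F := F) hE hz.1 hz.2)
    exact Set.mem_biUnion ht' ⟨hp, hp'⟩
  -- A point shared with another tile lies on one of its arrows. If the arrow is not shared, each of
  -- these meets it in at most one point, and there are only countably many tiles.
  have hcount : J.Countable := by
    refine Set.Countable.mono hcover ((hT.countable.mono Set.sdiff_subset).biUnion fun t' ht' => ?_)
    obtain ⟨k', F', rfl⟩ := hT.exists_frame ht'.1
    have hne : tile F k.scale ≠ tile F' k'.scale := fun e => ht'.2 e.symm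
    have hsub : J ∩ tile F' k'.scale ⊆ ⋃ E' ∈ {E | E ∈ k'.edges},
        (F.arrow k.scale E).support ∩ (F'.arrow k'.scale E').support := by
      rintro p ⟨hp, hp'⟩
      obtain ⟨E', hE', h2⟩ := exists_arrow_of_not_mem_otile hp' fun ho =>
        Set.disjoint_left.1 (hT.disjoint ht'.1 h hne.symm) ho (F.support_arrow_subset hE (hJs hp))
      exact Set.mem_biUnion hE' ⟨hJs hp, h2⟩
    refine Set.Countable.mono hsub ((List.finite_toSet _).countable.biUnion fun E' hE' => ?_)
    by_contra hc
    have hnt : ((F.arrow k.scale E).support ∩ (F'.arrow k'.scale E').support).Nontrivial := by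
      rw [← Set.not_subsingleton_iff]
      exact fun hsub => hc hsub.finite.countable
    exact hcon F' k' E' ht'.1 hne.symm hE' (hT.matching _ h _ ht'.1 hne _
      (mem_decoration_iff.2 ⟨E, hE, rfl⟩) _ (mem_decoration_iff.2 ⟨E', hE', rfl⟩) hnt).symm
  have hinj : Set.InjOn (fun z => Φ.pt z 0) (Set.Ioo 0 (k.scale * E.l)) :=
    fun z _ z' _ e => (Φ.pt_inj e).1
  have := Set.countable_of_injective_of_countable_image hinj hcount
  rw [← Cardinal.le_aleph0_iff_set_countable, Cardinal.mk_Ioo_real hl] at this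
  exact this.not_gt Cardinal.aleph0_lt_continuum

/-- Two distinct tiles lie on different sides of a common arrow. -/
theorem IsAmmannTiling.edge_opposite {F F' : Frame} {k k' : Kind} {E E' : Edge}
    (h : tile F k.scale ∈ T) (h' : tile F' k'.scale ∈ T)
    (hne : tile F' k'.scale ≠ tile F k.scale) (hE : E ∈ k.edges) (hE' : E' ∈ k'.edges)
    (ha : F'.arrow k'.scale E' = F.arrow k.scale E) :
    (F'.edge k'.scale E').c = (F.edge k.scale E).c ∧
    (F'.edge k'.scale E').u = (F.edge k.scale E).u ∧
    (F'.edge k'.scale E').v = -(F.edge k.scale E).v := by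
  obtain ⟨hl, hc, hu⟩ := Frame.edge_eq_of_arrow_eq hE hE' ha
  refine ⟨hc, hu, (Frame.v_eq_or_neg hu).resolve_left fun hv => hne ?_⟩
  have hs := s_pos
  -- With equal inward normals, a point just beside the middle of the arrow would be in both open
  -- parts.
  have h1 := F.edge_mid_mem_otile hE (η := s ^ 2 / 10) (by positivity) le_rfl
  have h2 := F'.edge_mid_mem_otile hE' (η := s ^ 2 / 10) (by positivity) le_rfl
  rw [hl, Frame.ext hc hu hv] at h2
  exact hT.eq_of_mem h' h h2 h1

/-- No arrow belongs to three distinct tiles. -/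
theorem IsAmmannTiling.not_three {e : Arrow} {t t' t'' : Set Plane} (ht : t ∈ T) (ht' : t' ∈ T)
    (ht'' : t'' ∈ T) (he : e ∈ decoration t) (he' : e ∈ decoration t') (he'' : e ∈ decoration t'')
    (h1 : t ≠ t') (h2 : t ≠ t'') : t' = t'' := by
  obtain ⟨k, F, rfl⟩ := hT.exists_frame ht
  obtain ⟨k', F', rfl⟩ := hT.exists_frame ht'
  obtain ⟨k'', F'', rfl⟩ := hT.exists_frame ht''
  obtain ⟨E, hE, rfl⟩ := mem_decoration_iff.1 he
  obtain ⟨E', hE', e'⟩ := mem_decoration_iff.1 he'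
  obtain ⟨E'', hE'', e''⟩ := mem_decoration_iff.1 he''
  by_contra h3
  -- Three pairwise opposite unit normals cannot exist: one of them would be its own negative.
  have g1 := (hT.edge_opposite ht ht' h1.symm hE hE' e'.symm).2.2
  have g2 := (hT.edge_opposite ht ht'' h2.symm hE hE'' e''.symm).2.2
  have g3 := (hT.edge_opposite ht' ht'' (Ne.symm h3) hE' hE'' (e''.symm.trans e')).2.2
  rw [g1, g2, neg_neg] at g3
  have hv := (F.edge k.scale E).hv
  have h0 := congrArg (fun p : Plane => p 0) g3
  have h1 := congrArg (fun p : Plane => p 1) g3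
  simp only [PiLp.neg_apply] at h0 h1
  have h0' : (F.edge k.scale E).v 0 = 0 := by linarith
  have h1' : (F.edge k.scale E).v 1 = 0 := by linarith
  rw [h0', h1'] at hv
  norm_num at hv

end Tiling

/-! ### Partners -/

/-- A probe that starts at distance z along the edge and moves by σ along it and by τ' inwards. With
z = 0 and direction (−1, 1) it tests whether the tile continues behind the tail of the edge, as it
does unless the tail is a convex corner. -/
theorem Frame.edge_near_mem_otile (F : Frame) {k : Kind} {E : Edge} {z σ τ' : ℝ}
    (h : ∀ w, 0 < w → w ≤ 1 / 10 → InGo (E.x + (z + w * σ) * E.a + w * τ' * E.m)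
      (E.y + (z + w * σ) * E.b + w * τ' * E.n)) {η : ℝ} (h0 : 0 < η) (h1 : η ≤ s ^ 2 / 10) :
    (F.edge k.scale E).pt (k.scale * z + η * σ) (η * τ') ∈ otile F k.scale := by
  have hk := k.scale_pos
  obtain ⟨w, rfl⟩ : ∃ w, η = k.scale * w := ⟨η / k.scale, by field_simp⟩
  have hw0 : 0 < w := pos_of_mul_pos_right h0 hk.le
  have hw1 : w ≤ 1 / 10 := by
    have := k.scale_mem.1
    refine le_of_mul_le_mul_left ?_ hk
    linarith
  rw [show k.scale * z + k.scale * w * σ = k.scale * (z + w * σ) by ring,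
    show k.scale * w * τ' = k.scale * (w * τ') by ring, F.edge_pt, pt_mem_otile hk]
  exact h w hw0 hw1

/-- Because of this involution, `F.smallPart` also serves as the frame of the bee whose small part
has frame `F`. -/
theorem Frame.smallPart_smallPart (F : Frame) : F.smallPart.smallPart = F := by
  ext1 <;> simp [Frame.smallPart]

/-- `dissect_unique` replaces the congruence with the bee by a common frame, from which either
partner can be recovered. -/
theorem isPartner_iff {T : Set (Set Plane)} {t b : Set Plane} :
    IsPartner T t b ↔ t ∈ T ∧ b ∈ T ∧ ∃ W : Frame, t = tile W.smallPart Kind.small.scale ∧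
      b = tile W.largePart Kind.large.scale := by
  constructor
  · rintro ⟨h1, h2, h3, h4, h5⟩
    obtain ⟨F, rfl⟩ := isSmall_iff.1 h2
    obtain ⟨F', rfl⟩ := isLarge_iff.1 h4
    obtain ⟨W, hW⟩ := congruent_G_iff.1 h5
    obtain ⟨rfl, rfl⟩ := dissect_unique hW
    exact ⟨h1, h3, W, rfl, rfl⟩
  · rintro ⟨h1, h2, W, rfl, rfl⟩
    exact ⟨h1, isSmall_iff.2 ⟨_, rfl⟩, h2, isLarge_iff.2 ⟨_, rfl⟩,
      congruent_G_iff.2 ⟨W, tile_dissect W⟩⟩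

theorem Frame.smallPart_injective : Function.Injective Frame.smallPart :=
  Function.LeftInverse.injective Frame.smallPart_smallPart

theorem Frame.largePart_injective : Function.Injective Frame.largePart := by
  intro W W' h
  have h1 := congrArg Frame.c h
  have h2 := congrArg Frame.u h
  have h3 := congrArg Frame.v h
  simp only [Frame.largePart, neg_inj] at h1 h2 h3
  rw [h3] at h1
  exact Frame.ext (add_right_cancel h1) h3 h2

theorem IsPartner.unique_large {T : Set (Set Plane)} {t b b' : Set Plane} (h : IsPartner T t b)
    (h' : IsPartner T t b') : b = b' := by
  obtain ⟨-, -, W, rfl, rfl⟩ := isPartner_iff.1 h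
  obtain ⟨-, -, W', e, rfl⟩ := isPartner_iff.1 h'
  rw [Frame.smallPart_injective (kind_tile_inj e).1]

theorem IsPartner.unique_small {T : Set (Set Plane)} {t t' b : Set Plane} (h : IsPartner T t b)
    (h' : IsPartner T t' b) : t = t' := by
  obtain ⟨-, -, W, rfl, rfl⟩ := isPartner_iff.1 h
  obtain ⟨-, -, W', rfl, e⟩ := isPartner_iff.1 h'
  rw [Frame.largePart_injective (kind_tile_inj e).1]

theorem Frame.pt_of_opposite {Φ Ψ : Frame} (hc : Ψ.c = Φ.c) (hu : Ψ.u = Φ.u) (hv : Ψ.v = -Φ.v)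
    (x y : ℝ) : Ψ.pt x y = Φ.pt x (-y) := by
  simp only [Frame.pt, hc, hu, hv]; module

/-- The arrow d of the small tile from v₃ to v₄ is shared with a tile on its notch side. That tile
must have a convex corner at v₃, and among the arrows of colour d only `largeNotchD` starts at a
convex corner. -/
theorem IsAmmannTiling.largePart_mem {T : Set (Set Plane)} (hT : IsAmmannTiling T) {F : Frame}
    (h : tile F Kind.small.scale ∈ T) : tile F.smallPart.largePart Kind.large.scale ∈ T := by
  obtain ⟨hb1, hb2, hb3⟩ := s_bounds
  have hE : smallNotchD ∈ Kind.small.edges := by simp [Kind.edges]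
  obtain ⟨F', k', E', h', hne, hE', ha⟩ := hT.exists_shared h hE
  obtain ⟨hc, hu, hv⟩ := hT.edge_opposite h h' hne hE hE' ha
  have hcol : E'.color = .d := congrArg Arrow.color ha
  -- Since the tail is a reflex vertex of the small tile, the diagonal that runs back from it and
  -- across the line of the arrow enters the small tile. A neighbour that also contains this
  -- diagonal would overlap it.
  have key (hback : ∀ w, 0 < w → w ≤ 1 / 10 → InGo (E'.x + (0 + w * -1) * E'.a + w * 1 * E'.m)
      (E'.y + (0 + w * -1) * E'.b + w * 1 * E'.n)) : False := by
    have h1 := F'.edge_near_mem_otile (k := k') hback (η := s ^ 2 / 10) (by linarith) le_rfl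
    have h2 := F.edge_near_mem_otile (k := .small) (E := smallNotchD) (z := 0) (σ := -1) (τ' := -1)
      (by
        intro w hw0 hw1
        simp only [smallNotchD, InGo, s_pow_three]
        refine ⟨?_, ?_, ?_, ?_, Or.inr ?_⟩ <;> linarith) (η := s ^ 2 / 10) (by linarith) le_rfl
    rw [Frame.pt_of_opposite hc hu hv] at h1
    rw [mul_zero] at h1 h2
    refine hne (hT.eq_of_mem h' h h1 ?_)
    convert h2 using 2
    ring
  cases k' <;> simp only [Kind.edges, List.mem_cons, List.not_mem_nil, or_false] at hE'
  · rcases hE' with rfl | rfl | rfl | rfl | rfl | rfl | rfl | rfl | rfl | rfl <;>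
      first | exact absurd hcol (by simp [largeBottomC, largeRightA, largeRightB, largeNotchA,
        largeTopC, largeLeftB, largeLeftUpperA, largeLeftLowerA]) | skip
    · refine (key fun w hw0 hw1 => ?_).elim
      simp only [largeBottomD, InGo, s_pow_three]
      refine ⟨?_, ?_, ?_, ?_, Or.inr ?_⟩ <;> linarith
    -- The remaining case `largeNotchD`: the opposite frames along the common arrow determine the
    -- frame of the large tile.
    · convert h' using 2
      simp only [Frame.edge, largeNotchD, smallNotchD, Frame.pt, Kind.scale] at hc hu hv
      have hu' : F'.u = -F.v := by
        rw [← neg_inj]; simpa using hu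
      have hv' : F'.v = -F.u := by
        rw [← neg_inj]; simpa using hv
      refine Frame.ext ?_ (by simp [Frame.smallPart, Frame.largePart, hu'])
        (by simp [Frame.smallPart, Frame.largePart, hv'])
      simp only [Frame.smallPart, Frame.largePart]
      rw [hu', hv'] at hc
      have e5 : s ^ 2 * s ^ 3 = s - s * s ^ 2 := by rw [← s_pow_five]; ring
      have e4 : s ^ 2 * s ^ 2 = 1 - s ^ 2 := by rw [← s_pow_four]; ring
      rw [e5, e4] at hc
      rw [← sub_eq_zero] at hc ⊢
      rw [← neg_eq_zero, ← hc]
      module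
  · rcases hE' with rfl | rfl | rfl | rfl | rfl | rfl | rfl | rfl <;>
      first | exact absurd hcol (by simp [smallBottomA, smallBottomB, smallRightC, smallNotchB,
        smallTopA, smallLeftC]) | skip
    · refine (key fun w hw0 hw1 => ?_).elim
      simp only [smallNotchD, InGo, s_pow_three]
      refine ⟨?_, ?_, ?_, ?_, Or.inl ?_⟩ <;> linarith
    · refine (key fun w hw0 hw1 => ?_).elim
      simp only [smallLeftD, InGo, s_pow_three, s_pow_four]
      refine ⟨?_, ?_, ?_, ?_, Or.inl ?_⟩ <;> linarith

/-- Every small tile of an Ammann tiling has a partner. -/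
theorem IsAmmannTiling.isPartner {T : Set (Set Plane)} (hT : IsAmmannTiling T) {F : Frame}
    (h : tile F Kind.small.scale ∈ T) :
    IsPartner T (tile F Kind.small.scale) (tile F.smallPart.largePart Kind.large.scale) :=
  isPartner_iff.2 ⟨h, hT.largePart_mem h, F.smallPart, by rw [F.smallPart_smallPart], rfl⟩

/-! ### Arrows of the amalgamated tiles -/

/-- `t` is one of the tiles of `T` of which the tile `X` of `amalgamated T` consists. -/
def IsPart (T : Set (Set Plane)) (X t : Set Plane) : Prop :=
  (∃ b, IsPartner T t b ∧ X = t ∪ b) ∨ (∃ t₀, IsPartner T t₀ t ∧ X = t₀ ∪ t) ∨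
    (X = t ∧ t ∈ T ∧ ∀ t₀ b, IsPartner T t₀ b → t ≠ t₀ ∧ t ≠ b)

theorem IsPartner.not_small {T : Set (Set Plane)} {t b t' : Set Plane} (h : IsPartner T t b)
    (h' : IsPartner T b t') : False := by
  obtain ⟨-, -, W, rfl, rfl⟩ := isPartner_iff.1 h
  obtain ⟨-, -, W', e, rfl⟩ := isPartner_iff.1 h'
  exact Kind.noConfusion (kind_tile_inj e).2

theorem IsPart.mem {T : Set (Set Plane)} {X t : Set Plane} (h : IsPart T X t) : t ∈ T := by
  rcases h with ⟨b, h, -⟩ | ⟨b, h, -⟩ | ⟨-, h, -⟩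
  exacts [h.small_mem, h.large_mem, h]

theorem IsPart.subset {T : Set (Set Plane)} {X t : Set Plane} (h : IsPart T X t) : t ⊆ X := by
  rcases h with ⟨b, -, rfl⟩ | ⟨b, -, rfl⟩ | ⟨rfl, -⟩
  exacts [Set.subset_union_left, Set.subset_union_right, subset_rfl]

/-- Partnership is one-to-one and does not chain, a large tile being no small one, so the merged
pairs are disjoint. -/
theorem IsPart.unique {T : Set (Set Plane)} {X Y t : Set Plane} (h : IsPart T X t)
    (h' : IsPart T Y t) : X = Y := by
  rcases h with ⟨b, h, rfl⟩ | ⟨b, h, rfl⟩ | ⟨rfl, h, hk⟩ <;>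
    rcases h' with ⟨b', h', rfl⟩ | ⟨b', h', rfl⟩ | ⟨rfl, h', hk'⟩
  · rw [h.unique_large h']
  · exact (h'.not_small h).elim
  · exact ((hk' _ _ h).1 rfl).elim
  · exact (h.not_small h').elim
  · rw [h.unique_small h']
  · exact ((hk' _ _ h).2 rfl).elim
  · exact ((hk _ _ h').1 rfl).elim
  · exact ((hk _ _ h').2 rfl).elim
  · rfl

/-- The arrow `f` of the large tile `t` becomes an arrow of colour `d` of the amalgamated
tile `X`. -/
def BecomesD (T : Set (Set Plane)) (X t : Set Plane) (f : Arrow) : Prop :=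
  ∃ F : Frame, t = tile F Kind.large.scale ∧
    (f = F.arrow s largeNotchA ∨ f = F.arrow s largeLeftLowerA ∨
      (f = F.arrow s largeRightA ∧
        ∃ t₂, IsPart T X t₂ ∧ t₂ ≠ t ∧ F.arrow s largeRightB ∈ decoration t₂))

/-- The arrows `f`, `g` of the tile `t`, of colours `a`, `b`, become together a reversed arrow of
colour `c` of an amalgamated tile. -/
def BecomesC (T : Set (Set Plane)) (t : Set Plane) (f g : Arrow) : Prop :=
  ∃ F : Frame,
    (t = tile F Kind.large.scale ∧ (∀ t₀, ¬ IsPartner T t₀ t) ∧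
      f = F.arrow Kind.large.scale largeRightA ∧ g = F.arrow Kind.large.scale largeRightB) ∨
    (t = tile F Kind.large.scale ∧
      f = F.arrow Kind.large.scale largeLeftUpperA ∧ g = F.arrow Kind.large.scale largeLeftB) ∨
    (t = tile F Kind.small.scale ∧
      f = F.arrow Kind.small.scale smallBottomA ∧ g = F.arrow Kind.small.scale smallBottomB)

/-- The three cases have one shape: two consecutive edges on one side of the tile, the second s²
times as long as the first. -/
theorem BecomesC.edges {T : Set (Set Plane)} {t : Set Plane} {f g : Arrow}
    (h : BecomesC T t f g) : ∃ (F : Frame) (k : Kind) (E E' : Edge), t = tile F k.scale ∧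
      E ∈ k.edges ∧ E' ∈ k.edges ∧ f = F.arrow k.scale E ∧ g = F.arrow k.scale E' ∧
      E.color = .a ∧ E'.color = .b ∧ E'.x = E.x' ∧ E'.y = E.y' ∧ E'.a = E.a ∧ E'.b = E.b ∧
      E'.m = E.m ∧ E'.n = E.n ∧ E'.l = s ^ 2 * E.l := by
  have h4 := s_pow_four
  have e4 : s ^ 2 * s ^ 2 = 1 - s ^ 2 := by rw [← s_pow_four]; ring
  have e3 : s ^ 2 * s ^ 3 = s - s ^ 3 := by
    rw [show s ^ 2 * s ^ 3 = s ^ 5 by ring, s_pow_five]; ring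
  obtain ⟨F, ⟨rfl, -, rfl, rfl⟩ | ⟨rfl, rfl, rfl⟩ | ⟨rfl, rfl, rfl⟩⟩ := h
  · refine ⟨F, .large, largeRightA, largeRightB, rfl, by simp [Kind.edges], by simp [Kind.edges],
      rfl, rfl, rfl, rfl, rfl, rfl, rfl, rfl, rfl, rfl, ?_⟩
    simp only [largeRightA, largeRightB, h4, mul_sub, e4]; ring
  · refine ⟨F, .large, largeLeftUpperA, largeLeftB, rfl, by simp [Kind.edges],
      by simp [Kind.edges], rfl, rfl, rfl, rfl, rfl, rfl, rfl, rfl, rfl, rfl, ?_⟩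
    simp only [largeLeftUpperA, largeLeftB, h4, mul_sub, e4]; ring
  · refine ⟨F, .small, smallBottomA, smallBottomB, rfl, by simp [Kind.edges],
      by simp [Kind.edges], rfl, rfl, rfl, rfl, rfl, rfl, rfl, rfl, rfl, rfl, ?_⟩
    simp only [smallBottomA, smallBottomB, e3]

/-- Two successive edges on a side. -/
theorem Frame.edge_succ (F : Frame) (r : ℝ) {E E' : Edge} (hx : E'.x = E.x') (hy : E'.y = E.y')
    (ha : E'.a = E.a) (hb : E'.b = E.b) (hm : E'.m = E.m) (hn : E'.n = E.n) :
    (F.edge r E').c = (F.edge r E).pt (r * E.l) 0 ∧ (F.edge r E').u = (F.edge r E).u ∧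
      (F.edge r E').v = (F.edge r E).v := by
  refine ⟨?_, by simp [Frame.edge, ha, hb], by simp [Frame.edge, hm, hn]⟩
  rw [← F.arrow_head, ← F.arrow_tail, F.arrow_tail', F.arrow_head', hx, hy]

theorem Frame.arrow_succ (F : Frame) (r : ℝ) {E E' : Edge} (hx : E'.x = E.x') (hy : E'.y = E.y')
    (ha : E'.a = E.a) (hb : E'.b = E.b) (hm : E'.m = E.m) (hn : E'.n = E.n)
    (hl : E'.l = s ^ 2 * E.l) :
    (F.arrow r E').tail = (F.arrow r E).head ∧ (F.arrow r E').head =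
      (F.arrow r E).head + s ^ 2 • ((F.arrow r E).head - (F.arrow r E).tail) := by
  obtain ⟨hc, hu, hv⟩ := F.edge_succ r hx hy ha hb hm hn
  refine ⟨by rw [F.arrow_tail, F.arrow_head, hc], ?_⟩
  rw [F.arrow_head, F.arrow_head, F.arrow_tail]
  simp only [Frame.pt, hc, hu, hl]
  module

theorem BecomesC.succ {T : Set (Set Plane)} {t : Set Plane} {f g : Arrow}
    (h : BecomesC T t f g) : f ∈ decoration t ∧ g ∈ decoration t ∧ f.color = .a ∧ g.color = .b ∧
      g.tail = f.head ∧ g.head = f.head + s ^ 2 • (f.head - f.tail) := by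
  obtain ⟨F, k, E, E', rfl, hE, hE', rfl, rfl, ca, cb, hx, hy, ha, hb, hm, hn, hl⟩ := h.edges
  exact ⟨mem_decoration_iff.2 ⟨E, hE, rfl⟩, mem_decoration_iff.2 ⟨E', hE', rfl⟩, ca, cb,
    F.arrow_succ _ hx hy ha hb hm hn hl⟩

theorem Arrow.eq_of {e e' : Arrow} (h1 : e.color = e'.color) (h2 : e.tail = e'.tail)
    (h3 : e.head = e'.head) : e = e' := by
  obtain ⟨_, _, _⟩ := e
  obtain ⟨_, _, _⟩ := e'
  simp_all

/-- In the dissection of the bee, the small and the large tile share an arrow of colour `b`. -/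
theorem largePart_arrow_b (W : Frame) : W.largePart.arrow Kind.large.scale largeRightB =
    W.smallPart.arrow Kind.small.scale smallNotchB := by
  have e5 : s ^ 2 * s ^ 3 = s - s * s ^ 2 := by rw [← s_pow_five]; ring
  have e4 : s ^ 2 * s ^ 2 = 1 - s ^ 2 := by rw [← s_pow_four]; ring
  refine Arrow.eq_of rfl ?_ ?_
  · rw [Frame.arrow_tail', Frame.arrow_tail', W.largePart_pt, W.smallPart_pt]
    simp only [largeRightB, smallNotchB, Kind.scale, s_pow_four, e4]
    congr 1 <;> ring
  · rw [Frame.arrow_head', Frame.arrow_head', W.largePart_pt, W.smallPart_pt]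
    simp only [largeRightB, smallNotchB, Kind.scale, e4, e5]
    congr 1; ring

/-- Let the arrow `E` of colour `a` of a large tile end at a convex corner. A tile on the same side
with an arrow of colour `b` that continues `E` is small, and this arrow is in its notch. -/
theorem shared_b_of_corner {T : Set (Set Plane)} (hT : IsAmmannTiling T) {F F' : Frame}
    {k' : Kind} {E E' : Edge} (h : tile F Kind.large.scale ∈ T) (h' : tile F' k'.scale ∈ T)
    (hE : E = largeNotchA ∨ E = largeLeftLowerA) (hE' : E' ∈ k'.edges) (hcol : E'.color = .b)
    (hpt : ∀ x y, (F'.edge k'.scale E').pt x y =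
      (F.edge Kind.large.scale E).pt (Kind.large.scale * E.l + x) y) :
    k' = .small ∧ E' = smallNotchB := by
  obtain ⟨hb1, hb2, hb3⟩ := s_bounds
  -- Unless `E'` starts at a convex corner of its tile, that tile reaches back around the corner
  -- into the large tile, hence equals it.
  have key (hback : ∀ w, 0 < w → w ≤ 1 / 10 → InGo (E'.x + (0 + w * -1) * E'.a + w * 1 * E'.m)
      (E'.y + (0 + w * -1) * E'.b + w * 1 * E'.n)) :
      F' = F ∧ k' = .large := by
    have h1 := F'.edge_near_mem_otile (k := k') hback (η := s ^ 2 / 10) (by linarith) le_rfl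
    have h2 := F.edge_near_mem_otile (k := .large) (E := E) (z := E.l) (σ := -1) (τ' := 1)
      (by
        intro w hw0 hw1
        rcases hE with rfl | rfl
        · simp only [largeNotchA, InGo, s_pow_three]
          refine ⟨?_, ?_, ?_, ?_, Or.inl ?_⟩ <;> linarith
        · simp only [largeLeftLowerA, InGo, s_pow_three]
          refine ⟨?_, ?_, ?_, ?_, Or.inl ?_⟩ <;> linarith) (η := s ^ 2 / 10) (by linarith) le_rfl
    rw [hpt, mul_zero, zero_add] at h1
    exact kind_tile_inj (hT.eq_of_mem h' h h1 h2)
  -- In the case of equality the arrow b would start at the head of `E`, at v₄ or v₀, where no arrow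
  -- b of the large tile starts.
  have tails (hF : F' = F) (hk : k' = .large) : E'.x = E.x' ∧ E'.y = E.y' := by
    subst hF hk
    have h0 := hpt 0 0
    rw [add_zero, ← Frame.arrow_head, Frame.pt, zero_smul, add_zero, zero_smul, add_zero,
      ← Frame.arrow_tail, Frame.arrow_head', Frame.arrow_tail'] at h0
    obtain ⟨hx, hy⟩ := F'.pt_inj h0
    exact ⟨mul_left_cancel₀ (Kind.scale_pos _).ne' hx, mul_left_cancel₀ (Kind.scale_pos _).ne' hy⟩
  cases k' <;> simp only [Kind.edges, List.mem_cons, List.not_mem_nil, or_false] at hE'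
  · exfalso
    rcases hE' with rfl | rfl | rfl | rfl | rfl | rfl | rfl | rfl | rfl | rfl <;>
      first | exact absurd hcol (by simp [largeBottomC, largeBottomD, largeRightA, largeNotchD,
        largeNotchA, largeTopC, largeLeftUpperA, largeLeftLowerA]) | skip
    · obtain ⟨hF, hk⟩ := key fun w hw0 hw1 => by
        simp only [largeRightB, InGo, s_pow_three, s_pow_four]
        refine ⟨?_, ?_, ?_, ?_, Or.inr ?_⟩ <;> linarith
      obtain ⟨hx, -⟩ := tails hF hk
      rcases hE with rfl | rfl <;>
        simp only [largeRightB, largeNotchA, largeLeftLowerA, s_pow_three] at hx <;> linarith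
    · obtain ⟨hF, hk⟩ := key fun w hw0 hw1 => by
        simp only [largeLeftB, InGo, s_pow_three, s_pow_four]
        refine ⟨?_, ?_, ?_, ?_, Or.inl ?_⟩ <;> linarith
      obtain ⟨hx, hy⟩ := tails hF hk
      rcases hE with rfl | rfl <;>
        simp only [largeLeftB, largeNotchA, largeLeftLowerA, s_pow_three, s_pow_four] at hx hy <;>
        linarith
  · rcases hE' with rfl | rfl | rfl | rfl | rfl | rfl | rfl | rfl <;>
      first | exact absurd hcol (by simp [smallBottomA, smallRightC, smallNotchD,
        smallTopA, smallLeftC, smallLeftD]) | skip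
    · obtain ⟨hF, hk⟩ := key fun w hw0 hw1 => by
        simp only [smallBottomB, InGo, s_pow_three]
        refine ⟨?_, ?_, ?_, ?_, Or.inr ?_⟩ <;> linarith
      cases hk
    · exact ⟨rfl, rfl⟩

/-- An arrow that becomes an arrow of colour `d` on one side does not become a part of an arrow of
colour `c` on the other side. -/
theorem not_becomesD_of_becomesC {T : Set (Set Plane)} (hT : IsAmmannTiling T)
    {X t t' : Set Plane} {f g : Arrow} (ht : t ∈ T) (ht' : t' ∈ T) (hX : ¬ IsPart T X t')
    (hne : t ≠ t') (hd : BecomesD T X t f) (hc : BecomesC T t' f g) : False := by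
  obtain ⟨hb1, hb2, hb3⟩ := s_bounds
  obtain ⟨F, rfl, hd⟩ := hd
  obtain ⟨-, hg, -, gcol, gt, gh⟩ := hc.succ
  rw [← or_assoc] at hd
  rcases hd with hd | ⟨rfl, t₂, ht₂, hne₂, hB⟩
  · obtain ⟨E, hE, rfl⟩ : ∃ E, (E = largeNotchA ∨ E = largeLeftLowerA) ∧
        f = F.arrow Kind.large.scale E := by
      rcases hd with rfl | rfl
      exacts [⟨_, Or.inl rfl, rfl⟩, ⟨_, Or.inr rfl, rfl⟩]
    have hEm : E ∈ Kind.large.edges := by rcases hE with rfl | rfl <;> simp [Kind.edges]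
    obtain ⟨F', k', Ea, Eb, rfl, hEa, hEb, hfa, rfl, ca, cb, hx, hy, ha, hb, hm, hn, hl⟩ := hc.edges
    -- Here f ends at a convex corner of t and g runs on beyond it. The tile that shares g with t'
    -- is a small one with g in its notch. The partner of this small tile carries g too, so it is
    -- t', and g is its `largeRightB`. But `BecomesC` admits `largeRightB` only in a large tile that
    -- is no partner.
    obtain ⟨F₃, k₃, E₃, h₃, hne₃, hE₃, ha₃⟩ := hT.exists_shared ht' hEb
    obtain ⟨c1, u1, v1⟩ := hT.edge_opposite ht' ht hne hEa hEm hfa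
    obtain ⟨l1, -, -⟩ := Frame.edge_eq_of_arrow_eq hEa hEm hfa
    obtain ⟨c2, u2, v2⟩ := hT.edge_opposite ht' h₃ hne₃ hEb hE₃ ha₃
    obtain ⟨c3, u3, v3⟩ := F'.edge_succ k'.scale hx hy ha hb hm hn
    have col₃ : E₃.color = .b := (congrArg Arrow.color ha₃).trans cb
    have hpt : ∀ x y, (F₃.edge k₃.scale E₃).pt x y =
        (F.edge Kind.large.scale E).pt (Kind.large.scale * E.l + x) y := by
      intro x y
      simp only [Frame.pt, c2, u2, v2, c1, u1, v1, c3, u3, v3, l1]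
      module
    obtain ⟨rfl, rfl⟩ := shared_b_of_corner hT ht h₃ hE hE₃ col₃ hpt
    have hp := hT.isPartner h₃
    have hshare := largePart_arrow_b F₃.smallPart
    rw [F₃.smallPart_smallPart] at hshare
    have hZ : tile F' k'.scale = tile F₃.smallPart.largePart Kind.large.scale := by
      refine hT.not_three h₃ ht' hp.large_mem (e := F'.arrow k'.scale Eb)
        (mem_decoration_iff.2 ⟨_, hE₃, ha₃.symm⟩) hg
        (mem_decoration_iff.2 ⟨largeRightB, by simp [Kind.edges], ?_⟩) hne₃ ?_
      · rw [hshare, ha₃]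
      · exact fun e => Kind.noConfusion (kind_tile_inj e).2
    obtain ⟨F₄, ⟨e4, hno, -, -⟩ | ⟨e4, -, h5⟩ | ⟨e4, -, -⟩⟩ := hc
    · exact hno _ (hZ ▸ hp)
    · rw [hZ] at e4
      obtain ⟨rfl, -⟩ := kind_tile_inj e4
      rw [← ha₃, ← hshare] at h5
      have h6 := congrArg Arrow.tail h5
      rw [Frame.arrow_tail', Frame.arrow_tail'] at h6
      have h7 := mul_left_cancel₀ (Kind.scale_pos _).ne' (Frame.pt_inj _ h6).1
      simp only [largeRightB, largeLeftB] at h7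
      linarith
    · rw [hZ] at e4
      exact Kind.noConfusion (kind_tile_inj e4).2
  -- Here f is `largeRightA` of t, so its continuation g, with s² times its length, is `largeRightB`
  -- of t. This arrow already belongs to the two parts t and t₂ of X, so t' would be t₂.
  · have e4 : s ^ 2 * s ^ 2 = 1 - s ^ 2 := by rw [← s_pow_four]; ring
    obtain ⟨h1, h2⟩ := F.arrow_succ s (E := largeRightA) (E' := largeRightB) rfl rfl rfl rfl rfl rfl
      (by simp only [largeRightA, largeRightB, s_pow_four, mul_sub, e4]; ring)
    have hgB : g = F.arrow s largeRightB :=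
      Arrow.eq_of (gcol.trans rfl) (gt.trans h1.symm) (gh.trans h2.symm)
    have hgt : g ∈ decoration (tile F Kind.large.scale) :=
      mem_decoration_iff.2 ⟨largeRightB, by simp [Kind.edges], hgB⟩
    refine hX ?_
    rwa [hT.not_three ht ht' ht₂.mem hgt hg (hgB ▸ hB) hne hne₂.symm]

/-! ### The matching rule for the amalgamation -/

/-- The frame `F` with its origin multiplied by `s`. -/
noncomputable def Frame.shrink (F : Frame) : Frame := { F with c := s • F.c }

theorem Frame.shrink_pt (F : Frame) (x y : ℝ) : F.shrink.pt (s * x) (s * y) = s • F.pt x y := by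
  simp only [Frame.pt, Frame.shrink]; module

theorem smul_tile (F : Frame) {r : ℝ} (hr : 0 < r) : s • tile F r = tile F.shrink (s * r) := by
  have hs := s_pos
  ext p
  constructor
  · rintro ⟨q, hq, rfl⟩
    obtain ⟨x, y, rfl⟩ := exists_pt (F := F) hr q
    rw [pt_mem_tile hr] at hq
    change s • F.pt _ _ ∈ _
    rw [← F.shrink_pt, ← mul_assoc, ← mul_assoc, pt_mem_tile (mul_pos hs hr)]
    exact hq
  · intro hp
    obtain ⟨x, y, rfl⟩ := exists_pt (F := F.shrink) (mul_pos hs hr) p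
    rw [pt_mem_tile (mul_pos hs hr)] at hp
    rw [mul_assoc, mul_assoc, F.shrink_pt]
    exact Set.smul_mem_smul_set ((pt_mem_tile hr).2 hp)

theorem Frame.shrink_arrow (F : Frame) (r : ℝ) (E : Edge) :
    F.shrink.arrow (s * r) E = (F.arrow r E).map (fun p => s • p) := by
  refine Arrow.eq_of rfl ?_ ?_
  · rw [Frame.arrow_tail', mul_assoc, mul_assoc, F.shrink_pt, ← F.arrow_tail']; rfl
  · rw [Frame.arrow_head', mul_assoc, mul_assoc, F.shrink_pt, ← F.arrow_head']; rfl

/-- Every amalgamated tile is either the union of a small tile and its partner or a large tile that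
is no partner. -/
theorem IsAmmannTiling.amalgamated_cases {T : Set (Set Plane)} (hT : IsAmmannTiling T)
    {X : Set Plane} (hX : X ∈ amalgamated T) :
    (∃ W : Frame, X = tile W 1 ∧ IsPart T X (tile W.smallPart Kind.small.scale) ∧
      IsPart T X (tile W.largePart Kind.large.scale)) ∨
    (∃ F : Frame, X = tile F Kind.large.scale ∧ IsPart T X X ∧ ∀ t₀, ¬ IsPartner T t₀ X) := by
  rcases hX with ⟨t, b, h, rfl⟩ | ⟨h1, h2⟩
  · left
    obtain ⟨-, -, W, rfl, rfl⟩ := isPartner_iff.1 h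
    exact ⟨W, tile_dissect W, Or.inl ⟨_, h, rfl⟩, Or.inr (Or.inl ⟨_, h, rfl⟩)⟩
  · right
    obtain ⟨k, F, rfl⟩ := hT.exists_frame h1
    cases k
    · exact ⟨F, rfl, Or.inr (Or.inr ⟨rfl, h1, h2⟩), fun t₀ h => (h2 _ _ h).2 rfl⟩
    · exact ((h2 _ _ (hT.isPartner h1)).1 rfl).elim

/-- How an arrow `e` of the amalgamated tile `X` arises from arrows of the part `t` of `X`. -/
def Arises (T : Set (Set Plane)) (X t : Set Plane) (e : Arrow) : Prop :=
  (∃ f ∈ decoration t, e.tail = f.tail ∧ e.head = f.head ∧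
    ((e.color = .a ∧ f.color = .c) ∨ (e.color = .b ∧ f.color = .d) ∨
      (e.color = .d ∧ f.color = .a ∧ BecomesD T X t f))) ∨
  (∃ f g, BecomesC T t f g ∧ e.color = .c ∧ e.tail = g.head ∧ e.head = f.tail)

/-- After scaling, a kept large tile is a small one. Each of the two arrows c of the small prototile
covers an a and a b of the large one, and every other arrow lies exactly on an old arrow. -/
theorem arises_of_kept {T : Set (Set Plane)} {F : Frame} {X : Set Plane}
    (hX : X = tile F Kind.large.scale)
    (hn : ∀ t₀, ¬ IsPartner T t₀ X) {E : Edge} (hE : E ∈ Kind.small.edges) :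
    Arises T X X (F.arrow s E) := by
  subst hX
  have dec {E' : Edge} (h : E' ∈ Kind.large.edges) :
      F.arrow s E' ∈ decoration (tile F Kind.large.scale) := mem_decoration_iff.2 ⟨E', h, rfl⟩
  simp only [Kind.edges, List.mem_cons, List.not_mem_nil, or_false] at hE
  rcases hE with rfl | rfl | rfl | rfl | rfl | rfl | rfl | rfl
  · exact Or.inl ⟨_, dec (E' := largeBottomC) (by simp [Kind.edges]), rfl, rfl, Or.inl ⟨rfl, rfl⟩⟩
  · exact Or.inl ⟨_, dec (E' := largeBottomD) (by simp [Kind.edges]), rfl, rfl,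
      Or.inr (Or.inl ⟨rfl, rfl⟩)⟩
  · exact Or.inr ⟨_, _, ⟨F, Or.inl ⟨rfl, hn, rfl, rfl⟩⟩, rfl, rfl, rfl⟩
  · exact Or.inl ⟨_, dec (E' := largeNotchD) (by simp [Kind.edges]), rfl, rfl,
      Or.inr (Or.inl ⟨rfl, rfl⟩)⟩
  · exact Or.inl ⟨_, dec (E' := largeNotchA) (by simp [Kind.edges]), rfl, rfl,
      Or.inr (Or.inr ⟨rfl, rfl, F, rfl, Or.inl rfl⟩)⟩
  · exact Or.inl ⟨_, dec (E' := largeTopC) (by simp [Kind.edges]), rfl, rfl, Or.inl ⟨rfl, rfl⟩⟩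
  · exact Or.inr ⟨_, _, ⟨F, Or.inr (Or.inl ⟨rfl, rfl, rfl⟩)⟩, rfl, rfl, rfl⟩
  · exact Or.inl ⟨_, dec (E' := largeLeftLowerA) (by simp [Kind.edges]), rfl, rfl,
      Or.inr (Or.inr ⟨rfl, rfl, F, rfl, Or.inr (Or.inl rfl)⟩)⟩

/-- After scaling, a merged pair is a large tile. Its edges `largeNotchA`, `largeTopC`, `largeLeftB`
and `largeLeftUpperA` come from the small part, the other six from the large part. -/
theorem arises_of_merged {T : Set (Set Plane)} {W : Frame} {X : Set Plane}
    (h1 : IsPart T X (tile W.smallPart Kind.small.scale))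
    (h2 : IsPart T X (tile W.largePart Kind.large.scale)) {E : Edge} (hE : E ∈ Kind.large.edges) :
    ∃ t, IsPart T X t ∧ Arises T X t (W.arrow 1 E) := by
  have h4 := s_pow_four
  have decL {E' : Edge} (h : E' ∈ Kind.large.edges) : W.largePart.arrow Kind.large.scale E' ∈
    decoration (tile W.largePart Kind.large.scale) := mem_decoration_iff.2 ⟨E', h, rfl⟩
  have decS {E' : Edge} (h : E' ∈ Kind.small.edges) : W.smallPart.arrow Kind.small.scale E' ∈
    decoration (tile W.smallPart Kind.small.scale) := mem_decoration_iff.2 ⟨E', h, rfl⟩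
  have ptL (x y x' y' : ℝ) (hx : x = s - s * y') (hy : y = s * x') :
      W.pt (1 * x) (1 * y) = W.largePart.pt (Kind.large.scale * x') (Kind.large.scale * y') := by
    rw [W.largePart_pt, one_mul, one_mul, hx, hy]; rfl
  have ptS (x y x' y' : ℝ) (hx : x = s ^ 2 * x') (hy : y = 1 - s ^ 2 * y') :
      W.pt (1 * x) (1 * y) = W.smallPart.pt (Kind.small.scale * x') (Kind.small.scale * y') := by
    rw [W.smallPart_pt, one_mul, one_mul, hx, hy]; rfl
  simp only [Kind.edges, List.mem_cons, List.not_mem_nil, or_false] at hE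
  rcases hE with rfl | rfl | rfl | rfl | rfl | rfl | rfl | rfl | rfl | rfl
  · refine ⟨_, h2, Or.inr ⟨_, _, ⟨W.largePart, Or.inr (Or.inl ⟨rfl, rfl, rfl⟩)⟩, rfl, ?_, ?_⟩⟩
    · rw [Frame.arrow_tail', Frame.arrow_head']
      exact ptL _ _ _ _ (by simp [largeBottomC, largeLeftB]) (by simp [largeBottomC, largeLeftB])
    · rw [Frame.arrow_tail', Frame.arrow_head']
      exact ptL _ _ _ _ (by simp only [largeBottomC, largeLeftUpperA]; linear_combination s * h4)
        (by simp [largeBottomC, largeLeftUpperA])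
  · refine ⟨_, h2, Or.inl ⟨_, decL (E' := largeLeftLowerA) (by simp [Kind.edges]), ?_, ?_,
      Or.inr (Or.inr ⟨rfl, rfl, W.largePart, rfl, Or.inr (Or.inl rfl)⟩)⟩⟩
    · rw [Frame.arrow_tail', Frame.arrow_tail']
      exact ptL _ _ _ _ (by simp only [largeBottomD, largeLeftLowerA]; linear_combination s * h4)
        (by simp [largeBottomD, largeLeftLowerA])
    · rw [Frame.arrow_head', Frame.arrow_head']
      exact ptL _ _ _ _ (by simp [largeBottomD, largeLeftLowerA])
        (by simp [largeBottomD, largeLeftLowerA])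
  · refine ⟨_, h2, Or.inl ⟨_, decL (E' := largeBottomC) (by simp [Kind.edges]), ?_, ?_,
      Or.inl ⟨rfl, rfl⟩⟩⟩
    · rw [Frame.arrow_tail', Frame.arrow_tail']
      exact ptL _ _ _ _ (by simp [largeBottomC, largeRightA]) (by simp [largeBottomC, largeRightA])
    · rw [Frame.arrow_head', Frame.arrow_head']
      exact ptL _ _ _ _ (by simp [largeBottomC, largeRightA])
        (by simp only [largeBottomC, largeRightA]; ring)
  · refine ⟨_, h2, Or.inl ⟨_, decL (E' := largeBottomD) (by simp [Kind.edges]), ?_, ?_,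
      Or.inr (Or.inl ⟨rfl, rfl⟩)⟩⟩
    · rw [Frame.arrow_tail', Frame.arrow_tail']
      exact ptL _ _ _ _ (by simp [largeBottomD, largeRightB])
        (by simp only [largeBottomD, largeRightB]; ring)
    · rw [Frame.arrow_head', Frame.arrow_head']
      exact ptL _ _ _ _ (by simp [largeBottomD, largeRightB])
        (by simp only [largeBottomD, largeRightB]; ring)
  -- Only the a on this side of the large part stays on the boundary; the b after it is shared with
  -- the small part. This is the last alternative in `BecomesD`.
  · refine ⟨_, h2, Or.inl ⟨_, decL (E' := largeRightA) (by simp [Kind.edges]), ?_, ?_,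
      Or.inr (Or.inr ⟨rfl, rfl, W.largePart, rfl, Or.inr (Or.inr ⟨rfl, _, h1, ?_, ?_⟩)⟩)⟩⟩
    · rw [Frame.arrow_tail', Frame.arrow_tail']
      exact ptL _ _ _ _ (by simp [largeNotchD, largeRightA])
        (by simp only [largeNotchD, largeRightA]; ring)
    · rw [Frame.arrow_head', Frame.arrow_head']
      exact ptL _ _ _ _ (by simp only [largeNotchD, largeRightA]; linear_combination s * h4)
        (by simp only [largeNotchD, largeRightA]; ring)
    · exact fun e => Kind.noConfusion (kind_tile_inj e).2
    · exact (largePart_arrow_b W).symm ▸ decS (by simp [Kind.edges])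
  · refine ⟨_, h1, Or.inl ⟨_, decS (E' := smallRightC) (by simp [Kind.edges]), ?_, ?_,
      Or.inl ⟨rfl, rfl⟩⟩⟩
    · rw [Frame.arrow_tail', Frame.arrow_tail']
      exact ptS _ _ _ _ (by simp only [largeNotchA, smallRightC]; ring)
        (by simp only [largeNotchA, smallRightC]; linear_combination h4)
    · rw [Frame.arrow_head', Frame.arrow_head']
      exact ptS _ _ _ _ (by simp only [largeNotchA, smallRightC]; ring)
        (by simp [largeNotchA, smallRightC])
  · refine ⟨_, h1, Or.inr ⟨_, _, ⟨W.smallPart, Or.inr (Or.inr ⟨rfl, rfl, rfl⟩)⟩, rfl, ?_, ?_⟩⟩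
    · rw [Frame.arrow_tail', Frame.arrow_head']
      exact ptS _ _ _ _ (by simp only [largeTopC, smallBottomB]; ring)
        (by simp [largeTopC, smallBottomB])
    · rw [Frame.arrow_tail', Frame.arrow_head']
      exact ptS _ _ _ _ (by simp [largeTopC, smallBottomA]) (by simp [largeTopC, smallBottomA])
  · refine ⟨_, h1, Or.inl ⟨_, decS (E' := smallLeftD) (by simp [Kind.edges]), ?_, ?_,
      Or.inr (Or.inl ⟨rfl, rfl⟩)⟩⟩
    · rw [Frame.arrow_tail', Frame.arrow_tail']
      exact ptS _ _ _ _ (by simp [largeLeftB, smallLeftD])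
        (by simp only [largeLeftB, smallLeftD]; linear_combination (s ^ 2 + 1) * h4)
    · rw [Frame.arrow_head', Frame.arrow_head']
      exact ptS _ _ _ _ (by simp [largeLeftB, smallLeftD]) (by simp [largeLeftB, smallLeftD])
  · refine ⟨_, h1, Or.inl ⟨_, decS (E' := smallLeftC) (by simp [Kind.edges]), ?_, ?_,
      Or.inl ⟨rfl, rfl⟩⟩⟩
    · rw [Frame.arrow_tail', Frame.arrow_tail']
      exact ptS _ _ _ _ (by simp [largeLeftUpperA, smallLeftC])
        (by simp only [largeLeftUpperA, smallLeftC]; linear_combination h4)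
    · rw [Frame.arrow_head', Frame.arrow_head']
      exact ptS _ _ _ _ (by simp [largeLeftUpperA, smallLeftC])
        (by simp only [largeLeftUpperA, smallLeftC]; linear_combination (s ^ 2 + 1) * h4)
  · refine ⟨_, h2, Or.inl ⟨_, decL (E' := largeTopC) (by simp [Kind.edges]), ?_, ?_,
      Or.inl ⟨rfl, rfl⟩⟩⟩
    · rw [Frame.arrow_tail', Frame.arrow_tail']
      exact ptL _ _ _ _ (by simp [largeLeftLowerA, largeTopC])
        (by simp only [largeLeftLowerA, largeTopC]; ring)
    · rw [Frame.arrow_head', Frame.arrow_head']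
      exact ptL _ _ _ _ (by simp [largeLeftLowerA, largeTopC])
        (by simp [largeLeftLowerA, largeTopC])

/-- Every arrow of a tile of the amalgamation arises from arrows of a part. -/
theorem IsAmmannTiling.exists_arises {T : Set (Set Plane)} (hT : IsAmmannTiling T)
    {X : Set Plane} (hX : X ∈ amalgamated T) {e : Arrow} (he : e ∈ decoration (s • X)) :
    ∃ t e₁, IsPart T X t ∧ Arises T X t e₁ ∧ e = e₁.map (fun p => s • p) := by
  rcases hT.amalgamated_cases hX with ⟨W, hW, h1, h2⟩ | ⟨F, hF, h1, h2⟩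
  · have hsX : s • X = tile W.shrink Kind.large.scale := by
      rw [hW, smul_tile W one_pos, mul_one]; rfl
    rw [hsX, mem_decoration_iff] at he
    obtain ⟨E, hE, rfl⟩ := he
    obtain ⟨t, ht, ha⟩ := arises_of_merged h1 h2 hE
    refine ⟨t, _, ht, ha, ?_⟩
    rw [← W.shrink_arrow, mul_one]; rfl
  · have hsX : s • X = tile F.shrink Kind.small.scale := by
      rw [hF, smul_tile F (Kind.scale_pos _)]; simp only [Kind.scale, sq]
    rw [hsX, mem_decoration_iff] at he
    obtain ⟨E, hE, rfl⟩ := he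
    refine ⟨X, _, h1, arises_of_kept hF h2 hE, ?_⟩
    rw [← F.shrink_arrow]; simp only [Kind.scale, sq]

theorem segment_subset_union {x y : Plane} {r : ℝ} (hr : 0 < r) :
    segment ℝ (y + r • (y - x)) x ⊆ segment ℝ x y ∪ segment ℝ y (y + r • (y - x)) := by
  rw [segment_symm, segment_eq_image', segment_eq_image', segment_eq_image']
  rintro _ ⟨θ, ⟨h0, h1⟩, rfl⟩
  rcases le_total (θ * (1 + r)) 1 with h | h
  · refine Or.inl ⟨θ * (1 + r), ⟨by positivity, h⟩, ?_⟩
    module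
  · refine Or.inr ⟨(θ * (1 + r) - 1) / r, ⟨div_nonneg (by linarith) hr.le, ?_⟩, ?_⟩
    · rw [div_le_one hr]; nlinarith
    · simp only [add_sub_cancel_left, smul_smul, div_mul_cancel₀ _ hr.ne']
      module

theorem BecomesC.segment_subset {T : Set (Set Plane)} {t : Set Plane} {f g : Arrow}
    (h : BecomesC T t f g) : segment ℝ g.head f.tail ⊆ f.support ∪ g.support := by
  obtain ⟨-, -, -, -, h1, h2⟩ := h.succ
  rw [Arrow.support, Arrow.support, h1, h2]
  exact segment_subset_union (pow_pos s_pos 2)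

/-- A convex set with two points is infinite. Unlike having two points, being infinite passes to one
of two sets that cover it, as is needed when an arrow c is split into its a and b. -/
theorem infinite_inter_support {e e' : Arrow} (h : (e.support ∩ e'.support).Nontrivial) :
    (e.support ∩ e'.support).Infinite :=
  ((convex_segment _ _).inter (convex_segment _ _)).isPreconnected.infinite_of_nontrivial h

/-- The matching rule for the amalgamated tiles. -/
theorem IsAmmannTiling.arises_eq {T : Set (Set Plane)} (hT : IsAmmannTiling T)
    {X Y t t' : Set Plane} {e e' : Arrow} (hXY : X ≠ Y) (ht : IsPart T X t) (ht' : IsPart T Y t')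
    (h : Arises T X t e) (h' : Arises T Y t' e')
    (hnt : (e.support ∩ e'.support).Nontrivial) : e = e' := by
  have hne : t ≠ t' := fun h => hXY (ht.unique (h ▸ ht'))
  have hX : ¬ IsPart T X t' := fun h => hXY (h.unique ht')
  have hY : ¬ IsPart T Y t := fun h => hXY (ht.unique h)
  have match_of_infinite {f f' : Arrow} (hf : f ∈ decoration t) (hf' : f' ∈ decoration t')
      (hi : (f.support ∩ f'.support).Infinite) : f = f' :=
    hT.matching t ht.mem t' ht'.mem hne f hf f' hf' hi.nontrivial
  have hinf := infinite_inter_support hnt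
  rcases h with ⟨f, hf, h1, h2, hcol⟩ | ⟨f, g, hC, hc, h1, h2⟩ <;>
    rcases h' with ⟨f', hf', h1', h2', hcol'⟩ | ⟨f', g', hC', hc', h1', h2'⟩
  · rw [Arrow.support, Arrow.support, h1, h2, h1', h2'] at hinf
    have hff := match_of_infinite hf hf' hinf
    -- For single arrows the old colour determines the new one.
    refine Arrow.eq_of ?_ (by rw [h1, h1', hff]) (by rw [h2, h2', hff])
    rw [hff] at hcol
    rcases hcol with ⟨c1, c2⟩ | ⟨c1, c2⟩ | ⟨c1, c2, -⟩ <;>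
      rcases hcol' with ⟨c1', c2'⟩ | ⟨c1', c2'⟩ | ⟨c1', c2', -⟩ <;> simp_all
  -- One arrow of the pair under the new c must coincide with f. It is not the b, since no b yields
  -- an arrow by itself; it is not the a by `not_becomesD_of_becomesC`.
  · exfalso
    obtain ⟨mf, mg, ca, cb, -, -⟩ := hC'.succ
    have hsub : e.support ∩ e'.support ⊆ (f.support ∩ f'.support) ∪ (f.support ∩ g'.support) := by
      rw [← Set.inter_union_distrib_left, Arrow.support, Arrow.support, h1, h2, h1', h2']
      exact Set.inter_subset_inter subset_rfl hC'.segment_subset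
    rcases Set.infinite_union.1 (hinf.mono hsub) with hi | hi
    · have := match_of_infinite hf mf hi
      subst this
      rcases hcol with ⟨c1, c2⟩ | ⟨c1, c2⟩ | ⟨c1, c2, hd⟩
      · simp [ca] at c2
      · simp [ca] at c2
      · exact not_becomesD_of_becomesC hT ht.mem ht'.mem hX hne hd hC'
    · have := match_of_infinite hf mg hi
      subst this
      rcases hcol with ⟨c1, c2⟩ | ⟨c1, c2⟩ | ⟨c1, c2, hd⟩ <;> simp [cb] at c2
  · exfalso
    obtain ⟨mf, mg, ca, cb, -, -⟩ := hC.succ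
    have hsub : e.support ∩ e'.support ⊆ (f.support ∩ f'.support) ∪ (g.support ∩ f'.support) := by
      rw [← Set.union_inter_distrib_right, Arrow.support, Arrow.support, h1, h2, h1', h2']
      exact Set.inter_subset_inter hC.segment_subset subset_rfl
    rcases Set.infinite_union.1 (hinf.mono hsub) with hi | hi
    · have := match_of_infinite mf hf' hi
      subst this
      rcases hcol' with ⟨c1, c2⟩ | ⟨c1, c2⟩ | ⟨c1, c2, hd⟩
      · simp [ca] at c2
      · simp [ca] at c2
      · exact not_becomesD_of_becomesC hT ht'.mem ht.mem hY hne.symm hd hC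
    · have := match_of_infinite mg hf' hi
      subst this
      rcases hcol' with ⟨c1, c2⟩ | ⟨c1, c2⟩ | ⟨c1, c2, hd⟩ <;> simp [cb] at c2
  · obtain ⟨mf, mg, ca, cb, e1, e2⟩ := hC.succ
    obtain ⟨mf', mg', ca', cb', e1', e2'⟩ := hC'.succ
    have hsub : e.support ∩ e'.support ⊆ ((f.support ∩ f'.support) ∪ (f.support ∩ g'.support)) ∪
        ((g.support ∩ f'.support) ∪ (g.support ∩ g'.support)) := by
      rw [← Set.inter_union_distrib_left, ← Set.inter_union_distrib_left,
        ← Set.union_inter_distrib_right, Arrow.support, Arrow.support, h1, h2, h1', h2']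
      exact Set.inter_subset_inter hC.segment_subset hC'.segment_subset
    have hs2 : s ^ 2 ≠ 0 := (pow_pos s_pos 2).ne'
    -- For two arrows c the colours leave f = f' or g = g'. Either equality fixes both ends, because
    -- g continues f with s² times its length.
    rcases Set.infinite_union.1 (hinf.mono hsub) with hi | hi <;>
      rcases Set.infinite_union.1 hi with hi | hi
    · have := match_of_infinite mf mf' hi
      subst this
      exact Arrow.eq_of (hc.trans hc'.symm) (by rw [h1, h1', e2, e2']) (by rw [h2, h2'])
    · have := congrArg Arrow.color (match_of_infinite mf mg' hi)
      simp [ca, cb'] at this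
    · have := congrArg Arrow.color (match_of_infinite mg mf' hi)
      simp [ca', cb] at this
    · have := match_of_infinite mg mg' hi
      subst this
      refine Arrow.eq_of (hc.trans hc'.symm) (by rw [h1, h1']) ?_
      rw [h2, h2']
      rw [e2, ← e1, ← e1'] at e2'
      have := smul_right_injective Plane hs2 (add_left_cancel e2')
      exact sub_right_injective this

theorem IsAmmannTiling.amalgamation_matching {T : Set (Set Plane)} (hT : IsAmmannTiling T) :
    ObeysMatchingRule (amalgamation T) := by
  rintro _ ⟨X, hX, rfl⟩ _ ⟨Y, hY, rfl⟩ hne e he e' he' hnt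
  obtain ⟨t, e₁, ht, ha, rfl⟩ := hT.exists_arises hX he
  obtain ⟨t', e₁', ht', ha', rfl⟩ := hT.exists_arises hY he'
  have hsupp (e : Arrow) : (e.map (fun p => s • p)).support = (fun p => s • p) '' e.support :=
    (image_segment ℝ (LinearMap.lsmul ℝ Plane s).toAffineMap e.tail e.head).symm
  have hinj : Function.Injective (fun p : Plane => s • p) := smul_right_injective Plane s_pos.ne'
  rw [hsupp, hsupp, ← Set.image_inter hinj] at hnt
  rw [hT.arises_eq (fun h => hne (by rw [h])) ht ht' ha ha' (Set.nontrivial_of_image _ _ hnt)]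

/-! ### All tiles are parallel -/

/-- The axes of two frames are parallel, up to order and orientation. -/
def Frame.Parallel (F F' : Frame) : Prop :=
  ∃ σ ρ : ℝ, (σ = 1 ∨ σ = -1) ∧ (ρ = 1 ∨ ρ = -1) ∧
    ((F'.u = σ • F.u ∧ F'.v = ρ • F.v) ∨ (F'.u = σ • F.v ∧ F'.v = ρ • F.u))

theorem mul_sign {σ ρ : ℝ} (h : σ = 1 ∨ σ = -1) (h' : ρ = 1 ∨ ρ = -1) :
    σ * ρ = 1 ∨ σ * ρ = -1 := by
  rcases h with rfl | rfl <;> rcases h' with rfl | rfl <;> norm_num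

theorem Frame.Parallel.trans {F F' F'' : Frame} (h : F.Parallel F') (h' : F'.Parallel F'') :
    F.Parallel F'' := by
  obtain ⟨σ, ρ, hσ, hρ, h⟩ := h
  obtain ⟨σ', ρ', hσ', hρ', h'⟩ := h'
  rcases h with ⟨hu, hv⟩ | ⟨hu, hv⟩ <;> rcases h' with ⟨hu', hv'⟩ | ⟨hu', hv'⟩ <;>
    rw [hu, smul_smul] at * <;> rw [hv, smul_smul] at *
  · exact ⟨_, _, mul_sign hσ' hσ, mul_sign hρ' hρ, Or.inl ⟨hu', hv'⟩⟩
  · exact ⟨_, _, mul_sign hσ' hρ, mul_sign hρ' hσ, Or.inr ⟨hu', hv'⟩⟩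
  · exact ⟨_, _, mul_sign hσ' hσ, mul_sign hρ' hρ, Or.inr ⟨hu', hv'⟩⟩
  · exact ⟨_, _, mul_sign hσ' hρ, mul_sign hρ' hσ, Or.inl ⟨hu', hv'⟩⟩

/-- One common axis is enough, as the other axes are quarter turns of it up to sign (`Frame.v_eq`).
-/
theorem Frame.parallel_of_axis {F F' : Frame} {σ : ℝ} (hσ : σ = 1 ∨ σ = -1)
    (h : F'.u = σ • F.u ∨ F'.u = σ • F.v ∨ F'.v = σ • F.u ∨ F'.v = σ • F.v) : F.Parallel F' := by
  obtain ⟨ε, h1, h2, h3⟩ := F.v_eq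
  obtain ⟨ε', h1', h2', h3'⟩ := F'.v_eq
  have hε := sq_eq_one_iff.1 h1
  have hε' := sq_eq_one_iff.1 h1'
  have hδ := mul_sign (mul_sign hε' hσ) hε
  have hδ' : -(ε' * σ * ε) = 1 ∨ -(ε' * σ * ε) = -1 := by
    rcases hδ with h | h <;> simp [h]
  have coord {p q : Plane} {r : ℝ} (h : p = r • q) : p 0 = r * q 0 ∧ p 1 = r * q 1 := by
    rw [h]; simp
  rcases h with h | h | h | h
  · refine ⟨σ, ε' * σ * ε, hσ, hδ, Or.inl ⟨h, ?_⟩⟩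
    obtain ⟨g0, g1⟩ := coord h
    apply plane_ext <;> simp only [PiLp.smul_apply, smul_eq_mul, h2, h3, h2', h3', g0, g1]
    · linear_combination ε' * σ * F.u 1 * h1
    · linear_combination -ε' * σ * F.u 0 * h1
  · refine ⟨σ, -(ε' * σ * ε), hσ, hδ', Or.inr ⟨h, ?_⟩⟩
    obtain ⟨g0, g1⟩ := coord h
    apply plane_ext <;> simp only [PiLp.smul_apply, smul_eq_mul, h2, h3, h2', h3', g0, g1] <;> ring
  · refine ⟨-(ε' * σ * ε), σ, hδ', hσ, Or.inr ⟨?_, h⟩⟩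
    obtain ⟨g0, g1⟩ := coord h
    apply plane_ext <;> simp only [PiLp.smul_apply, smul_eq_mul, h2, h3]
    · linear_combination -F'.u 0 * h1' + ε' * (g1 - h3') - ε' * σ * F.u 1 * h1
    · linear_combination -F'.u 1 * h1' - ε' * (g0 - h2') + ε' * σ * F.u 0 * h1
  · refine ⟨ε' * σ * ε, σ, hδ, hσ, Or.inl ⟨?_, h⟩⟩
    obtain ⟨g0, g1⟩ := coord h
    apply plane_ext <;> simp only [PiLp.smul_apply, smul_eq_mul]
    · linear_combination -F'.u 0 * h1' + ε' * (g1 - h3') + ε' * σ * h3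
    · linear_combination -F'.u 1 * h1' - ε' * (g0 - h2') - ε' * σ * h2

theorem Frame.parallel_of_edge {F F' : Frame} {r r' : ℝ} {E E' : Edge} (hE : E.Sound)
    (hE' : E'.Sound) (h : (F'.edge r' E').u = (F.edge r E).u) : F.Parallel F' := by
  have key {E : Edge} (hE : E.Sound) : ∃ σ : ℝ, (σ = 1 ∨ σ = -1) ∧
      ((E.a = σ ∧ E.b = 0) ∨ (E.a = 0 ∧ E.b = σ)) := by
    have h1 := E.unit_dir
    rcases mul_eq_zero.1 hE.axis with h | h
    · refine ⟨E.b, ?_, Or.inr ⟨h, rfl⟩⟩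
      rw [h] at h1
      exact sq_eq_one_iff.1 (by linarith)
    · refine ⟨E.a, ?_, Or.inl ⟨rfl, h⟩⟩
      rw [h] at h1
      exact sq_eq_one_iff.1 (by linarith)
  obtain ⟨σ, hσ, hab⟩ := key hE
  obtain ⟨σ', hσ', hab'⟩ := key hE'
  have cancel {p q : Plane} (h : σ' • p = σ • q) : p = (σ' * σ) • q := by
    rw [← smul_smul, ← h, smul_smul]
    rcases hσ' with rfl | rfl <;> simp
  refine Frame.parallel_of_axis (mul_sign hσ' hσ) ?_
  simp only [Frame.edge] at h
  rcases hab with ⟨h1, h2⟩ | ⟨h1, h2⟩ <;> rcases hab' with ⟨h1', h2'⟩ | ⟨h1', h2'⟩ <;>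
    simp only [h1, h2, h1', h2', zero_smul, add_zero, zero_add] at h
  · exact Or.inl (cancel h)
  · exact Or.inr (Or.inr (Or.inl (cancel h)))
  · exact Or.inr (Or.inl (cancel h))
  · exact Or.inr (Or.inr (Or.inr (cancel h)))

/-- Tiles with a common arrow are parallel, and all other pairs meet in countable sets. So the tiles
parallel to the first one and the remaining tiles have closed unions that cover the plane and meet
in a countable set. The complement of a countable set in the plane is connected, so one of the
classes is empty. -/
theorem IsAmmannTiling.parallel {T : Set (Set Plane)} (hT : IsAmmannTiling T) {F F' : Frame}
    {k k' : Kind} (h : tile F k.scale ∈ T) (h' : tile F' k'.scale ∈ T) : F.Parallel F' := by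
  by_contra hnot
  set C : Set (Set Plane) := {t | t ∈ T ∧ ∃ k₁ F₁, t = tile F₁ (Kind.scale k₁) ∧ F.Parallel F₁} with hC
  have hCT : C ⊆ T := fun t ht => ht.1
  have hAB : ⋃₀ C ∪ ⋃₀ (T \ C) = Set.univ := by
    rw [← Set.sUnion_union, Set.union_sdiff_cancel hCT, hT.tiling.covers]
  have hcount : (⋃₀ C ∩ ⋃₀ (T \ C)).Countable := by
    have hsub : ⋃₀ C ∩ ⋃₀ (T \ C) ⊆ ⋃ t ∈ C, ⋃ t' ∈ T \ C, t ∩ t' := by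
      rintro p ⟨⟨t, ht, hp⟩, ⟨t', ht', hp'⟩⟩
      exact Set.mem_biUnion ht (Set.mem_biUnion ht' ⟨hp, hp'⟩)
    refine Set.Countable.mono hsub ((hT.countable.mono hCT).biUnion fun t ht =>
      (hT.countable.mono Set.sdiff_subset).biUnion fun t' ht' => ?_)
    obtain ⟨htT, k₁, F₁, rfl, hpar⟩ := ht
    obtain ⟨k₂, F₂, rfl⟩ := hT.exists_frame ht'.1
    refine hT.countable_inter htT ht'.1 ?_ fun E hE E' hE' e => ?_
    · exact fun e => ht'.2 (e ▸ ⟨htT, k₁, F₁, rfl, hpar⟩)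
    · exact ht'.2 ⟨ht'.1, k₂, F₂, rfl, hpar.trans (Frame.parallel_of_edge (sound_of_mem hE)
        (sound_of_mem hE') (Frame.edge_eq_of_arrow_eq hE hE' e).2.2)⟩
  have hrank : 1 < Module.rank ℝ Plane := by
    rw [← Module.finrank_eq_rank, finrank_euclideanSpace_fin]; norm_num
  have hconn := (hcount.isPathConnected_compl_of_one_lt_rank hrank).isConnected.isPreconnected
  have hmem : tile F k.scale ∈ C := by
    refine ⟨h, k, F, rfl, 1, 1, Or.inl rfl, Or.inl rfl, Or.inl ⟨?_, ?_⟩⟩ <;> simp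
  have hmem' : tile F' k'.scale ∈ T \ C := by
    refine ⟨h', ?_⟩
    rintro ⟨-, k₁, F₁, e, hpar⟩
    rw [← (kind_tile_inj e).1] at hpar
    exact hnot hpar
  have hsplit {S S' : Set (Set Plane)} (hS : S ⊆ T) (hS' : S' ⊆ T) (hd : Disjoint S S') {F₁ : Frame}
      {k₁ : Kind} (h₁ : tile F₁ k₁.scale ∈ S) : ∃ p ∈ ⋃₀ S, p ∉ ⋃₀ S' := by
    have hp : F₁.pt (k₁.scale * (1 / 4)) (k₁.scale * (1 / 4)) ∈ otile F₁ k₁.scale := by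
      have := k₁.scale_pos
      exact ball_subset_otile F₁ this (Metric.mem_ball_self (by positivity))
    refine ⟨_, ⟨_, h₁, otile_subset _ _ hp⟩, ?_⟩
    rintro ⟨t', ht', hp'⟩
    obtain ⟨k₂, F₂, rfl⟩ := hT.exists_frame (hS' ht')
    exact Set.disjoint_left.1 (hT.disjoint (hS h₁) (hS' ht')
      fun e => Set.disjoint_left.1 hd h₁ (e ▸ ht')) hp hp'
  obtain ⟨p, hp, hp'⟩ := hsplit hCT Set.sdiff_subset Set.disjoint_sdiff_right hmem
  obtain ⟨q, hq, hq'⟩ := hsplit Set.sdiff_subset hCT Set.disjoint_sdiff_left hmem'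
  obtain ⟨z, -, hz1, hz2⟩ := hconn (⋃₀ C)ᶜ (⋃₀ (T \ C))ᶜ (hT.isClosed_sUnion hCT).isOpen_compl
    (hT.isClosed_sUnion Set.sdiff_subset).isOpen_compl (by rw [Set.compl_inter])
    ⟨q, fun hc => hq' hc.1, hq'⟩ ⟨p, fun hc => hp' hc.2, hp'⟩
  have : z ∈ ⋃₀ C ∪ ⋃₀ (T \ C) := by rw [hAB]; trivial
  exact this.elim hz1 hz2

/-! ### Intersections of parallel tiles -/

/-- Membership in a box from which the box at one corner is removed; the signs `σ`, `ρ` tell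
which corner. -/
def Notched (x₁ x₂ y₁ y₂ σ a ρ b x y : ℝ) : Prop :=
  x₁ ≤ x ∧ x ≤ x₂ ∧ y₁ ≤ y ∧ y ≤ y₂ ∧ (σ * x ≤ a ∨ ρ * y ≤ b)

theorem Notched.horizontal {x₁ x₂ y₁ y₂ σ a ρ b x x' y z : ℝ} (hσ : σ = 1 ∨ σ = -1)
    (h : Notched x₁ x₂ y₁ y₂ σ a ρ b x y) (h' : Notched x₁ x₂ y₁ y₂ σ a ρ b x' y)
    (hz : z ∈ Set.uIcc x x') : Notched x₁ x₂ y₁ y₂ σ a ρ b z y := by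
  obtain ⟨h1, h2, h3, h4, h5⟩ := h
  obtain ⟨h1', h2', -, -, h5'⟩ := h'
  rw [Set.mem_uIcc] at hz
  refine ⟨by rcases hz with hz | hz <;> linarith, by rcases hz with hz | hz <;> linarith, h3, h4, ?_⟩
  rcases h5 with h5 | h5
  · rcases h5' with h5' | h5'
    · left
      rcases hσ with rfl | rfl <;> rcases hz with hz | hz <;> linarith
    · exact Or.inr h5'
  · exact Or.inr h5

theorem notched_swap {x₁ x₂ y₁ y₂ σ a ρ b x y : ℝ} :
    Notched x₁ x₂ y₁ y₂ σ a ρ b x y ↔ Notched y₁ y₂ x₁ x₂ ρ b σ a y x := by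
  unfold Notched
  tauto

theorem notched_iff {x₁ x₂ y₁ y₂ σ a ρ b x y : ℝ} : Notched x₁ x₂ y₁ y₂ σ a ρ b x y ↔
    (x₁ ≤ x ∧ x ≤ x₂) ∧ (y₁ ≤ y ∧ y ≤ y₂) ∧ (σ * x ≤ a ∨ ρ * y ≤ b) := by
  unfold Notched
  tauto

theorem Notched.vertical {x₁ x₂ y₁ y₂ σ a ρ b x y y' z : ℝ} (hρ : ρ = 1 ∨ ρ = -1)
    (h : Notched x₁ x₂ y₁ y₂ σ a ρ b x y) (h' : Notched x₁ x₂ y₁ y₂ σ a ρ b x y')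
    (hz : z ∈ Set.uIcc y y') : Notched x₁ x₂ y₁ y₂ σ a ρ b x z :=
  notched_swap.2 ((notched_swap.1 h).horizontal hρ (notched_swap.1 h') hz)

/-- The common points of two notched boxes can be joined in their intersection by a path of at
most three axis-parallel segments, unless the two notches together form a hole. -/
theorem notched_join_or_hole {A B a₀ b₀ x₁ x₂ y₁ y₂ σ a ρ b p₀ p₁ q₀ q₁ : ℝ}
    (ha₀ : 0 ≤ a₀) (hb₀ : 0 ≤ b₀)
    (hσ : σ = 1 ∨ σ = -1) (hρ : ρ = 1 ∨ ρ = -1)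
    (hp : Notched 0 A 0 B 1 a₀ 1 b₀ p₀ p₁) (hq : Notched 0 A 0 B 1 a₀ 1 b₀ q₀ q₁)
    (hp' : Notched x₁ x₂ y₁ y₂ σ a ρ b p₀ p₁) (hq' : Notched x₁ x₂ y₁ y₂ σ a ρ b q₀ q₁) :
    (∃ m, (Notched 0 A 0 B 1 a₀ 1 b₀ m p₁ ∧ Notched x₁ x₂ y₁ y₂ σ a ρ b m p₁) ∧
      (Notched 0 A 0 B 1 a₀ 1 b₀ m q₁ ∧ Notched x₁ x₂ y₁ y₂ σ a ρ b m q₁)) ∨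
    (∃ m, (Notched 0 A 0 B 1 a₀ 1 b₀ p₀ m ∧ Notched x₁ x₂ y₁ y₂ σ a ρ b p₀ m) ∧
      (Notched 0 A 0 B 1 a₀ 1 b₀ q₀ m ∧ Notched x₁ x₂ y₁ y₂ σ a ρ b q₀ m)) ∨
    (σ = -1 ∧ ρ = -1 ∧ a₀ < -a ∧ -a ≤ A ∧ b₀ < -b ∧ -b ≤ B ∧ x₁ ≤ a₀ ∧ -a ≤ x₂ ∧ y₁ ≤ b₀ ∧
      -b ≤ y₂) := by
  have main {p₀ p₁ q₀ q₁ : ℝ} (hp : Notched 0 A 0 B 1 a₀ 1 b₀ p₀ p₁)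
      (hq : Notched 0 A 0 B 1 a₀ 1 b₀ q₀ q₁) (hp' : Notched x₁ x₂ y₁ y₂ σ a ρ b p₀ p₁)
      (hq' : Notched x₁ x₂ y₁ y₂ σ a ρ b q₀ q₁) (g1 : a₀ < 1 * p₀) (g2 : b₀ < 1 * q₁)
      (g3 : a < σ * q₀) (g4 : b < ρ * p₁) :
      (∃ m, (Notched 0 A 0 B 1 a₀ 1 b₀ m p₁ ∧ Notched x₁ x₂ y₁ y₂ σ a ρ b m p₁) ∧
        (Notched 0 A 0 B 1 a₀ 1 b₀ m q₁ ∧ Notched x₁ x₂ y₁ y₂ σ a ρ b m q₁)) ∨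
      (∃ m, (Notched 0 A 0 B 1 a₀ 1 b₀ p₀ m ∧ Notched x₁ x₂ y₁ y₂ σ a ρ b p₀ m) ∧
        (Notched 0 A 0 B 1 a₀ 1 b₀ q₀ m ∧ Notched x₁ x₂ y₁ y₂ σ a ρ b q₀ m)) ∨
      (σ = -1 ∧ ρ = -1 ∧ a₀ < -a ∧ -a ≤ A ∧ b₀ < -b ∧ -b ≤ B ∧ x₁ ≤ a₀ ∧ -a ≤ x₂ ∧ y₁ ≤ b₀ ∧
        -b ≤ y₂) := by
    obtain ⟨p1, p2, p3, p4, p5⟩ := hp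
    obtain ⟨q1, q2, q3, q4, q5⟩ := hq
    obtain ⟨p1', p2', p3', p4', p5'⟩ := hp'
    obtain ⟨q1', q2', q3', q4', q5'⟩ := hq'
    -- In the first tile, p lies beside and q above the notch corner (a₀, b₀). The second tile then
    -- has its notch at the lower left, so the notches face each other. The line x = a₀ or the line
    -- y = b₀ gives a path unless the second notch extends beyond both.
    have k1 : 1 * p₁ ≤ b₀ := p5.resolve_left (by linarith)
    have k2 : 1 * q₀ ≤ a₀ := q5.resolve_right (by linarith)
    have k3 : σ * p₀ ≤ a := p5'.resolve_right (by linarith)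
    have k4 : ρ * q₁ ≤ b := q5'.resolve_left (by linarith)
    have hσ' : σ = -1 := hσ.resolve_left fun h => by rw [h] at g3 k3; linarith
    have hρ' : ρ = -1 := hρ.resolve_left fun h => by rw [h] at g4 k4; linarith
    subst hσ' hρ'
    rcases le_or_gt (-a) a₀ with h | h
    · exact Or.inl ⟨a₀,
        ⟨⟨by linarith, by linarith, by linarith, by linarith, Or.inl (by linarith)⟩,
          by linarith, by linarith, by linarith, by linarith, Or.inl (by linarith)⟩,
        ⟨by linarith, by linarith, by linarith, by linarith, Or.inl (by linarith)⟩,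
          by linarith, by linarith, by linarith, by linarith, Or.inl (by linarith)⟩
    rcases le_or_gt (-b) b₀ with h' | h'
    · exact Or.inr (Or.inl ⟨b₀,
        ⟨⟨by linarith, by linarith, by linarith, by linarith, Or.inr (by linarith)⟩,
          by linarith, by linarith, by linarith, by linarith, Or.inr (by linarith)⟩,
        ⟨by linarith, by linarith, by linarith, by linarith, Or.inr (by linarith)⟩,
          by linarith, by linarith, by linarith, by linarith, Or.inr (by linarith)⟩)
    refine Or.inr (Or.inr ⟨rfl, rfl, h, ?_, h', ?_, ?_, ?_, ?_, ?_⟩) <;> linarith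
  -- If one of the other two corners of the rectangle spanned by p and q is in both tiles, two
  -- segments suffice.
  by_cases c1 : Notched 0 A 0 B 1 a₀ 1 b₀ p₀ q₁ ∧ Notched x₁ x₂ y₁ y₂ σ a ρ b p₀ q₁
  · exact Or.inl ⟨p₀, ⟨hp, hp'⟩, c1⟩
  by_cases c2 : Notched 0 A 0 B 1 a₀ 1 b₀ q₀ p₁ ∧ Notched x₁ x₂ y₁ y₂ σ a ρ b q₀ p₁
  · exact Or.inl ⟨q₀, c2, ⟨hq, hq'⟩⟩
  have corner {x₁ x₂ y₁ y₂ σ a ρ b p₀ p₁ q₀ q₁ : ℝ} (hp : Notched x₁ x₂ y₁ y₂ σ a ρ b p₀ p₁)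
      (hq : Notched x₁ x₂ y₁ y₂ σ a ρ b q₀ q₁) (hn : ¬ Notched x₁ x₂ y₁ y₂ σ a ρ b p₀ q₁) :
      a < σ * p₀ ∧ b < ρ * q₁ := by
    by_contra h
    refine hn ⟨hp.1, hp.2.1, hq.2.2.1, hq.2.2.2.1, ?_⟩
    by_contra h'
    push Not at h'
    exact h h'
  rw [not_and_or] at c1 c2
  -- A tile that misses both of these corners would also miss p.
  rcases c1 with c1 | c1 <;> rcases c2 with c2 | c2
  · have h1 := corner hp hq c1
    have h2 := corner hq hp c2
    rcases hp.2.2.2.2 with h | h <;> linarith [h1.1, h2.2]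
  · have h1 := corner hp hq c1
    have h2 := corner hq' hp' c2
    exact main hp hq hp' hq' h1.1 h1.2 h2.1 h2.2
  · have h1 := corner hp' hq' c1
    have h2 := corner hq hp c2
    rcases main hq hp hq' hp' h2.1 h2.2 h1.1 h1.2 with ⟨m, h, h'⟩ | ⟨m, h, h'⟩ | h
    · exact Or.inl ⟨m, h', h⟩
    · exact Or.inr (Or.inl ⟨m, h', h⟩)
    · exact Or.inr (Or.inr h)
  · have h1 := corner hp' hq' c1
    have h2 := corner hq' hp' c2
    rcases hp'.2.2.2.2 with h | h <;> linarith [h1.1, h2.2]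

theorem inG_div_iff {r x y : ℝ} (hr : 0 < r) : InG (x / r) (y / r) ↔
    Notched 0 (r * s) 0 r 1 (r * s ^ 3) 1 (r * s ^ 2) x y := by
  unfold InG Notched
  simp only [le_div_iff₀ hr, div_le_iff₀ hr, zero_mul, one_mul, mul_comm r]
  tauto

theorem pt_mem_tile_iff_notched (F : Frame) {r x y : ℝ} (hr : 0 < r) : F.pt x y ∈ tile F r ↔
    Notched 0 (r * s) 0 r 1 (r * s ^ 3) 1 (r * s ^ 2) x y := by
  rw [← inG_div_iff hr]
  simp [tile]

/-- In the coordinates of a parallel frame a tile is again a box without a corner; the signs of its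
axes tell which corner. -/
theorem Frame.Parallel.exists_notched {F F' : Frame} (h : F.Parallel F') {r : ℝ} (hr : 0 < r) :
    ∃ x₁ x₂ y₁ y₂ σ a ρ b : ℝ, (σ = 1 ∨ σ = -1) ∧ (ρ = 1 ∨ ρ = -1) ∧
      ∀ x y, F.pt x y ∈ tile F' r ↔ Notched x₁ x₂ y₁ y₂ σ a ρ b x y := by
  obtain ⟨σ, ρ, hσ, hρ, h⟩ := h
  have hσσ : σ * σ = 1 := by rcases hσ with rfl | rfl <;> norm_num
  have hρρ : ρ * ρ = 1 := by rcases hρ with rfl | rfl <;> norm_num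
  set c := F.X F'.c with hc
  set d := F.Y F'.c with hd
  have hcd : F'.c = F.c + c • F.u + d • F.v := (F.pt_X_Y F'.c).symm
  have interval {σ : ℝ} (hσ : σ = 1 ∨ σ = -1) (c l : ℝ) : ∃ x₁ x₂, ∀ x : ℝ,
      (0 ≤ σ * (x - c) ∧ σ * (x - c) ≤ l) ↔ (x₁ ≤ x ∧ x ≤ x₂) := by
    rcases hσ with rfl | rfl
    · refine ⟨c, c + l, fun x => ⟨fun h => ?_, fun h => ?_⟩⟩ <;> constructor <;> linarith
    · refine ⟨c - l, c, fun x => ⟨fun h => ?_, fun h => ?_⟩⟩ <;> constructor <;> linarith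
  have shift (σ c l x : ℝ) : 1 * (σ * (x - c)) ≤ l ↔ σ * x ≤ l + σ * c := by
    constructor <;> intro h <;> linarith
  rcases h with ⟨hu, hv⟩ | ⟨hu, hv⟩
  · have hpt (x y : ℝ) : F.pt x y = F'.pt (σ * (x - c)) (ρ * (y - d)) := by
      simp only [Frame.pt, hu, hv, hcd, smul_smul]
      rw [show σ * (x - c) * σ = x - c by linear_combination (x - c) * hσσ,
        show ρ * (y - d) * ρ = y - d by linear_combination (y - d) * hρρ]
      module
    obtain ⟨x₁, x₂, hx⟩ := interval hσ c (r * s)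
    obtain ⟨y₁, y₂, hy⟩ := interval hρ d r
    refine ⟨x₁, x₂, y₁, y₂, σ, r * s ^ 3 + σ * c, ρ, r * s ^ 2 + ρ * d, hσ, hρ, fun x y => ?_⟩
    rw [hpt, pt_mem_tile_iff_notched F' hr, notched_iff, notched_iff, hx, hy, shift, shift]
  · have hpt (x y : ℝ) : F.pt x y = F'.pt (σ * (y - d)) (ρ * (x - c)) := by
      simp only [Frame.pt, hu, hv, hcd, smul_smul]
      rw [show ρ * (x - c) * ρ = x - c by linear_combination (x - c) * hρρ,
        show σ * (y - d) * σ = y - d by linear_combination (y - d) * hσσ]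
      module
    obtain ⟨x₁, x₂, hx⟩ := interval hρ c r
    obtain ⟨y₁, y₂, hy⟩ := interval hσ d (r * s)
    refine ⟨x₁, x₂, y₁, y₂, ρ, r * s ^ 2 + ρ * c, σ, r * s ^ 3 + σ * d, hρ, hσ, fun x y => ?_⟩
    rw [hpt, pt_mem_tile_iff_notched F' hr, notched_swap, notched_iff, notched_iff, hx, hy, shift,
      shift]

/-- A path of three axis-parallel segments. -/
theorem exists_preconnected_join (F : Frame) {S : Set Plane} {p₀ p₁ q₀ q₁ m : ℝ}
    (hh : ∀ x x' y z, F.pt x y ∈ S → F.pt x' y ∈ S → z ∈ Set.uIcc x x' → F.pt z y ∈ S)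
    (hv : ∀ x y y' z, F.pt x y ∈ S → F.pt x y' ∈ S → z ∈ Set.uIcc y y' → F.pt x z ∈ S)
    (hp : F.pt p₀ p₁ ∈ S) (hq : F.pt q₀ q₁ ∈ S)
    (hm : (F.pt m p₁ ∈ S ∧ F.pt m q₁ ∈ S) ∨ (F.pt p₀ m ∈ S ∧ F.pt q₀ m ∈ S)) :
    ∃ t ⊆ S, F.pt p₀ p₁ ∈ t ∧ F.pt q₀ q₁ ∈ t ∧ IsPreconnected t := by
  have ch (y : ℝ) : Continuous fun x => F.pt x y :=
    F.continuous_pt.comp (by fun_prop : Continuous fun x : ℝ => (x, y))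
  have cv (x : ℝ) : Continuous fun y => F.pt x y :=
    F.continuous_pt.comp (by fun_prop : Continuous fun y : ℝ => (x, y))
  have conh (x x' y : ℝ) : IsPreconnected ((fun z => F.pt z y) '' Set.uIcc x x') :=
    Set.ordConnected_uIcc.isPreconnected.image _ (ch y).continuousOn
  have conv' (x y y' : ℝ) : IsPreconnected ((fun z => F.pt x z) '' Set.uIcc y y') :=
    Set.ordConnected_uIcc.isPreconnected.image _ (cv x).continuousOn
  rcases hm with ⟨h1, h2⟩ | ⟨h1, h2⟩
  · refine ⟨((fun z => F.pt z p₁) '' Set.uIcc p₀ m ∪ (fun z => F.pt m z) '' Set.uIcc p₁ q₁) ∪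
      (fun z => F.pt z q₁) '' Set.uIcc m q₀, ?_,
      Or.inl (Or.inl ⟨p₀, Set.left_mem_uIcc, rfl⟩), Or.inr ⟨q₀, Set.right_mem_uIcc, rfl⟩,
      IsPreconnected.union (F.pt m q₁) (Or.inr ⟨q₁, Set.right_mem_uIcc, rfl⟩)
        ⟨m, Set.left_mem_uIcc, rfl⟩ (IsPreconnected.union (F.pt m p₁)
        ⟨m, Set.right_mem_uIcc, rfl⟩ ⟨p₁, Set.left_mem_uIcc, rfl⟩ (conh _ _ _) (conv' _ _ _))
        (conh _ _ _)⟩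
    rintro _ ((⟨z, hz, rfl⟩ | ⟨z, hz, rfl⟩) | ⟨z, hz, rfl⟩)
    exacts [hh _ _ _ _ hp h1 hz, hv _ _ _ _ h1 h2 hz, hh _ _ _ _ h2 hq hz]
  · refine ⟨((fun z => F.pt p₀ z) '' Set.uIcc p₁ m ∪ (fun z => F.pt z m) '' Set.uIcc p₀ q₀) ∪
      (fun z => F.pt q₀ z) '' Set.uIcc m q₁, ?_,
      Or.inl (Or.inl ⟨p₁, Set.left_mem_uIcc, rfl⟩), Or.inr ⟨q₁, Set.right_mem_uIcc, rfl⟩,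
      IsPreconnected.union (F.pt q₀ m) (Or.inr ⟨q₀, Set.right_mem_uIcc, rfl⟩)
        ⟨m, Set.left_mem_uIcc, rfl⟩ (IsPreconnected.union (F.pt p₀ m)
        ⟨m, Set.right_mem_uIcc, rfl⟩ ⟨p₀, Set.left_mem_uIcc, rfl⟩ (conv' _ _ _) (conh _ _ _))
        (conv' _ _ _)⟩
    rintro _ ((⟨z, hz, rfl⟩ | ⟨z, hz, rfl⟩) | ⟨z, hz, rfl⟩)
    exacts [hv _ _ _ _ hp h1 hz, hh _ _ _ _ h1 h2 hz, hv _ _ _ _ h2 hq hz]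

/-- A tile that avoids the sides of a rectangle but not the rectangle lies in it. -/
theorem tile_subset_rectangle {F Z : Frame} {r a c b e : ℝ} (hr : 0 < r)
    (hside : ∀ x y, a ≤ x → x ≤ c → b ≤ y → y ≤ e → (x = a ∨ x = c ∨ y = b ∨ y = e) →
      F.pt x y ∉ otile Z r) {x₀ y₀ : ℝ} (hx : a < x₀) (hx' : x₀ < c) (hy : b < y₀) (hy' : y₀ < e)
    (hz : F.pt x₀ y₀ ∈ tile Z r) :
    tile Z r ⊆ {p | a ≤ F.X p ∧ F.X p ≤ c ∧ b ≤ F.Y p ∧ F.Y p ≤ e} := by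
  set H : Set Plane := {p | a < F.X p ∧ F.X p < c ∧ b < F.Y p ∧ F.Y p < e} with hH
  set K : Set Plane := {p | a ≤ F.X p ∧ F.X p ≤ c ∧ b ≤ F.Y p ∧ F.Y p ≤ e} with hK
  have hHo : IsOpen H := (isOpen_lt continuous_const F.continuous_X).inter <|
    (isOpen_lt F.continuous_X continuous_const).inter <|
    (isOpen_lt continuous_const F.continuous_Y).inter (isOpen_lt F.continuous_Y continuous_const)
  have hKc : IsClosed K := (isClosed_le continuous_const F.continuous_X).inter <|
    (isClosed_le F.continuous_X continuous_const).inter <|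
    (isClosed_le continuous_const F.continuous_Y).inter
      (isClosed_le F.continuous_Y continuous_const)
  have hHK : H ⊆ K := fun p hp => ⟨hp.1.le, hp.2.1.le, hp.2.2.1.le, hp.2.2.2.le⟩
  obtain ⟨w, hwH, hw⟩ := mem_closure_iff.1 (tile_subset_closure Z hr hz) H hHo
    (by simpa [hH] using ⟨hx, hx', hy, hy'⟩)
  -- The open part is connected, meets the open rectangle and avoids its sides.
  have hsub : otile Z r ⊆ H := by
    refine (isPreconnected_otile Z hr).subset_left_of_subset_union hHo hKc.isOpen_compl
      (Set.disjoint_left.2 fun p hp hp' => hp' (hHK hp)) (fun p hp => ?_) ⟨w, hw, hwH⟩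
    by_contra hc
    rw [Set.mem_union, not_or, Set.notMem_compl_iff] at hc
    obtain ⟨hc1, k1, k2, k3, k4⟩ := hc
    refine hside _ _ k1 k2 k3 k4 ?_ ((F.pt_X_Y p).symm ▸ hp)
    by_contra hne
    push Not at hne
    exact hc1 ⟨k1.lt_of_ne' hne.1, k2.lt_of_ne hne.2.1, k3.lt_of_ne' hne.2.2.1,
      k4.lt_of_ne hne.2.2.2⟩
  exact (tile_subset_closure Z hr).trans (closure_minimal (hsub.trans hHK) hKc)

/-- The intersection of two parallel tiles of scale at most `1` is connected if the rest of the
plane is covered by nonoverlapping tiles of scale at least `s`. -/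
theorem isPreconnected_inter {F F' : Frame} {r r' : ℝ} (hr : 0 < r) (hr1 : r ≤ 1) (hr' : 0 < r')
    (hpar : F.Parallel F')
    (hcover : ∀ p, p ∉ tile F r → p ∉ tile F' r' → ∃ Z r'', s ≤ r'' ∧ p ∈ tile Z r'' ∧
      Disjoint (otile Z r'') (tile F r) ∧ Disjoint (otile Z r'') (tile F' r')) :
    IsPreconnected (tile F r ∩ tile F' r') := by
  obtain ⟨hb1, hb2, hb3⟩ := s_bounds
  obtain ⟨x₁, x₂, y₁, y₂, σ, a, ρ, b, hσ, hρ, hmem'⟩ := hpar.exists_notched hr'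
  have hmem (x y : ℝ) := pt_mem_tile_iff_notched F hr (x := x) (y := y)
  have ha0 : 0 ≤ r * s ^ 3 := by have := s_pos; positivity
  have hb0 : 0 ≤ r * s ^ 2 := by positivity
  refine isPreconnected_of_forall_pair fun p hp q hq => ?_
  rw [← F.pt_X_Y p] at hp ⊢
  rw [← F.pt_X_Y q] at hq ⊢
  generalize F.X p = p₀ at *
  generalize F.Y p = p₁ at *
  generalize F.X q = q₀ at *
  generalize F.Y q = q₁ at *
  have join (m : ℝ) := exists_preconnected_join F (S := tile F r ∩ tile F' r') (p₀ := p₀) (p₁ := p₁)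
    (q₀ := q₀) (q₁ := q₁) (m := m)
    (fun x x' y z h h' hz => ⟨(hmem _ _).2 (((hmem _ _).1 h.1).horizontal (Or.inl rfl)
        ((hmem _ _).1 h'.1) hz),
      (hmem' _ _).2 (((hmem' _ _).1 h.2).horizontal hσ ((hmem' _ _).1 h'.2) hz)⟩)
    (fun x y y' z h h' hz => ⟨(hmem _ _).2 (((hmem _ _).1 h.1).vertical (Or.inl rfl)
        ((hmem _ _).1 h'.1) hz),
      (hmem' _ _).2 (((hmem' _ _).1 h.2).vertical hρ ((hmem' _ _).1 h'.2) hz)⟩) hp hq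
  rcases notched_join_or_hole ha0 hb0 hσ hρ ((hmem _ _).1 hp.1) ((hmem _ _).1 hq.1)
    ((hmem' _ _).1 hp.2) ((hmem' _ _).1 hq.2) with ⟨m, h1, h2⟩ | ⟨m, h1, h2⟩ | hhole
  · refine join m (Or.inl ⟨?_, ?_⟩)
    · exact ⟨(hmem _ _).2 h1.1, (hmem' _ _).2 h1.2⟩
    · exact ⟨(hmem _ _).2 h2.1, (hmem' _ _).2 h2.2⟩
  · refine join m (Or.inr ⟨?_, ?_⟩)
    · exact ⟨(hmem _ _).2 h1.1, (hmem' _ _).2 h1.2⟩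
    · exact ⟨(hmem _ _).2 h2.1, (hmem' _ _).2 h2.2⟩
  · exfalso
    obtain ⟨rfl, rfl, g1, g2, g3, g4, g5, g6, g7, g8⟩ := hhole
    -- The centre of the hole belongs to a third tile. The left and lower sides of the hole lie in
    -- the first tile, the right and upper sides in the second, so the third cannot leave the hole.
    obtain ⟨Z, r'', hr'', hz, d1, d2⟩ := hcover
      (F.pt ((r * s ^ 3 + -a) / 2) ((r * s ^ 2 + -b) / 2))
      (by
        rw [hmem]
        rintro ⟨-, -, -, -, h | h⟩ <;> linarith)
      (by
        rw [hmem']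
        rintro ⟨-, -, -, -, h | h⟩ <;> linarith)
    have hr''0 : 0 < r'' := by linarith
    have hK := tile_subset_rectangle (F := F) (a := r * s ^ 3) (c := -a) (b := r * s ^ 2) (e := -b)
      hr''0 (fun x y k1 k2 k3 k4 hs ho => by
        rcases hs with hs | hs | hs | hs
        · exact Set.disjoint_left.1 d1 ho ((hmem _ _).2
            ⟨by linarith, by linarith, by linarith, by linarith, Or.inl (by linarith)⟩)
        · exact Set.disjoint_left.1 d2 ho ((hmem' _ _).2
            ⟨by linarith, by linarith, by linarith, by linarith, Or.inl (by linarith)⟩)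
        · exact Set.disjoint_left.1 d1 ho ((hmem _ _).2
            ⟨by linarith, by linarith, by linarith, by linarith, Or.inr (by linarith)⟩)
        · exact Set.disjoint_left.1 d2 ho ((hmem' _ _).2
            ⟨by linarith, by linarith, by linarith, by linarith, Or.inr (by linarith)⟩))
      (by linarith) (by linarith) (by linarith) (by linarith) hz
    obtain ⟨-, c1, c2⟩ := corner_mem_tile Z hr''0
    have hd := Z.dist_pt_sq (r'' * s) 0 0 r''
    rw [F.dist_sq_coord] at hd
    obtain ⟨k1, k2, k3, k4⟩ := hK c1
    obtain ⟨k1', k2', k3', k4'⟩ := hK c2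
    generalize F.X (Z.pt (r'' * s) 0) = u at *
    generalize F.Y (Z.pt (r'' * s) 0) = v at *
    generalize F.X (Z.pt 0 r'') = u' at *
    generalize F.Y (Z.pt 0 r'') = v' at *
    -- The hole is at most 1/2 wide and high, so squared distances in it are at most 1/2. The
    -- vertices v₁ and v₅ of the third tile have squared distance at least s²(1 + s²) = 1.
    have e1 : r * s - r * s ^ 3 ≤ 1 / 2 := by
      rw [s_pow_three]; nlinarith
    have e2 : r - r * s ^ 2 ≤ 1 / 2 := by nlinarith
    have f1 : (u - u') ^ 2 ≤ (1 / 2) ^ 2 := sq_le_sq' (by linarith) (by linarith)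
    have f2 : (v - v') ^ 2 ≤ (1 / 2) ^ 2 := sq_le_sq' (by linarith) (by linarith)
    have f3 : s ^ 2 ≤ r'' ^ 2 := by nlinarith
    nlinarith [sq_nonneg (r'' * s)]

/-! ### The amalgamation is a tiling -/

/-- All copies of the bee are homeomorphic to it. -/
theorem nonempty_homeomorph_tile (F : Frame) {r : ℝ} (hr : 0 < r) : Nonempty (G ≃ₜ tile F r) := by
  rw [← iso_image_smul F hr]
  exact ⟨((Homeomorph.smulOfNeZero r hr.ne').image G).trans (F.iso.toHomeomorph.image _)⟩

theorem exists_amalgamated {T : Set (Set Plane)} {t : Set Plane} (ht : t ∈ T) :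
    ∃ X ∈ amalgamated T, IsPart T X t := by
  by_cases h : ∃ t₀ b, IsPartner T t₀ b ∧ (t = t₀ ∨ t = b)
  · obtain ⟨t₀, b, h, rfl | rfl⟩ := h
    · exact ⟨_, Or.inl ⟨_, _, h, rfl⟩, Or.inl ⟨_, h, rfl⟩⟩
    · exact ⟨_, Or.inl ⟨_, _, h, rfl⟩, Or.inr (Or.inl ⟨_, h, rfl⟩)⟩
  · push Not at h
    exact ⟨t, Or.inr ⟨ht, h⟩, Or.inr (Or.inr ⟨rfl, ht, h⟩)⟩

theorem exists_isPart {T : Set (Set Plane)} {X : Set Plane} (hX : X ∈ amalgamated T) {p : Plane}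
    (hp : p ∈ X) : ∃ t, IsPart T X t ∧ p ∈ t := by
  rcases hX with ⟨t, b, h, rfl⟩ | ⟨h1, h2⟩
  · rcases hp with hp | hp
    · exact ⟨t, Or.inl ⟨_, h, rfl⟩, hp⟩
    · exact ⟨b, Or.inr (Or.inl ⟨_, h, rfl⟩), hp⟩
  · exact ⟨X, Or.inr (Or.inr ⟨rfl, h1, h2⟩), hp⟩

section

variable {T : Set (Set Plane)} (hT : IsAmmannTiling T)
include hT

/-- An overlap of amalgamated tiles yields an overlap of parts, which are distinct by
`IsPart.unique`. -/
theorem IsAmmannTiling.amalgamated_nonoverlapping {X Y : Set Plane} (hX : X ∈ amalgamated T)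
    (hY : Y ∈ amalgamated T) (hne : X ≠ Y) : interior (X ∩ Y) = ∅ := by
  rw [Set.eq_empty_iff_forall_notMem]
  intro p hp
  obtain ⟨t, ht, hpt⟩ := exists_isPart hX (interior_subset hp).1
  obtain ⟨k, F, rfl⟩ := hT.exists_frame ht.mem
  obtain ⟨q, hq, hqF⟩ := mem_closure_iff.1 (tile_subset_closure F k.scale_pos hpt) _
    isOpen_interior hp
  obtain ⟨t', ht', hqt'⟩ := exists_isPart hY (interior_subset hq).2
  obtain ⟨k', F', rfl⟩ := hT.exists_frame ht'.mem
  refine Set.disjoint_left.1 (hT.disjoint ht.mem ht'.mem fun e => hne (ht.unique ?_)) hqF hqt'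
  rw [e]
  exact ht'

/-- A merged tile is parallel to its large part, with the axes exchanged, and so inherits
parallelism from `T`. The scale is at least s, which makes every amalgamated tile too big for a
hole. -/
theorem IsAmmannTiling.exists_amalgamated_frame {X : Set Plane} (hX : X ∈ amalgamated T) :
    ∃ (F : Frame) (r : ℝ), X = tile F r ∧ s ≤ r ∧ r ≤ 1 ∧ ∃ (F' : Frame) (k : Kind),
      tile F' k.scale ∈ T ∧ F.Parallel F' ∧ F'.Parallel F := by
  have hb := s_bounds
  rcases hT.amalgamated_cases hX with ⟨W, hW, -, h2⟩ | ⟨F, hF, h1, -⟩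
  · refine ⟨W, 1, hW, by linarith, le_rfl, W.largePart, .large, h2.mem, ?_, ?_⟩
    · refine ⟨1, -1, Or.inl rfl, Or.inr rfl, Or.inr ⟨?_, ?_⟩⟩ <;> simp [Frame.largePart]
    · refine ⟨-1, 1, Or.inr rfl, Or.inl rfl, Or.inr ⟨?_, ?_⟩⟩ <;> simp [Frame.largePart]
  · have hpar : F.Parallel F := by
      refine ⟨1, 1, Or.inl rfl, Or.inl rfl, Or.inl ⟨?_, ?_⟩⟩ <;> simp
    exact ⟨F, s, hF, le_rfl, by linarith, F, .large, hF ▸ h1.mem, hpar, hpar⟩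

theorem IsAmmannTiling.amalgamated_covers (p : Plane) : ∃ X ∈ amalgamated T, p ∈ X := by
  obtain ⟨t, ht, hp⟩ : p ∈ ⋃₀ T := by rw [hT.tiling.covers]; trivial
  obtain ⟨X, hX, hpart⟩ := exists_amalgamated ht
  exact ⟨X, hX, hpart.subset hp⟩

theorem IsAmmannTiling.amalgamated_connected {X Y : Set Plane} (hX : X ∈ amalgamated T)
    (hY : Y ∈ amalgamated T) (hne : X ≠ Y) : IsPreconnected (X ∩ Y) := by
  have hs := s_pos
  obtain ⟨F, r, rfl, hr, hr1, F₁, k₁, h₁, hp₁, -⟩ := hT.exists_amalgamated_frame hX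
  obtain ⟨F', r', rfl, hr', -, F₂, k₂, h₂, -, hp₂⟩ := hT.exists_amalgamated_frame hY
  refine isPreconnected_inter (hs.trans_le hr) hr1 (hs.trans_le hr')
    ((hp₁.trans (hT.parallel h₁ h₂)).trans hp₂) fun p hp hp' => ?_
  obtain ⟨Z, hZ, hpZ⟩ := hT.amalgamated_covers p
  have hZX : Z ≠ tile F r := fun e => hp (e ▸ hpZ)
  have hZY : Z ≠ tile F' r' := fun e => hp' (e ▸ hpZ)
  obtain ⟨F'', r'', rfl, hr'', -, -⟩ := hT.exists_amalgamated_frame hZ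
  exact ⟨F'', r'', hr'', hpZ,
    disjoint_otile_tile (hs.trans_le hr) (hT.amalgamated_nonoverlapping hZ hX hZX),
    disjoint_otile_tile (hs.trans_le hr') (hT.amalgamated_nonoverlapping hZ hY hZY)⟩

theorem IsAmmannTiling.amalgamation_tiles {t : Set Plane} (ht : t ∈ amalgamation T) :
    ∃ (k : Kind) (F : Frame), t = tile F k.scale := by
  obtain ⟨X, hX, rfl⟩ := ht
  rcases hT.amalgamated_cases hX with ⟨W, rfl, -⟩ | ⟨F, rfl, -⟩
  · exact ⟨.large, W.shrink, by simp only [smul_tile W one_pos, mul_one]; rfl⟩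
  · exact ⟨.small, F.shrink, by simp only [Kind.scale, sq, smul_tile F s_pos]⟩

theorem IsAmmannTiling.amalgamation_tiling : IsTiling (amalgamation T) := by
  have hs := s_pos.ne'
  have hinj : Function.Injective (fun p : Plane => s • p) := smul_right_injective Plane hs
  refine ⟨fun t ht => ?_, ?_, ?_, ?_⟩
  -- All copies of the bee are homeomorphic, so any tile of `T`, being a disk, shows that the new
  -- tiles are disks.
  · obtain ⟨t₀, ht₀, -⟩ : (0 : Plane) ∈ ⋃₀ T := by rw [hT.tiling.covers]; trivial
    obtain ⟨φ⟩ := hT.tiling.disk t₀ ht₀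
    obtain ⟨k₀, F₀, rfl⟩ := hT.exists_frame ht₀
    obtain ⟨ψ₀⟩ := nonempty_homeomorph_tile F₀ k₀.scale_pos
    obtain ⟨k, F, rfl⟩ := hT.amalgamation_tiles ht
    obtain ⟨ψ⟩ := nonempty_homeomorph_tile F k.scale_pos
    exact ⟨(ψ.symm.trans ψ₀).trans φ⟩
  · rintro _ ⟨X, hX, rfl⟩ _ ⟨Y, hY, rfl⟩ hne
    simp only
    rw [← Set.smul_set_inter₀ hs, interior_smul₀ hs,
      hT.amalgamated_nonoverlapping hX hY fun e => hne (by rw [e]), Set.smul_set_empty]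
  · refine Set.eq_univ_of_forall fun p => ?_
    obtain ⟨X, hX, hp⟩ := hT.amalgamated_covers (s⁻¹ • p)
    exact ⟨s • X, ⟨X, hX, rfl⟩, (Set.mem_smul_set_iff_inv_smul_mem₀ hs _ _).2 hp⟩
  · rintro _ ⟨X, hX, rfl⟩ _ ⟨Y, hY, rfl⟩ hne
    simp only
    rw [← Set.smul_set_inter₀ hs]
    exact (hT.amalgamated_connected hX hY fun e => hne (by rw [e])).image _
      (continuous_const_smul s).continuousOn

/-- The amalgamation of an Ammann tiling is an Ammann tiling. -/
theorem IsAmmannTiling.amalgamation : IsAmmannTiling (amalgamation T) := by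
  refine ⟨hT.amalgamation_tiling, fun t ht => ?_, hT.amalgamation_matching⟩
  obtain ⟨k, F, rfl⟩ := hT.amalgamation_tiles ht
  cases k
  · exact Or.inl (isLarge_iff.2 ⟨F, rfl⟩)
  · exact Or.inr (isSmall_iff.2 ⟨F, rfl⟩)

end

end AmmannA2

theorem proposition4p1 (T : Set (Set AmmannA2.Plane)) (hT : AmmannA2.IsAmmannTiling T) :
    (∀ t ∈ T, AmmannA2.IsSmall t → ∃! b, AmmannA2.IsPartner T t b) ∧
    (∀ t t' b, AmmannA2.IsPartner T t b → AmmannA2.IsPartner T t' b → t = t') ∧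
    AmmannA2.IsAmmannTiling (AmmannA2.amalgamation T) := by
  refine ⟨fun t ht hs => ?_, fun t t' b h h' => h.unique_small h', hT.amalgamation⟩
  obtain ⟨F, rfl⟩ := AmmannA2.isSmall_iff.1 hs
  exact ⟨_, hT.isPartner ht, fun b h => h.unique_large (hT.isPartner ht)⟩
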